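/- **Conventions.** Let $\Sigma=\{0,1,\sharp\}$. For a binary predicate $A\subseteq\Sigma^*\times\Sigma^*$ write $A(x)=\{y : A(x,y)\}$; the enumeration problem of $A$ is to list $A(x)$ without repetition on input $x$. It is in $\mathrm{EnumP}$ if $A(x,y)$ is decidable in time polynomial in $|x|+|y|$ and the elements of $A(x)$ have size polynomial in $|x|$. Machines are random access machines with addition, (truncated) subtraction and multiplication on natural numbers, each of cost linear in the bit size of its operands, all other instructions being of cost $O(1)$; an output instruction produces the word held in special output registers. A randomized RAM may moreover toss fair coins and, at a cost linear in the bit size of $b$, draw uniformly random integers in $\{0,\dots,b\}$. A *polynomial-time uniform generator* for $A$ is a randomized RAM which on every input $x$ stops in time polynomial in $|x|$ and which produces each $y\in A(x)$, as its only output, with probability $1/|A(x)|$. (If $A(x)=\emptyset$, nothing is required of what it outputs.) The enumeration problem of $A$ is in *randomized $\mathrm{IncP}_k$* if it is in $\mathrm{EnumP}$ and there are constants $a,b,c\in\mathbb N$, a polynomial $q$ and a randomized RAM $M$ such that for every $x\in\Sigma^*$ and every rational $\epsilon>0$, with probability greater than $1-\epsilon$, the run of $M$ on input $(x,\epsilon)$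 outputs exactly the elements of $A(x)$, without repetition, produces its $m$-th output after time at most $q(\cdot)+c\,m^k(|x|+1)^a\epsilon^{-b}$ for every $1\le m\le |A(x)|$, and stops after time at most $q(\cdot)+c\,|A(x)|^k(|x|+1)^a\epsilon^{-b}$. Here $q(\cdot)$ is the value of $q$ at the size of the input $(x,\epsilon)$, the numerator and the denominator of $\epsilon$ being written in binary; it accounts for a polynomial-time precomputation. **Theorem.** If the enumeration problem of $A$ is in $\mathrm{EnumP}$ and $A$ has a polynomial-time uniform generator, then it is in randomized $\mathrm{IncP}_1$. Moreover, the dependence of the running time on $\epsilon$ can be made polynomial in $\log(1/\epsilon)$: the conditions in the definition of randomized $\mathrm{IncP}_1$ can be satisfied with $\epsilon^{-b}$ replaced by $(1+\log(1/\epsilon))^{b}$. Both statements also hold if the generator and the enumerating machine may use fair coins only. -/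

import Mathlib

open scoped ENNReal

namespace EnumRAM

/-! ### Random access machines with output registers and random choices -/

/-- Words over the alphabet `{0, 1, ♯}`; the letter `♯` is coded by `2`. -/
abbrev Word : Type := List (Fin 3)

/-- The sequence of register contents that represents a word. -/
def Word.codes (x : Word) : List ℕ := x.map Fin.val

/-- Instructions of a randomized RAM whose instruction labels are of type `Λ`. `R` denotes the
work registers, `O` the output registers; all registers hold natural numbers. Every instruction
except `jumpZero` and `halt` names the label of the instruction to be executed next. -/
inductive Instr (Λ : Type) : Type
  /-- `R[dst] := n` -/
  | const (dst n : ℕ) (next : Λ)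
  /-- `R[dst] := R[src]` -/
  | copy (dst src : ℕ) (next : Λ)
  /-- `R[dst] := R[R[src]]` -/
  | load (dst src : ℕ) (next : Λ)
  /-- `R[R[dst]] := R[src]` -/
  | store (dst src : ℕ) (next : Λ)
  /-- `R[dst] := R[i] + R[j]` -/
  | add (dst i j : ℕ) (next : Λ)
  /-- `R[dst] := max (R[i] - R[j]) 0` -/
  | sub (dst i j : ℕ) (next : Λ)
  /-- `R[dst] := R[i] * R[j]` -/
  | mul (dst i j : ℕ) (next : Λ)
  /-- `R[dst] :=` a fair random bit -/
  | coin (dst : ℕ) (next : Λ)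
  /-- `R[dst] :=` a uniformly random element of `{0, 1, …, R[src]}` -/
  | random (dst src : ℕ) (next : Λ)
  /-- `if R[src] = 0 then goto yes else goto no` -/
  | jumpZero (src : ℕ) (yes no : Λ)
  /-- `O[R[dst]] := R[src]` -/
  | writeOut (dst src : ℕ) (next : Λ)
  /-- produce the content of the output registers, that is `O[1], …, O[O[0]]` -/
  | output (next : Λ)
  /-- stop -/
  | halt

/-- A RAM: a finite program of labelled instructions together with an initial label. -/
structure Machine : Type 1 where
  /-- the labels -/
  Λ : Type
  /-- there are finitely many labels -/
  finite : Finite Λ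
  /-- the label of the first instruction -/
  start : Λ
  /-- the instruction at each label -/
  code : Λ → Instr Λ

/-- Configurations, which also record the history that matters: the time spent so far, and the
list of all produced outputs in chronological order, each with the time spent before it. -/
structure Cfg (Λ : Type) : Type where
  /-- label of the current instruction -/
  label : Λ
  /-- work registers -/
  R : ℕ → ℕ
  /-- output registers -/
  O : ℕ → ℕ
  /-- sum of the costs of the instructions executed so far -/
  time : ℕ
  /-- the outputs produced so far, each with the sum of the costs of the preceding instructions -/
  outputs : List (List ℕ × ℕ)

namespace Instr

variable {Λ : Type}

/-- Cost of an instruction: constant, except for arithmetic instructions (and for drawing a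
random number below a given bound), whose cost is linear in the bit size of the operands. -/
def cost (R : ℕ → ℕ) : Instr Λ → ℕ
  | add _ i j _ => 1 + (R i).size + (R j).size
  | sub _ i j _ => 1 + (R i).size + (R j).size
  | mul _ i j _ => 1 + (R i).size + (R j).size
  | random _ src _ => 1 + (R src).size
  | halt => 0
  | _ => 1

/-- The uniform distribution on `{0, 1, …, b}`. -/
noncomputable def uniformUpTo (b : ℕ) : PMF ℕ :=
  PMF.uniformOfFinset (Finset.range (b + 1)) Finset.nonempty_range_add_one

/-- Effect of an instruction on a configuration, the time not being updated. -/
noncomputable def effect (c : Cfg Λ) : Instr Λ → PMF (Cfg Λ)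
  | const dst n next => PMF.pure { c with R := Function.update c.R dst n, label := next }
  | copy dst src next =>
      PMF.pure { c with R := Function.update c.R dst (c.R src), label := next }
  | load dst src next =>
      PMF.pure { c with R := Function.update c.R dst (c.R (c.R src)), label := next }
  | store dst src next =>
      PMF.pure { c with R := Function.update c.R (c.R dst) (c.R src), label := next }
  | add dst i j next =>
      PMF.pure { c with R := Function.update c.R dst (c.R i + c.R j), label := next }
  | sub dst i j next =>
      PMF.pure { c with R := Function.update c.R dst (c.R i - c.R j), label := next }
  | mul dst i j next =>
      PMF.pure { c with R := Function.update c.R dst (c.R i * c.R j), label := next }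
  | coin dst next =>
      (uniformUpTo 1).map fun v => { c with R := Function.update c.R dst v, label := next }
  | random dst src next =>
      (uniformUpTo (c.R src)).map fun v =>
        { c with R := Function.update c.R dst v, label := next }
  | jumpZero src yes no => PMF.pure { c with label := if c.R src = 0 then yes else no }
  | writeOut dst src next =>
      PMF.pure { c with O := Function.update c.O (c.R dst) (c.R src), label := next }
  | output next =>
      PMF.pure
        { c with
          outputs := c.outputs ++ [((List.range (c.O 0)).map fun i => c.O (i + 1), c.time)]
          label := next }
  | halt => PMF.pure c

/-- The instruction makes no random choice. -/
def IsDeterministic : Instr Λ → Prop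
  | coin _ _ => False
  | random _ _ _ => False
  | _ => True

end Instr

/-- The two usual sources of randomness: fair coins only, or fair coins together with uniformly
random integers below a computed bound. -/
inductive RandomSource : Type
  | coin
  | uniform

/-- The random choices made by the instruction, if any, are available from the source. -/
def Instr.AllowedBy {Λ : Type} : RandomSource → Instr Λ → Prop
  | .coin, .random _ _ _ => False
  | _, _ => True

namespace Machine

/-- A randomized RAM with the given source of randomness. -/
def IsRandomized (S : RandomSource) (M : Machine) : Prop := ∀ l, (M.code l).AllowedBy S

/-- A deterministic RAM. -/
def IsDeterministic (M : Machine) : Prop := ∀ l, (M.code l).IsDeterministic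

/-- The initial configuration: the input is in the first registers, all others contain `0`. -/
def init (M : Machine) (input : List ℕ) : Cfg M.Λ where
  label := M.start
  R := fun i => input.getD i 0
  O := fun _ => 0
  time := 0
  outputs := []

/-- The random configuration after one step; a halted configuration does not change. -/
noncomputable def step (M : Machine) (c : Cfg M.Λ) : PMF (Cfg M.Λ) :=
  ((M.code c.label).effect c).map fun c' =>
    { c' with time := c.time + (M.code c.label).cost c.R }

/-- The random configuration after `N` steps. -/
noncomputable def run (M : Machine) (input : List ℕ) : ℕ → PMF (Cfg M.Λ)
  | 0 => PMF.pure (M.init input)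
  | N + 1 => (M.run input N).bind M.step

/-- The machine has stopped. -/
def Halted (M : Machine) (c : Cfg M.Λ) : Prop := M.code c.label = Instr.halt

/-- The probability that the machine, on the given input, eventually stops, in a configuration
that satisfies `E` (the events below are increasing in `N`). -/
noncomputable def prob (M : Machine) (input : List ℕ) (E : Cfg M.Λ → Prop) : ℝ≥0∞ :=
  ⨆ N, (M.run input N).toOuterMeasure {c | M.Halted c ∧ E c}

end Machine

/-! ### Inputs -/

/-- Input consisting of a word: its length, then its letters. -/
def inputWord (x : Word) : List ℕ := x.length :: x.codes

/-- Input consisting of two words: their lengths, then their letters. -/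
def inputPair (x y : Word) : List ℕ := x.length :: y.length :: (x.codes ++ y.codes)

/-- Input consisting of a word and a positive rational: the length of the word, the numerator
and the denominator of the rational, then the letters of the word. -/
def inputWordRat (x : Word) (ε : ℚ) : List ℕ := x.length :: ε.num.toNat :: ε.den :: x.codes

/-- The size of the input `(x, ε)`: the length of `x` plus the number of bits of `ε`. -/
def sizeWordRat (x : Word) (ε : ℚ) : ℕ := x.length + ε.num.toNat.size + ε.den.size

/-! ### Enumeration problems and their complexity -/

/-- `A` is decidable in polynomial time (acceptance is a nonzero final value in register `0`). -/
def PolyTimeDecidable (A : Word → Word → Prop) : Prop :=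
  ∃ (M : Machine) (c d : ℕ), M.IsDeterministic ∧ ∀ x y : Word,
    M.prob (inputPair x y)
      (fun z => z.time ≤ c * (x.length + y.length + 1) ^ d ∧ (z.R 0 ≠ 0 ↔ A x y)) = 1

/-- `A` is polynomially balanced. -/
def PolyBalanced (A : Word → Word → Prop) : Prop :=
  ∃ c d : ℕ, ∀ x y : Word, A x y → y.length ≤ c * (x.length + 1) ^ d

/-- The enumeration problem of `A` is in `EnumP`. -/
def EnumP (A : Word → Word → Prop) : Prop := PolyTimeDecidable A ∧ PolyBalanced A

/-- `A` has a polynomial-time uniform generator: a randomized RAM which, on every input `x`,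
stops (almost surely) in time polynomial in `|x|`, and produces each `y ∈ A(x)`, as its only
output, with probability `1 / |A(x)|`. -/
def HasUniformGenerator (S : RandomSource) (A : Word → Word → Prop) : Prop :=
  ∃ (M : Machine) (c d : ℕ), M.IsRandomized S ∧ ∀ x : Word,
    M.prob (inputWord x) (fun z => z.time ≤ c * (x.length + 1) ^ d) = 1 ∧
    ∀ y : Word, A x y →
      M.prob (inputWord x) (fun z => z.outputs.map Prod.fst = [y.codes]) =
        ((Set.ncard {y' : Word | A x y'} : ℕ) : ℝ≥0∞)⁻¹

/-- The finished run that ends in `z` has enumerated `A(x)`, without repetition, its `m`-th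
output being produced after time at most `pre + f m` for every `1 ≤ m ≤ |A(x)|`, and it has
stopped in time at most `pre + f |A(x)|`. Here `pre` is the time granted to a precomputation. -/
def EnumeratesInTime {Λ : Type} (A : Word → Word → Prop) (x : Word) (pre : ℝ) (f : ℕ → ℝ)
    (z : Cfg Λ) : Prop :=
  (∃ ys : List Word, ys.Nodup ∧ (∀ y, y ∈ ys ↔ A x y) ∧
      z.outputs.map Prod.fst = ys.map Word.codes) ∧
  (∀ (i : ℕ) (h : i < z.outputs.length), ((z.outputs[i].2 : ℕ) : ℝ) ≤ pre + f (i + 1)) ∧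
  (z.time : ℝ) ≤ pre + f z.outputs.length

/-- There is a randomized RAM which, on input `x` and `ε`, with probability greater than `1 - ε`
enumerates `A(x)` in incremental time `c * m ^ k * (|x| + 1) ^ a * (g ε) ^ b`, after a
precomputation in time polynomial in the size of the input `(x, ε)`. -/
def HasRandomizedEnumeration (S : RandomSource) (k : ℕ) (g : ℝ → ℝ)
    (A : Word → Word → Prop) : Prop :=
  ∃ (M : Machine) (a b c d e : ℕ), M.IsRandomized S ∧ ∀ (x : Word) (ε : ℚ), 0 < ε →
    1 - (ε : ℝ) <
      (M.prob (inputWordRat x ε)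
        (EnumeratesInTime A x ((d : ℝ) * ((sizeWordRat x ε : ℝ) + 1) ^ e)
          (fun m => (c : ℝ) * (m : ℝ) ^ k * ((x.length : ℝ) + 1) ^ a * g ε ^ b))).toReal

/-- The enumeration problem of `A` is in randomized `IncP_k`. -/
def RandomizedIncP (S : RandomSource) (k : ℕ) (A : Word → Word → Prop) : Prop :=
  EnumP A ∧ HasRandomizedEnumeration S k (fun ε => ε⁻¹) A

end EnumRAM

namespace EnumRAM

/-! The machine draws words from the generator, checks each with the decision procedure, looks it up
in a dictionary, and outputs it if it is new. It cannot know `|A(x)|`, so a budget decides when to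
stop: it starts at `L`, every draw costs one unit, every new element pays `L` units, and the machine
stops at zero. Hence, on every run, at most `L * m` draws are made up to and including the `m`-th
output, and at most `L * (|A(x)| + 1)` in all. If `L` and the time of a draw are polynomial in `|x|`
and `log (1/ε)`, the enumeration is linear in `m`; the extra `L` draws at the end are charged to the
precomputation.

Let `n = |A(x)| > 0`. If the budget runs out when exactly the words of `S` have been found, with `m
= |S| < n`, then all `L * (m + 1)` draws fell into `S`, which has probability at most
`(m/n)^(L(m+1))`. Summing over `S` bounds the failure probability. `failBound` is this union bound
seen from an intermediate state; `sum_failBound_le` says that it does not increase on average under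
a draw, `one_le_failBound_zero` that it is at least 1 in a failed state, and `main_spec` concludes
by induction on the number of draws still possible. For `n ≤ 2^N` and `L = 2(2N + K)`,
`choose_mul_pow_le` bounds the sets of each size together by `2^-(N+K)`, so that `failBound_le`
gives `2^-K`. The machine takes the least `K` with `den ≤ num * (2^K - 1)`, where `ε = num/den`;
then `2^-K < ε`, and `K = O(1 + log (1/ε))` by `log_le_log`. If `A(x)` is empty, the first draw is
rejected or yields nothing, and the machine stops at once (`main_spec_of_empty`).

The rest is implementation. Probabilities are computed by first-step analysis
(`Machine.value_eq_avg`), and the program is a flow chart whose blocks make at most one random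
choice. Every draw runs the generator, cut off at its first output, and the decision procedure in
fresh regions of memory, so nothing has to be erased; `Flow.value_le_val_of_sim` carries expected
values through a simulation. The number of regions may be exponential, but addresses have
polynomially many bits. An almost sure time bound holds on every reachable path
(`Machine.Reach.time_le`), which bounds the simulated registers on all paths. The only random
instructions are those of the generator, so both sources of randomness are treated at once. -/

/-! ### Averages -/

/-- The mean of `f 0, …, f b`. -/
noncomputable def avg (b : ℕ) (f : ℕ → ℝ≥0∞) : ℝ≥0∞ :=
  ((b : ℝ≥0∞) + 1)⁻¹ * ∑ v ∈ Finset.range (b + 1), f v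

theorem natCast_add_one_inv_mul_self (b : ℕ) : ((b : ℝ≥0∞) + 1)⁻¹ * ((b : ℝ≥0∞) + 1) = 1 :=
  ENNReal.inv_mul_cancel (by simp) (by simp)

theorem avg_zero (f : ℕ → ℝ≥0∞) : avg 0 f = f 0 := by simp [avg]

theorem avg_mono {b : ℕ} {f g : ℕ → ℝ≥0∞} (h : ∀ v ≤ b, f v ≤ g v) : avg b f ≤ avg b g := by
  unfold avg
  gcongr with v hv
  exact h v (by simpa [Nat.lt_succ_iff] using hv)

theorem avg_const (b : ℕ) (a : ℝ≥0∞) : avg b (fun _ => a) = a := by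
  simp only [avg, Finset.sum_const, Finset.card_range, nsmul_eq_mul, Nat.cast_add, Nat.cast_one]
  rw [← mul_assoc, natCast_add_one_inv_mul_self, one_mul]

theorem avg_mul_const (b : ℕ) (f : ℕ → ℝ≥0∞) (a : ℝ≥0∞) :
    avg b (fun v => f v * a) = avg b f * a := by
  simp only [avg, ← Finset.sum_mul, mul_assoc]

theorem avg_sum {ι : Type*} (s : Finset ι) (b : ℕ) (f : ι → ℕ → ℝ≥0∞) :
    avg b (fun v => ∑ i ∈ s, f i v) = ∑ i ∈ s, avg b (f i) := by
  simp only [avg, ← Finset.mul_sum]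
  rw [Finset.sum_comm]

theorem avg_iSup (b : ℕ) (f : ℕ → ℕ → ℝ≥0∞) (hf : ∀ v, Monotone fun N => f N v) :
    avg b (fun v => ⨆ N, f N v) = ⨆ N, avg b (f N) := by
  simp only [avg]
  rw [ENNReal.finsetSum_iSup_of_monotone (fun v => hf v), ENNReal.mul_iSup]

/-- The total is `b + 1`, and the other `b` terms contribute at most `b`. This turns almost sure
statements into statements about every possible random choice. -/
theorem eq_one_of_avg_eq_one {b : ℕ} {f : ℕ → ℝ≥0∞} (h1 : ∀ v, f v ≤ 1) (h : avg b f = 1)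
    {v : ℕ} (hv : v ≤ b) : f v = 1 := by
  have hsum : ∑ v ∈ Finset.range (b + 1), f v = (b : ℝ≥0∞) + 1 := by
    have := congrArg (fun t => ((b : ℝ≥0∞) + 1) * t) h
    simp only [avg, mul_one] at this
    rwa [← mul_assoc, mul_comm ((b : ℝ≥0∞) + 1), natCast_add_one_inv_mul_self, one_mul] at this
  have hmem : v ∈ Finset.range (b + 1) := by simp; omega
  rw [← Finset.add_sum_erase _ _ hmem] at hsum
  have hle : ∑ w ∈ (Finset.range (b + 1)).erase v, f w ≤ (b : ℝ≥0∞) := by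
    refine (Finset.sum_le_sum fun w _ => h1 w).trans ?_
    simp [Finset.card_erase_of_mem hmem]
  refine le_antisymm (h1 v) ?_
  have h2 : (b : ℝ≥0∞) + 1 ≤ b + f v := by
    rw [← hsum, add_comm]; gcongr
  exact (ENNReal.add_le_add_iff_left (by simp)).1 h2

theorem toOuterMeasure_uniformUpTo_bind {α : Type} (b : ℕ) (h : ℕ → PMF α) (s : Set α) :
    ((Instr.uniformUpTo b).bind h).toOuterMeasure s = avg b fun v => (h v).toOuterMeasure s := by
  classical
  rw [PMF.toOuterMeasure_bind_apply, tsum_eq_sum (s := Finset.range (b + 1))]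
  · simp only [avg, Finset.mul_sum]
    refine Finset.sum_congr rfl fun v hv => ?_
    rw [Instr.uniformUpTo, PMF.uniformOfFinset_apply_of_mem _ hv]
    simp
  · intro v hv
    rw [Instr.uniformUpTo, PMF.uniformOfFinset_apply_of_notMem _ hv, zero_mul]

theorem uniformUpTo_zero : Instr.uniformUpTo 0 = PMF.pure 0 := by
  ext v
  simp [Instr.uniformUpTo, PMF.uniformOfFinset_apply, PMF.pure_apply]

/-! ### Steps with a prescribed random choice -/

namespace Instr

variable {Λ : Type}

/-- The largest value that the random choice of the instruction can take. -/
def bound (R : ℕ → ℕ) : Instr Λ → ℕ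
  | coin _ _ => 1
  | random _ src _ => R src
  | _ => 0

/-- The effect of the instruction if its random choice, if any, is `v`. -/
def outcome (v : ℕ) (c : Cfg Λ) : Instr Λ → Cfg Λ
  | const dst n next => { c with R := Function.update c.R dst n, label := next }
  | copy dst src next => { c with R := Function.update c.R dst (c.R src), label := next }
  | load dst src next => { c with R := Function.update c.R dst (c.R (c.R src)), label := next }
  | store dst src next => { c with R := Function.update c.R (c.R dst) (c.R src), label := next }
  | add dst i j next => { c with R := Function.update c.R dst (c.R i + c.R j), label := next }
  | sub dst i j next => { c with R := Function.update c.R dst (c.R i - c.R j), label := next }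
  | mul dst i j next => { c with R := Function.update c.R dst (c.R i * c.R j), label := next }
  | coin dst next => { c with R := Function.update c.R dst v, label := next }
  | random dst _ next => { c with R := Function.update c.R dst v, label := next }
  | jumpZero src yes no => { c with label := if c.R src = 0 then yes else no }
  | writeOut dst src next => { c with O := Function.update c.O (c.R dst) (c.R src), label := next }
  | output next =>
      { c with
        outputs := c.outputs ++ [((List.range (c.O 0)).map fun i => c.O (i + 1), c.time)]
        label := next }
  | halt => c

/-- Deterministic instructions count as a uniform choice from `{0}`, so that a single recursion
treats all instructions. -/
theorem effect_eq (c : Cfg Λ) (i : Instr Λ) :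
    i.effect c = (uniformUpTo (i.bound c.R)).map fun v => i.outcome v c := by
  cases i <;> simp [effect, outcome, bound, uniformUpTo_zero, PMF.pure_map]

end Instr

namespace Machine

variable (M : Machine)

/-- The next configuration if the random choice, if any, is `v`. -/
def stepWith (v : ℕ) (c : Cfg M.Λ) : Cfg M.Λ :=
  { (M.code c.label).outcome v c with time := c.time + (M.code c.label).cost c.R }

theorem step_eq (c : Cfg M.Λ) :
    M.step c = (Instr.uniformUpTo ((M.code c.label).bound c.R)).map fun v => M.stepWith v c := by
  rw [step, Instr.effect_eq, PMF.map_comp]; rfl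

/-! ### First-step analysis of expected values at halting. -/

/-- The expected value of `Φ` after `N` steps, on the event that the machine has halted. -/
noncomputable def ev (Φ : Cfg M.Λ → ℝ≥0∞) : ℕ → Cfg M.Λ → ℝ≥0∞
  | 0, c => open Classical in if M.Halted c then Φ c else 0
  | N + 1, c => avg ((M.code c.label).bound c.R) fun v => ev Φ N (M.stepWith v c)

/-- The expected value of `Φ` when the machine halts. -/
noncomputable def value (Φ : Cfg M.Λ → ℝ≥0∞) (c : Cfg M.Λ) : ℝ≥0∞ := ⨆ N, M.ev Φ N c

/-- The indicator function of an event. -/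
noncomputable def ind {α : Type} (E : α → Prop) (c : α) : ℝ≥0∞ :=
  open Classical in if E c then 1 else 0

variable {M}

theorem ind_le_one {α : Type} (E : α → Prop) (c : α) : ind E c ≤ 1 := by
  unfold ind; split_ifs <;> simp

/-- The random configuration `N` steps after `c`. -/
noncomputable def runFrom (M : Machine) : ℕ → Cfg M.Λ → PMF (Cfg M.Λ)
  | 0, c => PMF.pure c
  | N + 1, c => (M.step c).bind (M.runFrom N)

/-- `run` splits off the last step and `runFrom` the first; moving one step at a time across the
bind identifies them. -/
theorem run_bind_runFrom (input : List ℕ) (N K : ℕ) :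
    (M.run input N).bind (M.runFrom K) = M.runFrom (N + K) (M.init input) := by
  induction N generalizing K with
  | zero => simp [run]
  | succ N ih =>
    rw [run, PMF.bind_bind, show N + 1 + K = N + (K + 1) by ring, ← ih]
    rfl

theorem run_eq_runFrom (input : List ℕ) (N : ℕ) :
    M.run input N = M.runFrom N (M.init input) := by
  have h : M.runFrom 0 = PMF.pure := by funext c; rfl
  have := run_bind_runFrom (M := M) input N 0
  rwa [h, PMF.bind_pure, add_zero] at this

theorem toOuterMeasure_runFrom (E : Cfg M.Λ → Prop) (N : ℕ) (c : Cfg M.Λ) :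
    (M.runFrom N c).toOuterMeasure {c | M.Halted c ∧ E c} = M.ev (ind E) N c := by
  classical
  induction N generalizing c with
  | zero =>
    simp only [runFrom, PMF.toOuterMeasure_pure_apply, Set.mem_ofPred_eq, ev, ind]
    by_cases h : M.Halted c <;> simp [h]
  | succ N ih =>
    rw [runFrom, step_eq, PMF.bind_map, toOuterMeasure_uniformUpTo_bind, ev]
    congr 1
    funext v
    exact ih _

theorem prob_eq_value (M : Machine) (input : List ℕ) (E : Cfg M.Λ → Prop) :
    M.prob input E = M.value (ind E) (M.init input) := by
  simp only [prob, value, run_eq_runFrom, toOuterMeasure_runFrom]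

/-- Since `halt` costs nothing, a halted configuration, including its clock, is a fixed point of the
step. -/
theorem ev_halted {Φ : Cfg M.Λ → ℝ≥0∞} {c : Cfg M.Λ} (h : M.Halted c) (N : ℕ) :
    M.ev Φ N c = Φ c := by
  have h' : M.code c.label = Instr.halt := h
  have hs : M.stepWith 0 c = c := by simp [stepWith, h', Instr.outcome, Instr.cost]
  induction N with
  | zero => simp [ev, h]
  | succ N ih => simpa [ev, h', Instr.bound, avg_zero, hs] using ih

theorem ev_mono (Φ : Cfg M.Λ → ℝ≥0∞) (c : Cfg M.Λ) : Monotone fun N => M.ev Φ N c := by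
  refine monotone_nat_of_le_succ fun N => ?_
  induction N generalizing c with
  | zero =>
    by_cases h : M.Halted c
    · rw [ev_halted h, ev_halted h]
    · simp [ev, h]
  | succ N ih => exact avg_mono fun v _ => ih _

theorem value_halted {Φ : Cfg M.Λ → ℝ≥0∞} {c : Cfg M.Λ} (h : M.Halted c) :
    M.value Φ c = Φ c := by
  simp [value, ev_halted h]

/-- The supremum over the number of steps passes through the finite mean because the expectations
increase with that number. -/
theorem value_eq_avg (Φ : Cfg M.Λ → ℝ≥0∞) (c : Cfg M.Λ) :
    M.value Φ c =
      avg ((M.code c.label).bound c.R) fun v => M.value Φ (M.stepWith v c) := by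
  unfold value
  rw [avg_iSup _ (fun N v => M.ev Φ N (M.stepWith v c)) fun v => ev_mono Φ _]
  refine le_antisymm (iSup_le fun N => ?_) (iSup_le fun N => ?_)
  · exact le_trans (ev_mono Φ c (Nat.le_succ N)) (le_iSup (fun N => avg _ _) N)
  · exact le_iSup (fun N => M.ev Φ N c) (N + 1)

theorem value_eq_avg_of_code (Φ : Cfg M.Λ → ℝ≥0∞) {c : Cfg M.Λ} {i : Instr M.Λ}
    (h : M.code c.label = i) : M.value Φ c = avg (i.bound c.R) fun v =>
      M.value Φ { i.outcome v c with time := c.time + i.cost c.R } := by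
  subst h
  exact value_eq_avg Φ c

theorem ev_mono_of_le {Φ Ψ : Cfg M.Λ → ℝ≥0∞} (h : ∀ c, M.Halted c → Φ c ≤ Ψ c) (N : ℕ)
    (c : Cfg M.Λ) : M.ev Φ N c ≤ M.ev Ψ N c := by
  induction N generalizing c with
  | zero => unfold ev; split_ifs with hc <;> simp [h c, hc]
  | succ N ih => exact avg_mono fun v _ => ih _

theorem ev_const_le (a : ℝ≥0∞) (N : ℕ) (c : Cfg M.Λ) : M.ev (fun _ => a) N c ≤ a := by
  induction N generalizing c with
  | zero => unfold ev; split_ifs <;> simp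
  | succ N ih => exact (avg_mono fun v _ => ih _).trans (avg_const _ _).le

theorem ev_ind_le_one (E : Cfg M.Λ → Prop) (N : ℕ) (c : Cfg M.Λ) : M.ev (ind E) N c ≤ 1 :=
  (ev_mono_of_le (fun c _ => ind_le_one E c) N c).trans (ev_const_le 1 N c)

theorem value_ind_le_one (E : Cfg M.Λ → Prop) (c : Cfg M.Λ) : M.value (ind E) c ≤ 1 :=
  iSup_le fun N => ev_ind_le_one E N c

theorem ev_sum {ι : Type*} (s : Finset ι) (Φ : ι → Cfg M.Λ → ℝ≥0∞) (a : ι → ℝ≥0∞) (N : ℕ)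
    (c : Cfg M.Λ) :
    M.ev (fun c => ∑ i ∈ s, Φ i c * a i) N c = ∑ i ∈ s, M.ev (Φ i) N c * a i := by
  induction N generalizing c with
  | zero => unfold ev; split_ifs <;> simp
  | succ N ih =>
    simp only [ev, ih, avg_sum]
    exact Finset.sum_congr rfl fun i _ => avg_mul_const _ _ _

/-- Linearity lets the outcomes of a simulated run be weighted by the success probabilities of what
follows. -/
theorem value_sum {ι : Type*} (s : Finset ι) (Φ : ι → Cfg M.Λ → ℝ≥0∞) (a : ι → ℝ≥0∞)
    (c : Cfg M.Λ) :
    M.value (fun c => ∑ i ∈ s, Φ i c * a i) c = ∑ i ∈ s, M.value (Φ i) c * a i := by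
  simp only [value, ev_sum, ENNReal.iSup_mul]
  rw [ENNReal.finsetSum_iSup_of_monotone]
  intro i N N' h
  dsimp only
  gcongr
  exact ev_mono _ _ h

/-! ### Reachable configurations -/

/-- `c` can occur in a run that starts in `c₀`. -/
inductive Reach (c₀ : Cfg M.Λ) : Cfg M.Λ → Prop
  | refl : Reach c₀ c₀
  | step {c : Cfg M.Λ} (v : ℕ) (h : Reach c₀ c) (hv : v ≤ (M.code c.label).bound c.R) :
      Reach c₀ (M.stepWith v c)

theorem time_le_stepWith (v : ℕ) (c : Cfg M.Λ) : c.time ≤ (M.stepWith v c).time := by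
  simp [stepWith]

theorem ev_eq_zero_of_time {E : Cfg M.Λ → Prop} {T : ℕ} (hE : ∀ c, E c → c.time ≤ T) (N : ℕ)
    (c : Cfg M.Λ) (hc : T < c.time) : M.ev (ind E) N c = 0 := by
  induction N generalizing c with
  | zero =>
    have : ¬ E c := fun h => by have := hE c h; omega
    simp [ev, ind, this]
  | succ N ih =>
    simp only [ev]
    rw [← avg_const ((M.code c.label).bound c.R) 0]
    congr 1
    funext v
    exact ih _ (hc.trans_le (time_le_stepWith v c))

/-- By `eq_one_of_avg_eq_one`, probability one at a configuration is inherited by each of its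
possible successors. -/
theorem Reach.value_eq_one {E : Cfg M.Λ → Prop} {c₀ c : Cfg M.Λ}
    (h₀ : M.value (ind E) c₀ = 1) (h : Reach c₀ c) : M.value (ind E) c = 1 := by
  induction h with
  | refl => exact h₀
  | step v _ hv ih =>
    rw [value_eq_avg] at ih
    exact eq_one_of_avg_eq_one (fun v => value_ind_le_one E _) ih hv

/-- Time never decreases, so past time `T` the event would have probability zero instead of one. The
almost sure time bound thus becomes a bound on every path, which a simulation in bounded memory
needs. -/
theorem Reach.time_le {E : Cfg M.Λ → Prop} {T : ℕ} (hE : ∀ c, E c → c.time ≤ T)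
    {c₀ c : Cfg M.Λ} (h₀ : M.value (ind E) c₀ = 1) (h : Reach c₀ c) : c.time ≤ T := by
  by_contra hc
  have h1 := h.value_eq_one h₀
  simp [value, ev_eq_zero_of_time hE _ c (not_le.1 hc)] at h1

theorem value_mono_of_reach {Φ Ψ : Cfg M.Λ → ℝ≥0∞} {c₀ : Cfg M.Λ}
    (h : ∀ c, Reach c₀ c → M.Halted c → Φ c ≤ Ψ c) : M.value Φ c₀ ≤ M.value Ψ c₀ := by
  have key : ∀ N c, Reach c₀ c → M.ev Φ N c ≤ M.ev Ψ N c := by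
    intro N
    induction N with
    | zero => intro c hc; unfold ev; split_ifs with hh <;> simp [h c hc, hh]
    | succ N ih => intro c hc; exact avg_mono fun v hv => ih _ (hc.step v hv)
  exact iSup_mono fun N => key N c₀ .refl

/-- The largest constant that occurs in an instruction. -/
def _root_.EnumRAM.Instr.maxConst {Λ : Type} : Instr Λ → ℕ
  | .const d n _ => max d n
  | .copy d s _ => max d s
  | .load d s _ => max d s
  | .store d s _ => max d s
  | .add d i j _ => max d (max i j)
  | .sub d i j _ => max d (max i j)
  | .mul d i j _ => max d (max i j)
  | .coin d _ => d
  | .random d s _ => max d s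
  | .jumpZero s _ _ => s
  | .writeOut d s _ => max d s
  | _ => 0

theorem exists_maxConst (M : Machine) : ∃ C, ∀ l, (M.code l).maxConst < C := by
  have := M.finite
  obtain ⟨C, hC⟩ := (Set.finite_range fun l => (M.code l).maxConst).bddAbove
  exact ⟨C + 1, fun l => Nat.lt_succ_of_le (hC ⟨l, rfl⟩)⟩

/-- All registers of the configuration hold numbers of at most `s + time` bits. -/
def Sized (s : ℕ) (c : Cfg M.Λ) : Prop :=
  (∀ i, (c.R i).size ≤ s + c.time) ∧ ∀ i, (c.O i).size ≤ s + c.time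

theorem size_add_le (a b : ℕ) : (a + b).size ≤ max a.size b.size + 1 := by
  rw [Nat.size_le]
  have ha := (Nat.lt_size_self a).trans_le (Nat.pow_le_pow_right two_pos (le_max_left a.size b.size))
  have hb := (Nat.lt_size_self b).trans_le (Nat.pow_le_pow_right two_pos (le_max_right a.size b.size))
  rw [pow_succ]; omega

theorem size_mul_le (a b : ℕ) : (a * b).size ≤ a.size + b.size := by
  rw [Nat.size_le, pow_add]
  exact Nat.mul_lt_mul'' (Nat.lt_size_self a) (Nat.lt_size_self b)

/-- An addition or a multiplication lengthens numbers by no more than its cost; constants are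
covered by `s`, and a random number is at most its bound. -/
theorem Sized.stepWith {s v : ℕ} {c : Cfg M.Λ} (h : Sized s c)
    (hs : ∀ l, (M.code l).maxConst ≤ s) (hv : v ≤ (M.code c.label).bound c.R) :
    Sized s (M.stepWith v c) := by
  have upd : ∀ (f : ℕ → ℕ) (B d w : ℕ), (∀ i, (f i).size ≤ B) → w.size ≤ B →
      ∀ i, (Function.update f d w i).size ≤ B := by
    intro f B d w hf hw i
    rw [Function.update_apply]; split_ifs
    exacts [hw, hf i]
  have size_self : ∀ n : ℕ, n.size ≤ n := fun n => Nat.size_le.2 (Nat.lt_two_pow_self)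
  obtain ⟨hR, hO⟩ := h
  have hR' : ∀ k i, (c.R i).size ≤ s + (c.time + k) := fun k i => (hR i).trans (by omega)
  have hO' : ∀ k i, (c.O i).size ≤ s + (c.time + k) := fun k i => (hO i).trans (by omega)
  have hl := hs c.label
  unfold Sized Machine.stepWith
  cases hc : M.code c.label with
  | const d n _ =>
    simp only [hc, Instr.outcome, Instr.maxConst] at hl ⊢
    refine ⟨upd _ _ _ _ (hR' _) ?_, hO' _⟩
    have := size_self n
    omega
  | copy d i _ => exact ⟨upd _ _ _ _ (hR' _) (hR' _ _), hO' _⟩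
  | load d i _ => exact ⟨upd _ _ _ _ (hR' _) (hR' _ _), hO' _⟩
  | store d i _ => exact ⟨upd _ _ _ _ (hR' _) (hR' _ _), hO' _⟩
  | add d i j _ =>
    refine ⟨upd _ _ _ _ (hR' _) ((size_add_le _ _).trans ?_), hO' _⟩
    simp only [Instr.cost]; omega
  | sub d i j _ =>
    refine ⟨upd _ _ _ _ (hR' _) ?_, hO' _⟩
    exact (Nat.size_le_size (Nat.sub_le _ _)).trans (hR' _ _)
  | mul d i j _ =>
    refine ⟨upd _ _ _ _ (hR' _) ((size_mul_le _ _).trans ?_), hO' _⟩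
    simp only [Instr.cost]; omega
  | coin d _ =>
    simp only [hc, Instr.bound] at hv
    refine ⟨upd _ _ _ _ (hR' _) ((size_self v).trans ?_), hO' _⟩
    simp only [Instr.cost]; omega
  | random d i _ =>
    simp only [hc, Instr.bound] at hv
    exact ⟨upd _ _ _ _ (hR' _) ((Nat.size_le_size hv).trans (hR' _ _)), hO' _⟩
  | jumpZero i _ _ => exact ⟨hR' _, hO' _⟩
  | writeOut d i _ => exact ⟨hR' _, upd _ _ _ _ (hO' _) (hR' _ _)⟩
  | output _ => exact ⟨hR' _, hO' _⟩
  | halt => exact ⟨hR' _, hO' _⟩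

/-! ### Stopping at the first output -/

/-- The machine that stops instead of producing an output. -/
def untilOutput (M : Machine) : Machine where
  Λ := M.Λ
  finite := M.finite
  start := M.start
  code l := match M.code l with
    | .output _ => .halt
    | i => i

/-- The content of the output registers. -/
def _root_.EnumRAM.Cfg.word {Λ : Type} (c : Cfg Λ) : List ℕ :=
  (List.range (c.O 0)).map fun i => c.O (i + 1)

/-- The next instruction of `M` is an output instruction. -/
def AtOutput (M : Machine) (l : M.Λ) : Prop := ∃ n, M.code l = .output n

theorem outputs_prefix (v : ℕ) (c : Cfg M.Λ) : c.outputs <+: (M.stepWith v c).outputs := by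
  unfold stepWith
  cases M.code c.label <;> simp [Instr.outcome]

/-- The list of outputs only grows, so a wrong beginning cannot be repaired. -/
theorem ev_eq_zero_of_outputs {w : List ℕ} {c : Cfg M.Λ} (N : ℕ)
    (hc : ¬ c.outputs.map Prod.fst <+: [w]) :
    M.ev (ind fun c => c.outputs.map Prod.fst = [w]) N c = 0 := by
  induction N generalizing c with
  | zero =>
    have : ¬ c.outputs.map Prod.fst = [w] := fun h => hc (h ▸ List.prefix_rfl)
    simp [ev, ind, this]
  | succ N ih =>
    simp only [ev]
    rw [← avg_const ((M.code c.label).bound c.R) 0]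
    congr 1
    funext v
    exact ih fun h => hc (((outputs_prefix v c).map Prod.fst).trans h)

theorem untilOutput_code_of_not {l : M.Λ} (h : ¬ M.AtOutput l) :
    M.untilOutput.code l = M.code l := by
  unfold untilOutput
  dsimp only
  split
  · rename_i n hn; exact absurd ⟨n, hn⟩ h
  · rfl

theorem untilOutput_code_of {l : M.Λ} (h : M.AtOutput l) :
    M.untilOutput.code l = .halt := by
  obtain ⟨n, hn⟩ := h
  unfold untilOutput
  dsimp only
  rw [hn]

/-- If `w` is the only output, it is in the output registers when the first output instruction is
reached. The inequality can be strict, since `M` might produce further outputs; lower bounds are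
enough because those for the elements of `A(x)` already sum to 1. -/
theorem ev_le_ev_untilOutput (w : List ℕ) (N : ℕ) (c : Cfg M.Λ) (hc : c.outputs = []) :
    M.ev (ind fun c => c.outputs.map Prod.fst = [w]) N c ≤
      M.untilOutput.ev (ind fun c => M.AtOutput c.label ∧ c.word = w) N c := by
  by_cases ho : M.AtOutput c.label
  · have hh : M.untilOutput.Halted c := untilOutput_code_of ho
    rw [ev_halted hh]
    by_cases hw : c.word = w
    · have : (ind (fun c : Cfg M.untilOutput.Λ => M.AtOutput c.label ∧ c.word = w) c) = 1 := by
        unfold ind; rw [if_pos ⟨ho, hw⟩]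
      rw [this]
      exact ev_ind_le_one _ _ _
    · obtain ⟨n, hn⟩ := ho
      cases N with
      | zero => simp [ev, Halted, hn]
      | succ N =>
        simp only [ev, hn, Instr.bound, avg_zero]
        rw [ev_eq_zero_of_outputs]
        · exact zero_le
        · have : (M.stepWith 0 c).outputs = [(c.word, c.time)] := by
            simp [stepWith, hn, Instr.outcome, hc, Cfg.word]
          simp [this, hw]
  · have hcode := untilOutput_code_of_not ho
    cases N with
    | zero =>
      have : ¬ c.outputs.map Prod.fst = [w] := by simp [hc]
      simp [ev, ind, this]
    | succ N =>
      simp only [ev, hcode]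
      refine avg_mono fun v _ => ?_
      have hs : M.untilOutput.stepWith v c = M.stepWith v c := by
        simp only [stepWith, hcode]; rfl
      rw [hs]
      refine ev_le_ev_untilOutput w N _ ?_
      unfold stepWith
      cases h : M.code c.label <;> simp [Instr.outcome, hc]
      exact ho ⟨_, h⟩

/-- Where the truncated machine differs from `M` it stands still, so all bounds on reachable
configurations carry over. -/
theorem Reach.of_untilOutput {c₀ c : Cfg M.untilOutput.Λ} (h : Reach c₀ c) :
    Reach (M := M) c₀ c := by
  induction h with
  | refl => exact .refl
  | @step c v _ hv ih =>
    by_cases ho : M.AtOutput c.label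
    · have hs : M.untilOutput.stepWith v c = c := by
        simp [stepWith, untilOutput_code_of ho, Instr.outcome, Instr.cost]
      rwa [hs]
    · have hcode := untilOutput_code_of_not ho
      have hs : M.untilOutput.stepWith v c = M.stepWith v c := by
        simp only [stepWith, hcode]; rfl
      rw [hs]
      rw [hcode] at hv
      exact ih.step v hv

end Machine

/-! ### Flow charts -/

/-- Instructions without a next label. -/
inductive Op : Type
  | const (dst n : ℕ)
  | copy (dst src : ℕ)
  | load (dst src : ℕ)
  | store (dst src : ℕ)
  | add (dst i j : ℕ)
  | sub (dst i j : ℕ)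
  | mul (dst i j : ℕ)
  | coin (dst : ℕ)
  | random (dst src : ℕ)
  | writeOut (dst src : ℕ)
  | output

/-- Configurations without the label. -/
structure Mem : Type where
  /-- work registers -/
  R : ℕ → ℕ
  /-- output registers -/
  O : ℕ → ℕ
  /-- time spent so far -/
  time : ℕ
  /-- outputs produced so far, with the times of their production -/
  outputs : List (List ℕ × ℕ)

/-- The configuration without its label. -/
def Cfg.mem {Λ : Type} (c : Cfg Λ) : Mem := ⟨c.R, c.O, c.time, c.outputs⟩

/-- The configuration with the given label. -/
def Mem.at {Λ : Type} (s : Mem) (l : Λ) : Cfg Λ := ⟨l, s.R, s.O, s.time, s.outputs⟩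

/-- The time needed for a jump. -/
def Mem.tick (s : Mem) : Mem := { s with time := s.time + 1 }

namespace Op

/-- The instruction that continues at the label `next`. -/
def instr {Λ : Type} (next : Λ) : Op → Instr Λ
  | const d n => .const d n next
  | copy d s => .copy d s next
  | load d s => .load d s next
  | store d s => .store d s next
  | add d i j => .add d i j next
  | sub d i j => .sub d i j next
  | mul d i j => .mul d i j next
  | coin d => .coin d next
  | random d s => .random d s next
  | writeOut d s => .writeOut d s next
  | output => .output next

/-- The work registers after the operation. -/
def runR (v : ℕ) (R : ℕ → ℕ) : Op → ℕ → ℕ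
  | const d n => Function.update R d n
  | copy d s => Function.update R d (R s)
  | load d s => Function.update R d (R (R s))
  | store d s => Function.update R (R d) (R s)
  | add d i j => Function.update R d (R i + R j)
  | sub d i j => Function.update R d (R i - R j)
  | mul d i j => Function.update R d (R i * R j)
  | coin d => Function.update R d v
  | random d _ => Function.update R d v
  | _ => R

/-- The output registers after the operation. -/
def runO (R O : ℕ → ℕ) : Op → ℕ → ℕ
  | writeOut d s => Function.update O (R d) (R s)
  | _ => O

/-- The largest possible value of the random choice of the operation. -/
def bound (R : ℕ → ℕ) (o : Op) : ℕ := (o.instr ()).bound R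

/-- The cost of the operation. -/
def cost (R : ℕ → ℕ) (o : Op) : ℕ := (o.instr ()).cost R

/-- The effect of the operation if its random choice, if any, is `v`. -/
def exec (v : ℕ) (s : Mem) (o : Op) : Mem where
  R := o.runR v s.R
  O := o.runO s.R s.O
  time := s.time + o.cost s.R
  outputs := match o with
    | output => s.outputs ++ [((List.range (s.O 0)).map fun i => s.O (i + 1), s.time)]
    | _ => s.outputs

/-- The operation makes no random choice. -/
def Det : Op → Prop
  | coin _ => False
  | random _ _ => False
  | _ => True

/-- The operation does not affect the output registers or the list of outputs. -/
def Silent : Op → Prop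
  | writeOut _ _ => False
  | output => False
  | _ => True

theorem Det.bound {o : Op} (h : o.Det) (R : ℕ → ℕ) : o.bound R = 0 := by
  cases o <;> simp_all [Det, Op.bound, instr, Instr.bound]

theorem Det.exec {o : Op} (h : o.Det) (v w : ℕ) (s : Mem) : o.exec v s = o.exec w s := by
  cases o <;> simp_all [Det, Op.exec, runR, runO]

theorem instr_bound {Λ : Type} (o : Op) (n : Λ) (R : ℕ → ℕ) : (o.instr n).bound R = o.bound R := by
  cases o <;> rfl

theorem instr_outcome {Λ : Type} (o : Op) (n l : Λ) (v : ℕ) (s : Mem) :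
    ({ (o.instr n).outcome v (s.at l) with
        time := (s.at l).time + (o.instr n).cost (s.at l).R } : Cfg Λ) = (o.exec v s).at n := by
  cases o <;> rfl

end Op

/-- The work registers after a list of operations. -/
def runL (v : ℕ) : List Op → (ℕ → ℕ) → ℕ → ℕ
  | [], R => R
  | o :: l, R => runL v l (o.runR v R)

/-- The effect of a list of operations, with `v` as the result of every random choice. -/
def execL (v : ℕ) : List Op → Mem → Mem
  | [], s => s
  | o :: l, s => execL v l (o.exec v s)

theorem runL_append (v : ℕ) (l l' : List Op) (R : ℕ → ℕ) :
    runL v (l ++ l') R = runL v l' (runL v l R) := by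
  induction l generalizing R with
  | nil => rfl
  | cons o l ih => exact ih _

theorem execL_append (v : ℕ) (l l' : List Op) (s : Mem) :
    execL v (l ++ l') s = execL v l' (execL v l s) := by
  induction l generalizing s with
  | nil => rfl
  | cons o l ih => exact ih _

theorem execL_R (v : ℕ) (l : List Op) (s : Mem) : (execL v l s).R = runL v l s.R := by
  induction l generalizing s with
  | nil => rfl
  | cons o l ih => exact ih _

theorem execL_silent (v : ℕ) {l : List Op} (h : ∀ o ∈ l, o.Silent) (s : Mem) :
    (execL v l s).O = s.O ∧ (execL v l s).outputs = s.outputs := by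
  induction l generalizing s with
  | nil => exact ⟨rfl, rfl⟩
  | cons o l ih =>
    have ho := h o (by simp)
    have := ih (fun o' ho' => h o' (by simp [ho'])) (o.exec v s)
    rw [execL, this.1, this.2]
    cases o <;> simp_all [Op.Silent, Op.exec, Op.runO]

theorem execL_det (v w : ℕ) {l : List Op} (h : ∀ o ∈ l, o.Det) (s : Mem) :
    execL v l s = execL w l s := by
  induction l generalizing s with
  | nil => rfl
  | cons o l ih =>
    rw [execL, execL, (h o (by simp)).exec v w, ih fun o' ho' => h o' (by simp [ho'])]

/-- All work registers hold numbers below `2 ^ σ`. -/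
def Below (σ : ℕ) (R : ℕ → ℕ) : Prop := ∀ a, R a < 2 ^ σ

theorem Below.update {σ : ℕ} {R : ℕ → ℕ} (h : Below σ R) {d w : ℕ} (hw : w < 2 ^ σ) :
    Below σ (Function.update R d w) := by
  intro a
  rw [Function.update_apply]; split_ifs
  exacts [hw, h a]

theorem Below.mono {σ τ : ℕ} {R : ℕ → ℕ} (h : Below σ R) (hle : σ ≤ τ) : Below τ R :=
  fun a => (h a).trans_le (Nat.pow_le_pow_right two_pos hle)

/-- The factor 2 is due to multiplication. The constant depends only on the operation: it absorbs a
carry and a literal `n < 2 ^ n`. -/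
theorem Op.exists_growth (o : Op) : ∃ C, ∀ (v σ : ℕ) (R : ℕ → ℕ), v < 2 ^ σ → Below σ R →
    Below (2 * σ + C) (o.runR v R) ∧ o.cost R ≤ 2 * (σ + 1) := by
  refine ⟨1 + match o with | const _ n => n | _ => 0, fun v σ R hv hR => ?_⟩
  have hsz : ∀ a, (R a).size ≤ σ := fun a => Nat.size_le.2 (hR a)
  have hmono : ∀ C, Below (2 * σ + (1 + C)) R := fun C => hR.mono (by omega)
  have hup : ∀ C w, w < 2 ^ σ → w < 2 ^ (2 * σ + (1 + C)) := fun C w hw =>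
    hw.trans_le (Nat.pow_le_pow_right two_pos (by omega))
  cases o with
  | const d n =>
    refine ⟨(hmono _).update ?_, by simp [cost, instr, Instr.cost]; omega⟩
    exact Nat.lt_two_pow_self.trans_le (Nat.pow_le_pow_right two_pos (by dsimp only; omega))
  | copy d s => exact ⟨(hmono _).update (hup _ _ (hR _)), by simp [cost, instr, Instr.cost]; omega⟩
  | load d s => exact ⟨(hmono _).update (hup _ _ (hR _)), by simp [cost, instr, Instr.cost]; omega⟩
  | store d s =>
    exact ⟨(hmono _).update (hup _ _ (hR _)), by simp [cost, instr, Instr.cost]; omega⟩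
  | add d i j =>
    refine ⟨(hmono _).update ?_, ?_⟩
    · refine (Nat.add_lt_add (hR i) (hR j)).trans_le ?_
      rw [← two_mul, ← pow_succ']
      exact Nat.pow_le_pow_right two_pos (by omega)
    · have := hsz i; have := hsz j
      simp only [cost, instr, Instr.cost]; omega
  | sub d i j =>
    refine ⟨(hmono _).update (hup _ _ ((Nat.sub_le _ _).trans_lt (hR _))), ?_⟩
    have := hsz i; have := hsz j
    simp only [cost, instr, Instr.cost]; omega
  | mul d i j =>
    refine ⟨(hmono _).update ?_, ?_⟩
    · refine (Nat.mul_lt_mul'' (hR i) (hR j)).trans_le ?_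
      rw [← pow_add]
      exact Nat.pow_le_pow_right two_pos (by omega)
    · have := hsz i; have := hsz j
      simp only [cost, instr, Instr.cost]; omega
  | coin d => exact ⟨(hmono _).update (hup _ _ hv), by simp [cost, instr, Instr.cost]; omega⟩
  | random d s =>
    refine ⟨(hmono _).update (hup _ _ hv), ?_⟩
    have := hsz s
    simp only [cost, instr, Instr.cost]; omega
  | writeOut d s => exact ⟨hmono _, by simp [cost, instr, Instr.cost]; omega⟩
  | output => exact ⟨hmono _, by simp [cost, instr, Instr.cost]; omega⟩

/-- One operation takes a bit length `σ` to at most `2σ + D`; iterated over a fixed list this stays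
linear in `σ`, and so does the cost. -/
theorem exists_cost (l : List Op) : ∃ C, ∀ (v σ : ℕ) (s : Mem), v < 2 ^ σ → Below σ s.R →
    (execL v l s).time ≤ s.time + C * (σ + 1) := by
  induction l with
  | nil => exact ⟨0, fun v σ s _ _ => by simp [execL]⟩
  | cons o l ih =>
    obtain ⟨C, hC⟩ := ih
    obtain ⟨D, hD⟩ := o.exists_growth
    refine ⟨2 + C * (D + 2), fun v σ s hv hs => ?_⟩
    obtain ⟨h1, h2⟩ := hD v σ s.R hv hs
    have h3 := hC v (2 * σ + D) (o.exec v s)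
      (hv.trans_le (Nat.pow_le_pow_right two_pos (by omega))) h1
    have h4 : (o.exec v s).time = s.time + o.cost s.R := rfl
    rw [h4] at h3
    have h5 : C * (2 * σ + D + 1) ≤ C * ((D + 2) * (σ + 1)) :=
      Nat.mul_le_mul_left _ (by nlinarith)
    rw [execL]
    calc _ ≤ _ := h3
      _ ≤ s.time + 2 * (σ + 1) + C * ((D + 2) * (σ + 1)) := by gcongr
      _ = _ := by ring

/-- The ways to leave a node of a flow chart. -/
inductive Exit (N : Type) : Type
  | goto (n : N)
  | branch (src : ℕ) (yes no : N)
  | halt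

/-- A flow chart: every node consists of a list of operations, followed by a jump. -/
structure Flow where
  /-- the nodes -/
  Node : Type
  /-- there are finitely many nodes -/
  finite : Finite Node
  /-- the initial node -/
  start : Node
  /-- the operations at each node -/
  ops : Node → List Op
  /-- the jump at each node -/
  exit : Node → Exit Node

namespace Flow

variable (F : Flow)

/-- The labels of the machine of a flow chart: a node and the operations still to be done. -/
def Label : Type := {p : F.Node × List Op // p.2 <:+ F.ops p.1}

/-- A suffix of a given list is determined by its length. -/
theorem finite_label : Finite F.Label := by
  have := F.finite
  refine Finite.of_injective
    (β := Σ n : F.Node, Fin ((F.ops n).length + 1))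
    (fun p => ⟨p.1.1, p.1.2.length, Nat.lt_succ_of_le p.2.length_le⟩) ?_
  rintro ⟨⟨n, l⟩, h⟩ ⟨⟨n', l'⟩, h'⟩ heq
  simp only [Sigma.mk.injEq] at heq
  obtain ⟨rfl, heq⟩ := heq
  have hlen : l.length = l'.length := by simpa using heq
  have : l = l' := by
    have h1 := List.suffix_iff_eq_drop.1 h
    have h2 := List.suffix_iff_eq_drop.1 h'
    dsimp only at h1 h2
    rw [h1, h2, hlen]
  subst this; rfl

/-- The first label of a node. -/
def enter (n : F.Node) : F.Label := ⟨(n, F.ops n), List.suffix_rfl⟩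

/-- The machine that executes a flow chart. -/
def machine : Machine where
  Λ := F.Label
  finite := F.finite_label
  start := F.enter F.start
  code p := match p with
    | ⟨(n, []), _⟩ => match F.exit n with
      | .goto m => .jumpZero 0 (F.enter m) (F.enter m)
      | .branch src yes no => .jumpZero src (F.enter yes) (F.enter no)
      | .halt => .halt
    | ⟨(n, o :: l), h⟩ => o.instr ⟨(n, l), (List.suffix_cons o l).trans h⟩

variable {F}
variable (E : Mem → Prop)

/-- The probability that the machine of the flow chart, started at the node `n` in the state `s`,
halts in a state that satisfies `E`. -/
noncomputable def val (n : F.Node) (s : Mem) : ℝ≥0∞ :=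
  F.machine.value (Machine.ind fun c => E c.mem) (s.at (F.enter n))

/-- The same, started at the jump of a node. -/
noncomputable def exitVal : Exit F.Node → Mem → ℝ≥0∞
  | .goto n, s => val E n s.tick
  | .branch src yes no, s => val E (if s.R src = 0 then yes else no) s.tick
  | .halt, s => Machine.ind E s

variable {E}

theorem value_nil (n : F.Node) (h : [] <:+ F.ops n) (s : Mem) :
    F.machine.value (Machine.ind fun c => E c.mem) (s.at (⟨(n, []), h⟩ : F.Label)) =
      exitVal E (F.exit n) s := by
  cases hx : F.exit n with
  | goto m =>
    have hc : F.machine.code ((s.at (⟨(n, []), h⟩ : F.Label)).label) =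
        .jumpZero 0 (F.enter m) (F.enter m) := by
      simp only [machine, Mem.at, hx]
    refine (Machine.value_eq_avg_of_code _ hc).trans ?_
    simp only [Instr.bound, avg_zero, Instr.outcome, exitVal]
    by_cases h0 : s.R 0 = 0
    · simp only [h0, Mem.at]; rfl
    · simp only [h0, Mem.at]; rfl
  | branch src yes no =>
    have hc : F.machine.code ((s.at (⟨(n, []), h⟩ : F.Label)).label) =
        .jumpZero src (F.enter yes) (F.enter no) := by
      simp only [machine, Mem.at, hx]
    refine (Machine.value_eq_avg_of_code _ hc).trans ?_
    simp only [Instr.bound, avg_zero, Instr.outcome, exitVal]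
    by_cases h0 : s.R src = 0
    · simp only [h0, Mem.at]; rfl
    · simp only [h0, Mem.at]; rfl
  | halt =>
    have hc : F.machine.Halted (s.at (⟨(n, []), h⟩ : F.Label)) := by
      simp only [Machine.Halted, machine, Mem.at, hx]
    exact Machine.value_halted hc

theorem value_cons (n : F.Node) (o : Op) (l : List Op) (h : o :: l <:+ F.ops n) (s : Mem) :
    F.machine.value (Machine.ind fun c => E c.mem) (s.at (⟨(n, o :: l), h⟩ : F.Label)) =
      avg (o.bound s.R) fun v => F.machine.value (Machine.ind fun c => E c.mem)
        ((o.exec v s).at (⟨(n, l), (List.suffix_cons o l).trans h⟩ : F.Label)) := by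
  have hc : F.machine.code ((s.at (⟨(n, o :: l), h⟩ : F.Label)).label) =
      o.instr (⟨(n, l), (List.suffix_cons o l).trans h⟩ : F.Label) := rfl
  exact (Machine.value_eq_avg_of_code _ hc).trans (congrArg₂ avg (Op.instr_bound o _ _)
    (funext fun v => congrArg _ (Op.instr_outcome o _ _ v s)))

theorem value_append (n : F.Node) (l l' : List Op) (h : l ++ l' <:+ F.ops n)
    (hl : ∀ o ∈ l, o.Det) (v : ℕ) (s : Mem) :
    F.machine.value (Machine.ind fun c => E c.mem) (s.at (⟨(n, l ++ l'), h⟩ : F.Label)) =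
      F.machine.value (Machine.ind fun c => E c.mem)
        ((execL v l s).at (⟨(n, l'), (List.suffix_append l l').trans h⟩ : F.Label)) := by
  induction l generalizing s with
  | nil => rfl
  | cons o l ih =>
    have ho : o.Det := hl o (by simp)
    refine (value_cons n o (l ++ l') h s).trans ?_
    rw [ho.bound, avg_zero, ih _ fun o' ho' => hl o' (by simp [ho'])]
    rw [execL, ho.exec 0 v]

theorem val_eq_of_det (n : F.Node) (h : ∀ o ∈ F.ops n, o.Det) (v : ℕ) (s : Mem) :
    val E n s = exitVal E (F.exit n) (execL v (F.ops n) s) := by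
  have key : ∀ l (hl : l <:+ F.ops n), l = F.ops n ++ [] → val E n s =
      F.machine.value (Machine.ind fun c => E c.mem) (s.at (⟨(n, l), hl⟩ : F.Label)) := by
    rintro l hl hll
    rw [List.append_nil] at hll
    subst hll; rfl
  rw [key (F.ops n ++ []) (by simp) rfl, value_append n (F.ops n) [] (by simp) h v, value_nil]

/-- With a single random operation in the block, feeding its value `v` to the whole block is
harmless: the deterministic operations ignore it. -/
theorem val_eq_avg (n : F.Node) {l l' : List Op} {o : Op} (hn : F.ops n = l ++ o :: l')
    (hl : ∀ o ∈ l, o.Det) (hl' : ∀ o ∈ l', o.Det) (s : Mem) :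
    val E n s = avg (o.bound (runL 0 l s.R)) fun v =>
      exitVal E (F.exit n) (execL v (F.ops n) s) := by
  have key : ∀ l (h : l <:+ F.ops n), l = F.ops n → val E n s =
      F.machine.value (Machine.ind fun c => E c.mem) (s.at (⟨(n, l), h⟩ : F.Label)) := by
    rintro l h hll
    subst hll; rfl
  have hsuf : l ++ o :: l' <:+ F.ops n := by rw [hn]
  have hsuf' : l' ++ [] <:+ F.ops n := by
    rw [List.append_nil, hn]
    exact ⟨l ++ [o], by simp⟩
  rw [key (l ++ o :: l') hsuf hn.symm, value_append n l _ hsuf hl 0, value_cons, execL_R]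
  congr 1
  funext v
  have h2 := value_append (E := E) n l' [] hsuf' hl' v (o.exec v (execL 0 l s))
  simp only [List.append_nil] at h2
  rw [h2, value_nil, hn, execL_append, execL, execL_det v 0 hl]

/-- A flow chart has finitely many blocks, so one constant serves them all; the additional unit pays
for the jump. -/
theorem exists_blockCost (F : Flow) : ∃ C, ∀ (n : F.Node) (v σ : ℕ) (s : Mem), v < 2 ^ σ →
    Below σ s.R → (execL v (F.ops n) s).time + 1 ≤ s.time + C * (σ + 1) := by
  have := F.finite
  choose C hC using exists_cost
  obtain ⟨B, hB⟩ := (Set.finite_range fun n => C (F.ops n)).bddAbove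
  refine ⟨B + 1, fun n v σ s hv hs => ?_⟩
  have h1 := hC (F.ops n) v σ s hv hs
  have h2 : C (F.ops n) * (σ + 1) ≤ B * (σ + 1) := Nat.mul_le_mul_right _ (hB ⟨n, rfl⟩)
  rw [add_mul]; omega

theorem prob_machine (input : List ℕ) :
    F.machine.prob input (fun c => E c.mem) =
      val E F.start ⟨fun i => input.getD i 0, fun _ => 0, 0, []⟩ :=
  Machine.prob_eq_value _ _ _

end Flow

/-! ### Collecting coupons with a budget -/

section Coupons

variable {α : Type} [DecidableEq α]

/-- An upper bound for the probability that a collector of coupons from `A` runs out of budget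
before the collection is complete: `F` is the set of coupons found so far, `b` is the number of
draws left, and every new coupon gives a bonus of `L` draws. -/
noncomputable def failBound (A : Finset α) (L b : ℕ) (F : Finset α) : ℝ≥0∞ :=
  ∑ S ∈ A.powerset with F ⊆ S ∧ S ≠ A,
    ((S.card : ℝ≥0∞) * (A.card : ℝ≥0∞)⁻¹) ^ (b + L * (S.card - F.card))

/-- The summand `S = F` has exponent 0, so it equals 1 even when `F` is empty. -/
theorem one_le_failBound_zero {A F : Finset α} (L : ℕ) (hF : F ⊆ A) (hne : F ≠ A) :
    1 ≤ failBound A L 0 F := by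
  have hmem : F ∈ A.powerset.filter (fun S => F ⊆ S ∧ S ≠ A) := by simp [hF, hne]
  refine le_trans ?_ (Finset.single_le_sum (fun _ _ => zero_le) hmem)
  simp

/-- The summand of `S` survives a draw exactly if `y ∈ S`, and its exponent, the number of draws
left if the collection ends at `S`, then drops by one whether or not `y` is new. Averaging over `y`
restores the lost factor `|S| / |A|`. -/
theorem sum_failBound_le {A F : Finset α} (L b : ℕ) :
    ∑ y ∈ A, (A.card : ℝ≥0∞)⁻¹ *
        (if y ∈ F then failBound A L b F else failBound A L (b + L) (insert y F)) ≤
      failBound A L (b + 1) F := by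
  have h1 : ∀ y ∈ A, (if y ∈ F then failBound A L b F else failBound A L (b + L) (insert y F)) =
      ∑ S ∈ A.powerset with F ⊆ S ∧ S ≠ A, if y ∈ S then
        ((S.card : ℝ≥0∞) * (A.card : ℝ≥0∞)⁻¹) ^ (b + L * (S.card - F.card)) else 0 := by
    intro y _
    rw [← Finset.sum_filter, Finset.filter_filter]
    split_ifs with hy
    · unfold failBound
      refine Finset.sum_congr (Finset.filter_congr fun S _ => ?_) fun _ _ => rfl
      exact ⟨fun h => ⟨h, h.1 hy⟩, fun h => h.1⟩
    · unfold failBound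
      refine Finset.sum_congr (Finset.filter_congr fun S _ => ?_) fun S hS => ?_
      · rw [Finset.insert_subset_iff]; tauto
      · simp only [Finset.mem_filter] at hS
        have hc := Finset.card_le_card (Finset.insert_subset hS.2.2 hS.2.1.1)
        rw [Finset.card_insert_of_notMem hy] at hc ⊢
        -- A new element moves `L` from the term `L * (|S| - |F|)` into the budget, so the exponent
        -- is unchanged.
        congr 1
        obtain ⟨d, hd⟩ := Nat.exists_eq_add_of_le hc
        rw [hd, show F.card + 1 + d - (F.card + 1) = d by omega,
          show F.card + 1 + d - F.card = d + 1 by omega]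
        ring
  rw [Finset.sum_congr rfl fun y hy => by rw [h1 y hy]]
  simp only [Finset.mul_sum]
  rw [Finset.sum_comm]
  unfold failBound
  refine Finset.sum_le_sum fun S hS => ?_
  simp only [Finset.mem_filter, Finset.mem_powerset] at hS
  simp only [mul_ite, mul_zero, ← Finset.sum_filter]
  rw [Finset.filter_mem_eq_inter, Finset.inter_eq_right.2 hS.1, Finset.sum_const, nsmul_eq_mul,
    ← mul_assoc, ← pow_succ']
  exact le_of_eq (by congr 1; ring)

/-- From `m/n = 1 - (n-m)/n ≤ exp (-(n-m)/n)` the left side is at most `exp (-2(m+1)(n-m)/n)`, and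
the harmonic mean of `m + 1` and `n - m` is at least their minimum. Finally `exp (-1) ≤ 1/2`. -/
theorem div_pow_le_half_pow {m n : ℕ} (h : m < n) :
    ((m : ℝ) / n) ^ (2 * (m + 1)) ≤ (1 / 2 : ℝ) ^ min (m + 1) (n - m) := by
  have hn : (0 : ℝ) < n := by exact_mod_cast (Nat.zero_le m).trans_lt h
  obtain ⟨q, rfl⟩ := Nat.exists_eq_add_of_lt h
  set j := min (m + 1) (m + q + 1 - m) with hj
  have hjm : (j : ℝ) * (m + q + 1) ≤ 2 * ((q + 1) * (m + 1)) := by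
    have h1 : j ≤ m + 1 := min_le_left _ _
    have h2 : j ≤ q + 1 := (min_le_right _ _).trans (by omega)
    have : j * (m + q + 1) ≤ 2 * ((q + 1) * (m + 1)) := by
      calc j * (m + q + 1) = j * m + j * (q + 1) := by ring
        _ ≤ (q + 1) * m + (m + 1) * (q + 1) := by gcongr
        _ ≤ _ := by nlinarith
    exact_mod_cast this
  have h1 : (m : ℝ) / ((m + q + 1 : ℕ) : ℝ) ≤ Real.exp (-((q + 1 : ℝ) / (m + q + 1))) := by
    have := Real.add_one_le_exp (-((q + 1 : ℝ) / (m + q + 1)))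
    refine le_trans (le_of_eq ?_) this
    push_cast at hn ⊢
    field_simp
    ring
  have h2 : Real.exp (-1) ≤ 1 / 2 := by
    rw [Real.exp_neg, one_div]
    have := Real.add_one_le_exp (1 : ℝ)
    exact inv_anti₀ two_pos (by linarith)
  calc _ ≤ Real.exp (-((q + 1 : ℝ) / (m + q + 1))) ^ (2 * (m + 1)) := by gcongr
    _ = Real.exp (-(2 * ((q + 1) * (m + 1)) / (m + q + 1))) := by
      rw [← Real.exp_nat_mul]; congr 1; push_cast; ring
    _ ≤ Real.exp (-(j : ℝ)) := by
      apply Real.exp_le_exp.2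
      push_cast at hn
      rw [neg_le_neg_iff, le_div_iff₀ hn]
      exact hjm
    _ = Real.exp (-1) ^ j := by rw [← Real.exp_nat_mul]; congr 1; ring
    _ ≤ _ := by gcongr

theorem choose_le_pow_min {m n : ℕ} (h : m < n) : n.choose m ≤ n ^ min (m + 1) (n - m) := by
  rcases min_cases (m + 1) (n - m) with ⟨h1, -⟩ | ⟨h1, -⟩ <;> rw [h1]
  · exact (Nat.choose_le_pow n m).trans (Nat.pow_le_pow_right (by omega) (by omega))
  · rw [← Nat.choose_symm h.le]
    exact Nat.choose_le_pow n _

/-- With `j = min (m+1) (n-m)`, the binomial coefficient is at most `2^(N j)` and the power at most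
`2^(-(2N+K) j)`. The same exponent `j` governs few found and few missing elements, and `j ≥ 1`. -/
theorem choose_mul_pow_le {m n N K : ℕ} (h : m < n) (hN : n ≤ 2 ^ N) :
    (n.choose m : ℝ) * ((m : ℝ) / n) ^ (2 * (2 * N + K) * (m + 1)) ≤ (1 / 2) ^ (N + K) := by
  have hj : 1 ≤ min (m + 1) (n - m) := by omega
  have h1 : ((m : ℝ) / n) ^ (2 * (2 * N + K) * (m + 1)) ≤
      ((1 / 2 : ℝ) ^ (2 * N + K)) ^ min (m + 1) (n - m) := by
    calc ((m : ℝ) / n) ^ (2 * (2 * N + K) * (m + 1))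
        = (((m : ℝ) / n) ^ (2 * (m + 1))) ^ (2 * N + K) := by rw [← pow_mul]; congr 1; ring
      _ ≤ ((1 / 2 : ℝ) ^ min (m + 1) (n - m)) ^ (2 * N + K) :=
        pow_le_pow_left₀ (by positivity) (div_pow_le_half_pow h) _
      _ = _ := by rw [← pow_mul, ← pow_mul, mul_comm]
  have h2 : (n.choose m : ℝ) ≤ ((2 : ℝ) ^ N) ^ min (m + 1) (n - m) := by
    have := (choose_le_pow_min h).trans (Nat.pow_le_pow_left hN (min (m + 1) (n - m)))
    exact_mod_cast this
  calc _ ≤ ((2 : ℝ) ^ N) ^ min (m + 1) (n - m) *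
        ((1 / 2 : ℝ) ^ (2 * N + K)) ^ min (m + 1) (n - m) := by gcongr
    _ = ((1 / 2 : ℝ) ^ (N + K)) ^ min (m + 1) (n - m) := by
      rw [← mul_pow]
      congr 1
      rw [show 2 * N + K = N + (N + K) by ring, pow_add _ N, ← mul_assoc, ← mul_pow]
      norm_num
    _ ≤ ((1 / 2 : ℝ) ^ (N + K)) ^ 1 := by
      refine pow_le_pow_of_le_one (by positivity) ?_ hj
      exact pow_le_one₀ (by norm_num) (by norm_num)
    _ = _ := pow_one _

/-- Starting budget and bonus coincide, so the exponent for `S` is `L * (|S| + 1)`. Grouping by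
cardinality leaves `|A| ≤ 2^N` terms of at most `2^-(N+K)`; the spare `N` in `choose_mul_pow_le`
pays for their number. -/
theorem failBound_le {A : Finset α} {N K : ℕ} (hN : A.card ≤ 2 ^ N) (hA : 0 < A.card) :
    failBound A (2 * (2 * N + K)) (2 * (2 * N + K)) ∅ ≤ ENNReal.ofReal ((1 / 2) ^ K) := by
  have h1 : failBound A (2 * (2 * N + K)) (2 * (2 * N + K)) ∅ =
      ENNReal.ofReal (∑ m ∈ Finset.range A.card, (A.card.choose m : ℝ) *
        ((m : ℝ) / A.card) ^ (2 * (2 * N + K) * (m + 1))) := by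
    have h2 : ∀ S : Finset α, ((S.card : ℝ≥0∞) * (A.card : ℝ≥0∞)⁻¹) ^
        (2 * (2 * N + K) + 2 * (2 * N + K) * (S.card - (∅ : Finset α).card)) =
        ENNReal.ofReal (((S.card : ℝ) / A.card) ^ (2 * (2 * N + K) * (S.card + 1))) := by
      intro S
      have hpos : (0 : ℝ) < A.card := by exact_mod_cast hA
      rw [ENNReal.ofReal_pow (by positivity), ENNReal.ofReal_div_of_pos hpos,
        ENNReal.ofReal_natCast, ENNReal.ofReal_natCast, div_eq_mul_inv, Finset.card_empty]
      congr 1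
      simp only [Nat.sub_zero]; ring
    unfold failBound
    simp only [h2, Finset.empty_subset, true_and]
    rw [← ENNReal.ofReal_sum_of_nonneg fun _ _ => by positivity]
    congr 1
    have h3 : (A.powerset.filter fun S => S ≠ A) = A.powerset.erase A := by
      ext S; simp [and_comm]
    have h4 := Finset.sum_powerset_apply_card
      (fun m => ((m : ℝ) / A.card) ^ (2 * (2 * N + K) * (m + 1))) (x := A)
    rw [Finset.sum_range_succ, ← Finset.sum_erase_add _ _ (Finset.mem_powerset_self A)] at h4
    simp only [Nat.choose_self, nsmul_eq_mul, Nat.cast_one, one_mul] at h4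
    rw [h3]
    exact add_right_cancel h4
  rw [h1]
  apply ENNReal.ofReal_le_ofReal
  calc _ ≤ ∑ m ∈ Finset.range A.card, (1 / 2 : ℝ) ^ (N + K) :=
        Finset.sum_le_sum fun m hm => choose_mul_pow_le (Finset.mem_range.1 hm) hN
    _ = A.card * (1 / 2 : ℝ) ^ (N + K) := by simp
    _ ≤ 2 ^ N * (1 / 2 : ℝ) ^ (N + K) := by gcongr; exact_mod_cast hN
    _ = _ := by rw [pow_add, ← mul_assoc, ← mul_pow]; norm_num

end Coupons

/-! ### Disjoint regions of memory -/

/-- The address of the cell `i` of the region `r`. -/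
def ad (r i : ℕ) : ℕ := (r + i) * (r + i) + i

/-- As `i ≤ r + i`, the address lies between the consecutive squares of `r + i` and `r + i + 1`; the
square root gives `r + i` and the remainder `i`. -/
theorem ad_inj {r i r' i' : ℕ} (h : ad r i = ad r' i') : r = r' ∧ i = i' := by
  unfold ad at h
  have key : ∀ u u' i i' : ℕ, i ≤ u → i' ≤ u' → u * u + i = u' * u' + i' → ¬ u < u' := by
    intro u u' i i' hi _ h hlt
    have := Nat.mul_le_mul (Nat.succ_le_of_lt hlt) (Nat.succ_le_of_lt hlt)
    simp only [Nat.succ_eq_add_one] at this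
    nlinarith
  have h1 := key (r + i) (r' + i') i i' (by omega) (by omega) h
  have h2 := key (r' + i') (r + i) i' i (by omega) (by omega) h.symm
  have h3 : r + i = r' + i' := by omega
  rw [h3] at h
  omega

theorem le_ad (r i : ℕ) : r * r ≤ ad r i := by
  unfold ad; nlinarith

/-- Registers below 64 are reserved for the control program. -/
theorem ad_ge {r : ℕ} (hr : 8 ≤ r) (i : ℕ) : 64 ≤ ad r i :=
  (Nat.mul_le_mul hr hr).trans (le_ad r i)

theorem ad_ne {r : ℕ} (hr : 8 ≤ r) (i : ℕ) {k : ℕ} (hk : k < 64) : ad r i ≠ k := by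
  have := ad_ge hr i; omega

theorem ad_lt {r i μ : ℕ} (hr : r ≤ 2 ^ μ) (hi : i < 2 ^ μ) : ad r i < 2 ^ (2 * μ + 3) := by
  have h1 : r + i < 2 ^ (μ + 1) := by rw [pow_succ]; omega
  have h2 : (r + i) * (r + i) < 2 ^ (2 * μ + 2) := by
    rw [show 2 * μ + 2 = (μ + 1) + (μ + 1) by ring, pow_add]
    exact Nat.mul_lt_mul'' h1 h1
  have h3 : 2 ^ μ ≤ 2 ^ (2 * μ + 2) := Nat.pow_le_pow_right two_pos (by omega)
  unfold ad
  rw [show 2 * μ + 3 = (2 * μ + 2) + 1 by ring, pow_succ]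
  omega

/-- Outside of the registers in `T` and of the regions in `Z`, `R'` is the same as `R`. -/
def Keep (T Z : Set ℕ) (R R' : ℕ → ℕ) : Prop :=
  ∀ a, a ∉ T → (∀ r ∈ Z, ∀ i, a ≠ ad r i) → R' a = R a

theorem Keep.refl (T Z : Set ℕ) (R : ℕ → ℕ) : Keep T Z R R := fun _ _ _ => rfl

theorem Keep.trans {T Z : Set ℕ} {R R' R'' : ℕ → ℕ} (h : Keep T Z R R') (h' : Keep T Z R' R'') :
    Keep T Z R R'' := fun a hT hZ => (h' a hT hZ).trans (h a hT hZ)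

theorem Keep.mono {T T' Z Z' : Set ℕ} {R R' : ℕ → ℕ} (h : Keep T Z R R') (hT : T ⊆ T')
    (hZ : Z ⊆ Z') : Keep T' Z' R R' :=
  fun a ha hr => h a (fun h => ha (hT h)) fun r h => hr r (hZ h)

theorem Keep.cell {T Z : Set ℕ} {R R' : ℕ → ℕ} (h : Keep T Z R R') {r : ℕ} (hr : 8 ≤ r)
    (hT : ∀ a ∈ T, a < 64) (hZ : r ∉ Z) (i : ℕ) : R' (ad r i) = R (ad r i) :=
  h _ (fun ha => (hT _ ha).not_ge (ad_ge hr i)) fun _ hr' _ hj => hZ ((ad_inj hj).1 ▸ hr')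

theorem Keep.reg {T Z : Set ℕ} {R R' : ℕ → ℕ} (h : Keep T Z R R') (hZ : ∀ r ∈ Z, 8 ≤ r) {a : ℕ}
    (ha : a < 64) (hT : a ∉ T) : R' a = R a :=
  h a hT fun r hr i => (ad_ne (hZ r hr) i ha).symm

/-! ### Simulation of a machine in two regions of memory

The work registers of the simulated machine are kept in the region whose number is in
register `17`, its output registers in the region whose number is in register `18`. The registers
`20, …, 23` are used for intermediate results. -/

/-- Load the cell `R[t]` of the region `R[g]` into the register `d`. -/
def fetch (g t d : ℕ) : List Op := [.add 21 g t, .mul 21 21 21, .add 21 21 t, .load d 21]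

/-- Store the register `v` in the cell `R[t]` of the region `R[g]`. -/
def place (g t v : ℕ) : List Op := [.add 21 g t, .mul 21 21 21, .add 21 21 t, .store 21 v]

theorem runL_fetch (v : ℕ) {g t d r i : ℕ} {R : ℕ → ℕ} (hg : R g = r) (ht : R t = i)
    (ht' : t ≠ 21) (hr : 8 ≤ r) :
    runL v (fetch g t d) R =
      Function.update (Function.update R 21 (ad r i)) d (R (ad r i)) := by
  subst hg ht
  simp only [fetch, runL, Op.runR, Function.update_self, Function.update_idem,
    Function.update_of_ne ht']
  congr 1
  exact Function.update_of_ne (ad_ne hr _ (by norm_num)) _ _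

theorem runL_place (v : ℕ) {g t d r i : ℕ} {R : ℕ → ℕ} (hg : R g = r) (ht : R t = i)
    (ht' : t ≠ 21) (hd : d ≠ 21) :
    runL v (place g t d) R =
      Function.update (Function.update R 21 (ad r i)) (ad r i) (R d) := by
  subst hg ht
  simp only [place, runL, Op.runR, Function.update_self, Function.update_idem,
    Function.update_of_ne ht', Function.update_of_ne hd]
  rfl

/-- Load the cell `i` of the region of work registers into the register `d`. -/
def read (i d : ℕ) : List Op := .const 20 i :: fetch 17 20 d

/-- Store the register `23` in the cell `i` of the region of work registers. -/
def write (i : ℕ) : List Op := .const 20 i :: place 17 20 23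

theorem runL_read (v : ℕ) {i d r : ℕ} {R : ℕ → ℕ} (hg : R 17 = r) (hr : 8 ≤ r) :
    runL v (read i d) R = Function.update (Function.update (Function.update R 20 i) 21 (ad r i)) d
      (R (ad r i)) := by
  rw [read, runL, Op.runR, runL_fetch v (r := r) (i := i) (by simpa using hg) (by simp)
    (by norm_num) hr, Function.update_of_ne (ad_ne hr _ (by norm_num))]

theorem runL_write (v : ℕ) {i r : ℕ} {R : ℕ → ℕ} (hg : R 17 = r) :
    runL v (write i) R = Function.update (Function.update (Function.update R 20 i) 21 (ad r i))
      (ad r i) (R 23) := by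
  rw [write, runL, Op.runR, runL_place v (r := r) (i := i) (by simpa using hg) (by simp)
    (by norm_num) (by norm_num)]
  simp

/-- The operations that simulate an instruction. -/
def simOps {Λ : Type} : Instr Λ → List Op
  | .const d n _ => [] ++ .const 23 n :: write d
  | .copy d s _ => read s 23 ++ write d
  | .load d s _ => read s 22 ++ (fetch 17 22 23 ++ write d)
  | .store d s _ => read s 23 ++ (read d 22 ++ place 17 22 23)
  | .add d i j _ => read i 22 ++ (read j 23 ++ (.add 23 22 23 :: write d))
  | .sub d i j _ => read i 22 ++ (read j 23 ++ (.sub 23 22 23 :: write d))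
  | .mul d i j _ => read i 22 ++ (read j 23 ++ (.mul 23 22 23 :: write d))
  | .coin d _ => [] ++ .coin 23 :: write d
  | .random d s _ => read s 22 ++ .random 23 22 :: write d
  | .jumpZero s _ _ => read s 23
  | .writeOut d s _ => read s 23 ++ (read d 22 ++ place 18 22 23)
  | _ => []

/-- The jump after the operations that simulate an instruction. -/
def simExit {Λ N : Type} (emb : Λ → N) : Instr Λ → Exit N
  | .const _ _ n => .goto (emb n)
  | .copy _ _ n => .goto (emb n)
  | .load _ _ n => .goto (emb n)
  | .store _ _ n => .goto (emb n)
  | .add _ _ _ n => .goto (emb n)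
  | .sub _ _ _ n => .goto (emb n)
  | .mul _ _ _ n => .goto (emb n)
  | .coin _ n => .goto (emb n)
  | .random _ _ n => .goto (emb n)
  | .jumpZero _ y n => .branch 23 (emb y) (emb n)
  | .writeOut _ _ n => .goto (emb n)
  | .output n => .goto (emb n)
  | .halt => .halt

/-- The memory `R` represents the registers of the configuration `c` in the regions `r` and
`r + 1`, and has not been changed elsewhere. -/
structure Sim {Λ : Type} (r σ : ℕ) (R₀ : ℕ → ℕ) (c : Cfg Λ) (R : ℕ → ℕ) : Prop where
  region : R 17 = r
  outRegion : R 18 = r + 1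
  work : ∀ i, R (ad r i) = c.R i
  out : ∀ i, R (ad (r + 1) i) = c.O i
  keep : Keep (Set.Icc 20 23) {r, r + 1} R₀ R
  below : Below σ R

variable {Λ : Type}

theorem Sim.update_temp {r σ : ℕ} {R₀ R : ℕ → ℕ} {c : Cfg Λ} (h : Sim r σ R₀ c R) (hr : 8 ≤ r)
    {d w : ℕ} (hd : 20 ≤ d) (hd' : d ≤ 23) (hw : w < 2 ^ σ) :
    Sim r σ R₀ c (Function.update R d w) where
  region := by rw [Function.update_of_ne (by omega)]; exact h.region
  outRegion := by rw [Function.update_of_ne (by omega)]; exact h.outRegion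
  work i := by rw [Function.update_of_ne (ad_ne hr i (by omega))]; exact h.work i
  out i := by rw [Function.update_of_ne (ad_ne (by omega) i (by omega))]; exact h.out i
  keep a ha hZ := by
    rw [Function.update_of_ne, h.keep a ha hZ]
    rintro rfl
    exact ha ⟨hd, hd'⟩
  below := h.below.update hw

theorem Sim.update_work {r σ : ℕ} {R₀ R : ℕ → ℕ} {c : Cfg Λ} (h : Sim r σ R₀ c R) (hr : 8 ≤ r)
    {d w : ℕ} (hw : w < 2 ^ σ) (l : Λ) (t : ℕ) (o : List (List ℕ × ℕ)) :
    Sim r σ R₀ (⟨l, Function.update c.R d w, c.O, t, o⟩ : Cfg Λ)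
      (Function.update R (ad r d) w) where
  region := by rw [Function.update_of_ne (ad_ne hr d (by norm_num)).symm]; exact h.region
  outRegion := by rw [Function.update_of_ne (ad_ne hr d (by norm_num)).symm]; exact h.outRegion
  work i := by
    dsimp only
    by_cases hi : i = d
    · subst hi; simp
    · rw [Function.update_of_ne hi, Function.update_of_ne fun he => hi (ad_inj he).2]
      exact h.work i
  out i := by
    rw [Function.update_of_ne fun he => by have := (ad_inj he).1; omega]; exact h.out i
  keep a ha hZ := by
    rw [Function.update_of_ne (hZ r (by simp) d), h.keep a ha hZ]
  below := h.below.update hw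

theorem Sim.update_out {r σ : ℕ} {R₀ R : ℕ → ℕ} {c : Cfg Λ} (h : Sim r σ R₀ c R) (hr : 8 ≤ r)
    {d w : ℕ} (hw : w < 2 ^ σ) (l : Λ) (t : ℕ) (o : List (List ℕ × ℕ)) :
    Sim r σ R₀ (⟨l, c.R, Function.update c.O d w, t, o⟩ : Cfg Λ)
      (Function.update R (ad (r + 1) d) w) where
  region := by
    rw [Function.update_of_ne (ad_ne (by omega) d (by norm_num)).symm]; exact h.region
  outRegion := by
    rw [Function.update_of_ne (ad_ne (by omega) d (by norm_num)).symm]; exact h.outRegion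
  work i := by
    rw [Function.update_of_ne fun he => by have := (ad_inj he).1; omega]; exact h.work i
  out i := by
    dsimp only
    by_cases hi : i = d
    · subst hi; simp
    · rw [Function.update_of_ne hi, Function.update_of_ne fun he => hi (ad_inj he).2]
      exact h.out i
  keep a ha hZ := by
    rw [Function.update_of_ne (hZ (r + 1) (by simp) d), h.keep a ha hZ]
  below := h.below.update hw

theorem Sim.read {r σ : ℕ} {R₀ R : ℕ → ℕ} {c : Cfg Λ} (h : Sim r σ R₀ c R) (hr : 8 ≤ r)
    {i d : ℕ} (hi : i < 2 ^ σ) (ha : ad r i < 2 ^ σ) (hd : 20 ≤ d) (hd' : d ≤ 23) (v : ℕ) :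
    Sim r σ R₀ c (runL v (read i d) R) ∧ runL v (EnumRAM.read i d) R d = c.R i ∧
      ∀ e, 22 ≤ e → e ≠ d → runL v (EnumRAM.read i d) R e = R e := by
  rw [runL_read v h.region hr]
  refine ⟨((h.update_temp hr (by norm_num) (by norm_num) hi).update_temp hr (by norm_num)
    (by norm_num) ha).update_temp hr hd hd' (h.below _), by simp [h.work], fun e he hne => ?_⟩
  rw [Function.update_of_ne hne, Function.update_of_ne (by omega), Function.update_of_ne (by omega)]

theorem Sim.write {r σ : ℕ} {R₀ R : ℕ → ℕ} {c : Cfg Λ} (h : Sim r σ R₀ c R) (hr : 8 ≤ r)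
    {i : ℕ} (hi : i < 2 ^ σ) (ha : ad r i < 2 ^ σ) (v : ℕ) (l : Λ) (t : ℕ)
    (o : List (List ℕ × ℕ)) :
    Sim r σ R₀ (⟨l, Function.update c.R i (R 23), c.O, t, o⟩ : Cfg Λ) (runL v (write i) R) := by
  rw [runL_write v h.region]
  exact ((h.update_temp hr (by norm_num) (by norm_num) hi).update_temp hr (by norm_num)
    (by norm_num) ha).update_work hr (h.below _) _ _ _

/-- The simulation of one instruction. -/
theorem Sim.step {M : Machine} {r μ : ℕ} {R₀ R : ℕ → ℕ} {c : Cfg M.Λ}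
    (h : Sim r (2 * μ + 3) R₀ c R) (hr : 8 ≤ r) (hrμ : r < 2 ^ μ)
    (hM : (M.code c.label).maxConst < 2 ^ μ) (hc : ∀ i, c.R i < 2 ^ μ) (v : ℕ)
    (hc' : ∀ i, (M.stepWith v c).R i < 2 ^ μ) :
    Sim r (2 * μ + 3) R₀ (M.stepWith v c) (runL v (simOps (M.code c.label)) R) ∧
      ∀ s y n, M.code c.label = .jumpZero s y n →
        runL v (simOps (M.code c.label)) R 23 = c.R s := by
  have hup : ∀ {k}, k < 2 ^ μ → k < 2 ^ (2 * μ + 3) := fun hk =>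
    hk.trans_le (Nat.pow_le_pow_right two_pos (by omega))
  have had : ∀ {k}, k < 2 ^ μ → ad r k < 2 ^ (2 * μ + 3) := fun hk => ad_lt hrμ.le hk
  have had' : ∀ {k}, k < 2 ^ μ → ad (r + 1) k < 2 ^ (2 * μ + 3) := fun hk => ad_lt hrμ hk
  have n2 : (20 : ℕ) ≤ 22 := by norm_num
  have n3 : (20 : ℕ) ≤ 23 := by norm_num
  have n2' : (22 : ℕ) ≤ 23 := by norm_num
  have n3' : (23 : ℕ) ≤ 23 := by norm_num
  have hself : ∀ w : ℕ, Function.update R 23 w 23 = w := fun w => Function.update_self _ _ _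
  cases hcode : M.code c.label with
  | const d n next =>
    refine ⟨?_, by simp⟩
    simp only [hcode, Instr.maxConst, max_lt_iff] at hM
    have h1 := h.update_temp hr n3 n3' (hup hM.2)
    have h2 := h1.write hr (hup hM.1) (had hM.1) v next (c.time + 1) c.outputs
    rw [hself] at h2
    simpa [Machine.stepWith, hcode, simOps, Instr.outcome, Instr.cost, runL, Op.runR] using h2
  | copy d s next =>
    refine ⟨?_, by simp⟩
    simp only [hcode, Instr.maxConst, max_lt_iff] at hM
    obtain ⟨h1, e1, -⟩ := h.read hr (hup hM.2) (had hM.2) n3 n3' v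
    have h2 := h1.write hr (hup hM.1) (had hM.1) v next (c.time + 1) c.outputs
    rw [e1] at h2
    simpa [Machine.stepWith, hcode, simOps, Instr.outcome, Instr.cost, runL_append] using h2
  | load d s next =>
    refine ⟨?_, by simp⟩
    simp only [hcode, Instr.maxConst, max_lt_iff] at hM
    obtain ⟨h1, e1, -⟩ := h.read hr (hup hM.2) (had hM.2) n2 n2' v
    have h2 := (h1.update_temp hr (by norm_num : 20 ≤ 21) (by norm_num) (had (hc s))).update_temp
      hr n3 n3' (h1.below (ad r (c.R s)))
    rw [← runL_fetch v h1.region e1 (by norm_num) hr] at h2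
    have h3 := h2.write hr (hup hM.1) (had hM.1) v next (c.time + 1) c.outputs
    nth_rw 1 [runL_fetch v h1.region e1 (by norm_num) hr] at h3
    rw [Function.update_self, h1.work] at h3
    simpa [Machine.stepWith, hcode, simOps, Instr.outcome, Instr.cost, runL_append] using h3
  | store d s next =>
    refine ⟨?_, by simp⟩
    simp only [hcode, Instr.maxConst, max_lt_iff] at hM
    obtain ⟨h1, e1, -⟩ := h.read hr (hup hM.2) (had hM.2) n3 n3' v
    obtain ⟨h2, e2, f2⟩ := h1.read hr (hup hM.1) (had hM.1) n2 n2' v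
    have h3 := (h2.update_temp hr (by norm_num : 20 ≤ 21) (by norm_num) (had (hc d))).update_work
      hr (d := c.R d) (h2.below 23) next (c.time + 1) c.outputs
    rw [← runL_place v h2.region e2 (by norm_num) (by norm_num),
      f2 23 (by norm_num) (by norm_num), e1] at h3
    simpa [Machine.stepWith, hcode, simOps, Instr.outcome, Instr.cost, runL_append] using h3
  | add d i j next =>
    refine ⟨?_, by simp⟩
    simp only [hcode, Instr.maxConst, max_lt_iff] at hM
    obtain ⟨h1, e1, -⟩ := h.read hr (hup hM.2.1) (had hM.2.1) n2 n2' v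
    obtain ⟨h2, e2, f2⟩ := h1.read hr (hup hM.2.2) (had hM.2.2) n3 n3' v
    -- The size of the sum is not estimated: it is a register of the next configuration, for which
    -- the bound is assumed.
    have hv := hc' d
    simp only [Machine.stepWith, hcode, Instr.outcome, Function.update_self] at hv
    have h3 := (h2.update_temp hr n3 n3' (hup hv)).write hr (hup hM.1) (had hM.1) v next
      (c.time + (1 + (c.R i).size + (c.R j).size)) c.outputs
    rw [Function.update_self] at h3
    have e3 := f2 22 (by norm_num) (by norm_num)
    rw [e1] at e3
    simp only [Machine.stepWith, hcode, simOps, Instr.outcome, Instr.cost, runL_append, runL,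
      Op.runR, e2, e3]
    exact h3
  | sub d i j next =>
    refine ⟨?_, by simp⟩
    simp only [hcode, Instr.maxConst, max_lt_iff] at hM
    obtain ⟨h1, e1, -⟩ := h.read hr (hup hM.2.1) (had hM.2.1) n2 n2' v
    obtain ⟨h2, e2, f2⟩ := h1.read hr (hup hM.2.2) (had hM.2.2) n3 n3' v
    have hv := hc' d
    simp only [Machine.stepWith, hcode, Instr.outcome, Function.update_self] at hv
    have h3 := (h2.update_temp hr n3 n3' (hup hv)).write hr (hup hM.1) (had hM.1) v next
      (c.time + (1 + (c.R i).size + (c.R j).size)) c.outputs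
    rw [Function.update_self] at h3
    have e3 := f2 22 (by norm_num) (by norm_num)
    rw [e1] at e3
    simp only [Machine.stepWith, hcode, simOps, Instr.outcome, Instr.cost, runL_append, runL,
      Op.runR, e2, e3]
    exact h3
  | mul d i j next =>
    refine ⟨?_, by simp⟩
    simp only [hcode, Instr.maxConst, max_lt_iff] at hM
    obtain ⟨h1, e1, -⟩ := h.read hr (hup hM.2.1) (had hM.2.1) n2 n2' v
    obtain ⟨h2, e2, f2⟩ := h1.read hr (hup hM.2.2) (had hM.2.2) n3 n3' v
    have hv := hc' d
    simp only [Machine.stepWith, hcode, Instr.outcome, Function.update_self] at hv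
    have h3 := (h2.update_temp hr n3 n3' (hup hv)).write hr (hup hM.1) (had hM.1) v next
      (c.time + (1 + (c.R i).size + (c.R j).size)) c.outputs
    rw [Function.update_self] at h3
    have e3 := f2 22 (by norm_num) (by norm_num)
    rw [e1] at e3
    simp only [Machine.stepWith, hcode, simOps, Instr.outcome, Instr.cost, runL_append, runL,
      Op.runR, e2, e3]
    exact h3
  | coin d next =>
    refine ⟨?_, by simp⟩
    simp only [hcode, Instr.maxConst] at hM
    have hv := hc' d
    simp only [Machine.stepWith, hcode, Instr.outcome, Function.update_self] at hv
    have h2 := (h.update_temp hr n3 n3' (hup hv)).write hr (hup hM) (had hM) v next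
      (c.time + 1) c.outputs
    rw [hself] at h2
    simpa [Machine.stepWith, hcode, simOps, Instr.outcome, Instr.cost, runL, Op.runR] using h2
  | random d s next =>
    refine ⟨?_, by simp⟩
    simp only [hcode, Instr.maxConst, max_lt_iff] at hM
    have hv := hc' d
    simp only [Machine.stepWith, hcode, Instr.outcome, Function.update_self] at hv
    obtain ⟨h1, e1, -⟩ := h.read hr (hup hM.2) (had hM.2) n2 n2' v
    have h2 := (h1.update_temp hr n3 n3' (hup hv)).write hr (hup hM.1) (had hM.1) v next
      (c.time + (1 + (c.R s).size)) c.outputs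
    rw [Function.update_self] at h2
    simpa [Machine.stepWith, hcode, simOps, Instr.outcome, Instr.cost, runL_append, runL,
      Op.runR] using h2
  | jumpZero s y n =>
    simp only [hcode, Instr.maxConst] at hM
    obtain ⟨h1, e1, -⟩ := h.read hr (hup hM) (had hM) n3 n3' v
    refine ⟨?_, by rintro _ _ _ ⟨⟩; exact e1⟩
    simp only [Machine.stepWith, hcode, Instr.outcome]
    exact ⟨h1.region, h1.outRegion, h1.work, h1.out, h1.keep, h1.below⟩
  | writeOut d s next =>
    refine ⟨?_, by simp⟩
    simp only [hcode, Instr.maxConst, max_lt_iff] at hM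
    obtain ⟨h1, e1, -⟩ := h.read hr (hup hM.2) (had hM.2) n3 n3' v
    obtain ⟨h2, e2, f2⟩ := h1.read hr (hup hM.1) (had hM.1) n2 n2' v
    have h3 := (h2.update_temp hr (by norm_num : 20 ≤ 21) (by norm_num) (had' (hc d))).update_out
      hr (d := c.R d) (h2.below 23) next (c.time + 1) c.outputs
    rw [← runL_place v h2.outRegion e2 (by norm_num) (by norm_num),
      f2 23 (by norm_num) (by norm_num), e1] at h3
    simpa [Machine.stepWith, hcode, simOps, Instr.outcome, Instr.cost, runL_append] using h3
  | output next =>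
    refine ⟨?_, by simp⟩
    simp only [Machine.stepWith, hcode, Instr.outcome]
    exact ⟨h.region, h.outRegion, h.work, h.out, h.keep, h.below⟩
  | halt =>
    refine ⟨?_, by simp⟩
    simp only [Machine.stepWith, hcode, Instr.outcome]
    exact ⟨h.region, h.outRegion, h.work, h.out, h.keep, h.below⟩

theorem simOps_silent {Λ : Type} (i : Instr Λ) : ∀ o ∈ simOps i, o.Silent := by
  cases i <;> simp [simOps, read, write, fetch, place, Op.Silent]

theorem read_det (i d : ℕ) : ∀ o ∈ read i d, o.Det := by
  simp [read, fetch, Op.Det]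

theorem write_det (i : ℕ) : ∀ o ∈ write i, o.Det := by
  simp [write, place, Op.Det]

/-- The block of a flow chart that simulates an instruction makes the same random choice. -/
theorem Flow.val_simOps {F : Flow} {E : Mem → Prop} {Λ : Type} {i : Instr Λ} {n : F.Node}
    (hops : F.ops n = simOps i) (hi : i ≠ .halt) {r σ : ℕ} {R₀ : ℕ → ℕ} {c : Cfg Λ} {s : Mem}
    (h : Sim r σ R₀ c s.R) (hr : 8 ≤ r) :
    Flow.val E n s = avg (i.bound c.R) fun v =>
      Flow.exitVal E (F.exit n) (execL v (F.ops n) s) := by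
  have det : (∀ o ∈ simOps i, o.Det) → i.bound c.R = 0 → Flow.val E n s =
      avg (i.bound c.R) fun v => Flow.exitVal E (F.exit n) (execL v (F.ops n) s) := fun h1 h2 => by
    have := Flow.val_eq_of_det (E := E) n (hops ▸ h1) 0 s
    rw [h2, avg_zero]
    exact this
  cases i with
  | coin d next =>
    exact Flow.val_eq_avg n hops (by simp) (write_det d) s
  | random d src next =>
    rw [Flow.val_eq_avg n hops (read_det src 22) (write_det d) s]
    congr 1
    -- The block loads the simulated bound into register 22 before drawing, so both draws are
    -- uniform on the same range.
    change runL 0 (read src 22) s.R 22 = c.R src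
    rw [runL_read 0 h.region hr, Function.update_self, h.work]
  | halt => exact absurd rfl hi
  | _ => exact det (by simp [simOps, read, write, fetch, place, Op.Det]) rfl

/-- The simulation of a run: if `Φ` is a lower bound for the probability of success after the
simulation, its expected value is a lower bound for the probability of success before. -/
theorem Flow.value_le_val_of_sim {F : Flow} {E : Mem → Prop} {M : Machine} {emb : M.Λ → F.Node}
    (hemb : ∀ l, M.code l ≠ .halt →
      F.ops (emb l) = simOps (M.code l) ∧ F.exit (emb l) = simExit emb (M.code l))
    {r μ κ : ℕ} (hr : 8 ≤ r) (hrμ : r < 2 ^ μ)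
    (hκ : ∀ (n : F.Node) (v : ℕ) (s : Mem), v < 2 ^ (2 * μ + 3) → Below (2 * μ + 3) s.R →
      (execL v (F.ops n) s).time + 1 ≤ s.time + κ)
    (hM : ∀ l, (M.code l).maxConst < 2 ^ μ) {c₀ : Cfg M.Λ}
    (hreach : ∀ c, Machine.Reach c₀ c → ∀ i, c.R i < 2 ^ μ) {Φ : Cfg M.Λ → ℝ≥0∞} {s₀ : Mem}
    (hs₀ : Sim r (2 * μ + 3) s₀.R c₀ s₀.R)
    (hΦ : ∀ c s, Machine.Reach c₀ c → M.Halted c → Sim r (2 * μ + 3) s₀.R c s.R → s.O = s₀.O →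
      s.outputs = s₀.outputs → s.time ≤ s₀.time + κ * c.time → Φ c ≤ Flow.val E (emb c.label) s) :
    M.value Φ c₀ ≤ Flow.val E (emb c₀.label) s₀ := by
  have key : ∀ N c s, Machine.Reach c₀ c → Sim r (2 * μ + 3) s₀.R c s.R → s.O = s₀.O →
      s.outputs = s₀.outputs → s.time ≤ s₀.time + κ * c.time →
      M.ev Φ N c ≤ Flow.val E (emb c.label) s := by
    intro N
    induction N with
    | zero =>
      intro c s hc hs hO ho ht
      unfold Machine.ev
      split_ifs with hh
      · exact hΦ c s hc hh hs hO ho ht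
      · exact zero_le
    | succ N ih =>
      intro c s hc hs hO ho ht
      by_cases hh : M.Halted c
      · rw [Machine.ev_halted hh]
        exact hΦ c s hc hh hs hO ho ht
      obtain ⟨hops, hexit⟩ := hemb c.label hh
      rw [Flow.val_simOps hops hh hs hr]
      refine avg_mono fun v hv => ?_
      have hc' := hc.step v hv
      have hstep := hs.step hr hrμ (hM _) (hreach c hc) v (hreach _ hc')
      have hsil := execL_silent v (simOps_silent (M.code c.label)) s
      have hvμ : v < 2 ^ (2 * μ + 3) := by
        refine lt_of_le_of_lt hv ?_
        have h2 : 1 < 2 ^ (2 * μ + 3) := Nat.one_lt_two_pow (by omega)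
        cases M.code c.label <;> simp only [Instr.bound] <;> first | exact h2 | omega | skip
        exact (hreach c hc _).trans_le (Nat.pow_le_pow_right two_pos (by omega))
      have htime := hκ (emb c.label) v s hvμ hs.below
      rw [hops] at htime ⊢
      -- Each simulated instruction advances the simulated clock by at least one and the real clock
      -- by at most `κ`, which keeps `s.time ≤ s₀.time + κ * c.time`.
      have hcost : 1 ≤ (M.code c.label).cost c.R := by
        cases hcode : M.code c.label <;> simp only [Instr.cost] <;> first | omega | skip
        exact absurd hcode hh
      have htime' : (execL v (simOps (M.code c.label)) s).tick.time ≤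
          s₀.time + κ * (M.stepWith v c).time := by
        have e1 : (M.stepWith v c).time = c.time + (M.code c.label).cost c.R := rfl
        have e2 : (execL v (simOps (M.code c.label)) s).tick.time =
          (execL v (simOps (M.code c.label)) s).time + 1 := rfl
        have e3 : κ * (c.time + 1) ≤ κ * (M.stepWith v c).time := by
          rw [e1]; gcongr
        rw [mul_add, mul_one] at e3
        omega
      have hexitVal : Flow.exitVal E (F.exit (emb c.label))
          (execL v (simOps (M.code c.label)) s) =
          Flow.val E (emb (M.stepWith v c).label)
            (execL v (simOps (M.code c.label)) s).tick := by
        rw [hexit]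
        have h23 := hstep.2
        rw [← execL_R] at h23
        generalize execL v (simOps (M.code c.label)) s = s' at h23 ⊢
        unfold Machine.stepWith
        cases hcode : M.code c.label with
        | jumpZero src y n =>
          simp only [simExit, Flow.exitVal, h23 _ _ _ hcode, Instr.outcome]
          split_ifs <;> rfl
        | halt => exact absurd hcode hh
        | _ => rfl
      rw [hexitVal]
      refine ih _ _ hc' ?_ (hsil.1.trans hO) (hsil.2.trans ho) htime'
      have := hstep.1
      rw [← execL_R] at this
      exact this
  exact iSup_le fun N => key N c₀ s₀ .refl hs₀ rfl rfl (by omega)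

/-! ### The enumerating machine

Registers that keep their meaning during the main loop: `6`: one, `7`: length of the input word,
`10`: address of its first letter, `11`: bonus for a new element, `12`: region of the dictionary,
`13`: bound for the length of the elements, `14`: remaining budget, `15`: first unused region,
`16`: logarithm of the inverse of the probability of failure. -/

/-- The nodes of the enumerating machine outside of the two simulations. -/
inductive Ctl : Type
  | start | copy | scan | log | setup | main | draw | seed | feed | check | accept | letter | put
  | pass | verdict | lookup | fresh | next | finish

theorem Ctl.finite : Finite Ctl := by
  have h : (Set.univ : Set Ctl) = {.start, .copy, .scan, .log, .setup, .main, .draw, .seed, .feed,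
      .check, .accept, .letter, .put, .pass, .verdict, .lookup, .fresh, .next, .finish} := by
    ext c; cases c <;> simp
  rw [← Set.finite_univ_iff, h]
  exact Set.toFinite _

/-- The operations of the nodes outside of the two simulations; `cB * (n + 1) ^ dB` bounds the
length of the elements to be enumerated. -/
def Ctl.ops (cB dB : ℕ) : Ctl → List Op
  -- The input fills the registers from 3 on, so working registers must first be freed. `R[0]`
  -- becomes `64 * |x|`; registers 3 to 9 are moved to the addresses from `64 * |x| + 67` on,
  -- register 3 being parked at `64 * |x|` meanwhile because it is needed as a pointer.
  | start =>
      [.add 0 0 0, .add 0 0 0, .add 0 0 0, .add 0 0 0, .add 0 0 0, .add 0 0 0, .store 0 3,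
        .const 3 68, .add 3 3 0, .store 3 4, .const 3 69, .add 3 3 0, .store 3 5,
        .const 3 70, .add 3 3 0, .store 3 6, .const 3 71, .add 3 3 0, .store 3 7,
        .const 3 72, .add 3 3 0, .store 3 8, .const 3 73, .add 3 3 0, .store 3 9,
        .load 4 0, .const 3 67, .add 3 3 0, .store 3 4,
        .const 5 64, .const 6 1, .const 7 0, .const 3 10, .const 4 74, .add 4 4 0]
  | copy => [.sub 0 0 5, .add 7 7 6, .load 8 3, .store 4 8, .add 3 3 6, .add 4 4 6]
  | scan => [.sub 10 4 3, .const 8 3, .add 10 10 8, .copy 12 4, .const 16 0]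
  -- Subtracting `num, 2 num, 4 num, …` from `den` until nothing is left counts to about `log (1/ε)`
  -- without division.
  | log => [.sub 2 2 1, .add 1 1 1, .add 16 16 6]
  -- Registers 1 and 2 are cleared so that the cost of a draw does not depend on the bit size of
  -- `ε`. With `P` in register 13, the bonus is `2(2(2P + 2) + K)`, that is `2(2N + K)` for `N = 2P
  -- + 2`.
  | setup =>
      [.const 1 0, .const 2 0, .add 8 7 6, .const 13 cB] ++
        (List.replicate dB (.mul 13 13 8) ++
          [.add 11 13 13, .const 9 2, .add 11 11 9, .add 11 11 11, .add 11 11 16, .add 11 11 11,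
            .copy 14 11, .add 15 12 6])
  | main => []
  | draw => [.sub 14 14 6]
  | seed =>
      [.copy 17 15, .add 18 17 6, .add 26 18 6, .const 20 0] ++ (place 17 20 7 ++ (place 26 20 7 ++
        [.const 24 1, .const 27 2, .copy 28 10, .copy 25 7]))
  | feed =>
      .load 23 28 :: (place 17 24 23 ++ (place 26 27 23 ++
        [.add 24 24 6, .add 27 27 6, .add 28 28 6, .sub 25 25 6]))
  | check => .const 20 0 :: (fetch 18 20 29 ++ [.sub 23 29 13])
  | accept =>
      [.const 20 0, .writeOut 20 29] ++ ([.add 26 18 6, .const 20 1] ++ (place 26 20 29 ++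
        [.const 19 1, .const 24 1, .const 27 2, .add 27 27 7, .copy 25 29]))
  | letter => fetch 18 24 23 ++ [.const 22 2, .sub 22 23 22]
  | put =>
      .writeOut 24 23 :: (place 26 27 23 ++
        [.add 19 19 19, .add 19 19 19, .add 19 19 23, .add 24 24 6, .add 27 27 6, .sub 25 25 6])
  | pass => [.copy 17 26, .add 18 17 6]
  | verdict => .const 20 0 :: fetch 17 20 23
  | lookup => fetch 12 19 23
  | fresh => .output :: (place 12 19 6 ++ [.add 14 14 11])
  | next => [.const 20 4, .add 15 15 20]
  | finish => []

/-- The jumps of the nodes outside of the two simulations. -/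
def Ctl.exit {ΛG ΛD : Type} (gStart : ΛG) (dStart : ΛD) : Ctl → Exit (Ctl ⊕ ΛG ⊕ ΛD)
  | start => .branch 0 (.inl scan) (.inl copy)
  | copy => .branch 0 (.inl scan) (.inl copy)
  | scan => .goto (.inl log)
  | log => .branch 2 (.inl setup) (.inl log)
  | setup => .goto (.inl main)
  | main => .branch 14 (.inl finish) (.inl draw)
  | draw => .goto (.inl seed)
  | seed => .branch 25 (.inr (.inl gStart)) (.inl feed)
  | feed => .branch 25 (.inr (.inl gStart)) (.inl feed)
  -- Here and below a bad word ends the run: for nonempty `A(x)` this has probability zero, and for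
  -- empty `A(x)` it is the right answer.
  | check => .branch 23 (.inl accept) (.inl finish)
  | accept => .branch 25 (.inl pass) (.inl letter)
  | letter => .branch 22 (.inl put) (.inl finish)
  | put => .branch 25 (.inl pass) (.inl letter)
  | pass => .goto (.inr (.inr dStart))
  | verdict => .branch 23 (.inl finish) (.inl lookup)
  | lookup => .branch 23 (.inl fresh) (.inl next)
  | fresh => .goto (.inl next)
  | next => .goto (.inl main)
  | finish => .halt

/-- The machine that enumerates the words produced by the generator `G` and accepted by the
decision procedure `D`. -/
def enumerator (G D : Machine) (cB dB : ℕ) : Flow where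
  Node := Ctl ⊕ G.Λ ⊕ D.Λ
  finite := by
    have := Ctl.finite; have := G.finite; have := D.finite
    infer_instance
  start := .inl .start
  ops
    | .inl c => c.ops cB dB
    | .inr (.inl l) => simOps (G.untilOutput.code l)
    | .inr (.inr l) => simOps (D.code l)
  exit
    | .inl c => c.exit G.start D.start
    | .inr (.inl l) => match G.code l with
      | .output _ => .goto (.inl .check)
      | .halt => .goto (.inl .finish)
      | i => simExit (fun l => .inr (.inl l)) i
    | .inr (.inr l) => match D.code l with
      | .halt => .goto (.inl .verdict)
      | i => simExit (fun l => .inr (.inr l)) i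

/-- The probability that the enumerator succeeds, from the given node and state. -/
noncomputable abbrev enumVal (G D : Machine) (cB dB : ℕ) (E : Mem → Prop)
    (n : Ctl ⊕ G.Λ ⊕ D.Λ) (s : Mem) : ℝ≥0∞ :=
  Flow.val (F := enumerator G D cB dB) E n s

/-! ### Straight-line code -/

theorem runL_fetch_eq (v : ℕ) {g t d : ℕ} (R : ℕ → ℕ) (ht : t ≠ 21) :
    runL v (fetch g t d) R = Function.update (Function.update R 21 (ad (R g) (R t))) d
      (Function.update R 21 (ad (R g) (R t)) (ad (R g) (R t))) := by
  simp only [fetch, runL, Op.runR, Function.update_self, Function.update_idem,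
    Function.update_of_ne ht]
  rfl

theorem runL_place_eq (v : ℕ) {g t d : ℕ} (R : ℕ → ℕ) (ht : t ≠ 21) (hd : d ≠ 21) :
    runL v (place g t d) R =
      Function.update (Function.update R 21 (ad (R g) (R t))) (ad (R g) (R t)) (R d) :=
  runL_place v rfl rfl ht hd

/-- `R'` differs from `R` only in the registers in `T` and the regions in `Z`, and it holds only
numbers below `2 ^ σ`. -/
structure Good (T Z : Set ℕ) (σ : ℕ) (R R' : ℕ → ℕ) : Prop where
  keep : Keep T Z R R'
  below : Below σ R'

theorem Good.refl {T Z : Set ℕ} {σ : ℕ} {R : ℕ → ℕ} (h : Below σ R) : Good T Z σ R R :=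
  ⟨Keep.refl _ _ _, h⟩

theorem Good.set {T Z : Set ℕ} {σ : ℕ} {R R' : ℕ → ℕ} (h : Good T Z σ R R') {d w : ℕ}
    (hd : d ∈ T) (hw : w < 2 ^ σ) : Good T Z σ R (Function.update R' d w) where
  keep a ha hZ := by
    rw [Function.update_of_ne, h.keep a ha hZ]
    rintro rfl; exact ha hd
  below := h.below.update hw

theorem Good.setCell {T Z : Set ℕ} {σ : ℕ} {R R' : ℕ → ℕ} (h : Good T Z σ R R') {r i w : ℕ}
    (hr : r ∈ Z) (hw : w < 2 ^ σ) : Good T Z σ R (Function.update R' (ad r i) w) where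
  keep a ha hZ := by rw [Function.update_of_ne (hZ r hr i), h.keep a ha hZ]
  below := h.below.update hw

theorem Good.mono {T T' Z Z' : Set ℕ} {σ : ℕ} {R R' : ℕ → ℕ} (h : Good T Z σ R R') (hT : T ⊆ T')
    (hZ : Z ⊆ Z') : Good T' Z' σ R R' := ⟨h.keep.mono hT hZ, h.below⟩

theorem Good.trans {T Z : Set ℕ} {σ : ℕ} {R R' R'' : ℕ → ℕ} (h : Good T Z σ R R')
    (h' : Good T Z σ R' R'') : Good T Z σ R R'' := ⟨h.keep.trans h'.keep, h'.below⟩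

/-- The region `r` holds the list `l`, followed by zeros. -/
def Holds (r : ℕ) (l : List ℕ) (R : ℕ → ℕ) : Prop := ∀ i, R (ad r i) = l.getD i 0

theorem getD_concat (l : List ℕ) (a i : ℕ) :
    (l ++ [a]).getD i 0 = if i = l.length then a else l.getD i 0 := by
  rcases lt_trichotomy i l.length with h | h | h
  · rw [List.getD_append _ _ _ _ h, if_neg h.ne]
  · subst h; simp
  · rw [if_neg h.ne', List.getD_eq_default _ _ (by simpa using h),
      List.getD_eq_default _ _ h.le]

theorem Holds.concat {r : ℕ} {l : List ℕ} {R R' : ℕ → ℕ} {a : ℕ} (h : Holds r l R)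
    (h1 : R' (ad r l.length) = a) (h2 : ∀ i, i ≠ l.length → R' (ad r i) = R (ad r i)) :
    Holds r (l ++ [a]) R' := by
  intro i
  rw [getD_concat]
  split_ifs with hi
  · rw [hi, h1]
  · rw [h2 i hi, h i]

/-- The bound on the cost of the blocks of a flow chart. -/
def Flow.CostBound (F : Flow) (σ κ : ℕ) : Prop :=
  ∀ (n : F.Node) (v : ℕ) (s : Mem), v < 2 ^ σ → Below σ s.R →
    (execL v (F.ops n) s).time + 1 ≤ s.time + κ

theorem Flow.val_goto {F : Flow} {E : Mem → Prop} {σ κ : ℕ} (hκ : F.CostBound σ κ)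
    {n m : F.Node} (hx : F.exit n = .goto m) (hdet : ∀ o ∈ F.ops n, o.Det) {s : Mem}
    (hs : Below σ s.R) :
    ∃ s', Flow.val E n s = Flow.val E m s' ∧ s'.R = runL 0 (F.ops n) s.R ∧
      s'.O = (execL 0 (F.ops n) s).O ∧ s'.outputs = (execL 0 (F.ops n) s).outputs ∧
      s'.time ≤ s.time + κ := by
  refine ⟨(execL 0 (F.ops n) s).tick, ?_, execL_R 0 _ _, rfl, rfl,
    hκ n 0 s (by positivity) hs⟩
  rw [Flow.val_eq_of_det n hdet 0, hx]; rfl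

theorem Flow.val_branch {F : Flow} {E : Mem → Prop} {σ κ : ℕ} (hκ : F.CostBound σ κ)
    {n y z : F.Node} {r : ℕ} (hx : F.exit n = .branch r y z) (hdet : ∀ o ∈ F.ops n, o.Det) {s : Mem}
    (hs : Below σ s.R) :
    ∃ s', Flow.val E n s = (if s'.R r = 0 then Flow.val E y s' else Flow.val E z s') ∧
      s'.R = runL 0 (F.ops n) s.R ∧
      s'.O = (execL 0 (F.ops n) s).O ∧ s'.outputs = (execL 0 (F.ops n) s).outputs ∧
      s'.time ≤ s.time + κ := by
  refine ⟨(execL 0 (F.ops n) s).tick, ?_, execL_R 0 _ _, rfl, rfl,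
    hκ n 0 s (by positivity) hs⟩
  rw [Flow.val_eq_of_det n hdet 0, hx]
  exact apply_ite (fun m => Flow.val E m (execL 0 (F.ops n) s).tick) _ y z

/-! ### Coding words by numbers. -/

/-- The number that represents a word in the dictionary. -/
def wordCode (l : List ℕ) : ℕ := l.foldl (fun k a => 4 * k + a) 1

theorem wordCode_concat (l : List ℕ) (a : ℕ) : wordCode (l ++ [a]) = 4 * wordCode l + a := by
  simp [wordCode]

theorem Word.codes_lt (y : Word) : ∀ a ∈ y.codes, a < 3 := by
  intro a ha
  obtain ⟨b, -, rfl⟩ := List.mem_map.1 ha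
  exact b.2

theorem Word.codes_injective : Function.Injective Word.codes :=
  List.map_injective_iff.2 Fin.val_injective

theorem exists_codes {l : List ℕ} (h : ∀ a ∈ l, a < 3) : ∃ y : Word, y.codes = l := by
  induction l with
  | nil => exact ⟨[], rfl⟩
  | cons a l ih =>
    obtain ⟨y, hy⟩ := ih fun b hb => h b (by simp [hb])
    exact ⟨⟨a, h a (by simp)⟩ :: y, by simp [Word.codes, ← hy]⟩

theorem wordCode_pos (l : List ℕ) : 1 ≤ wordCode l := by
  induction l using List.reverseRecOn with
  | nil => simp [wordCode]
  | append_singleton l a ih => rw [wordCode_concat]; omega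

/-- The induction needs the bound on `wordCode l + 1`, which leaves room for the next digit. -/
theorem wordCode_lt {l : List ℕ} (h : ∀ a ∈ l, a < 3) : wordCode l < 2 * 4 ^ l.length := by
  have : wordCode l + 1 ≤ 2 * 4 ^ l.length := by
    induction l using List.reverseRecOn with
    | nil => simp [wordCode]
    | append_singleton l a ih =>
      have h1 := ih fun b hb => h b (by simp [hb])
      have h2 := h a (by simp)
      rw [wordCode_concat, List.length_append, List.length_singleton, pow_succ]
      omega
  omega

/-- The code is a base-4 numeral with a leading 1, which makes the length recoverable even when the
word starts with zeros. -/
theorem wordCode_inj {l l' : List ℕ} (h : ∀ a ∈ l, a < 3) (h' : ∀ a ∈ l', a < 3)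
    (he : wordCode l = wordCode l') : l = l' := by
  induction l using List.reverseRecOn generalizing l' with
  | nil =>
    rcases List.eq_nil_or_concat' l' with rfl | ⟨m, b, rfl⟩
    · rfl
    · rw [wordCode_concat] at he
      have := wordCode_pos m
      simp [wordCode] at he; unfold wordCode at this; omega
  | append_singleton l a ih =>
    rcases List.eq_nil_or_concat' l' with rfl | ⟨m, b, rfl⟩
    · rw [wordCode_concat] at he
      have := wordCode_pos l
      simp [wordCode] at he; unfold wordCode at this; omega
    · rw [wordCode_concat, wordCode_concat] at he
      have h1 := h a (by simp)
      have h2 := h' b (by simp)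
      have hab : a = b := by omega
      rw [hab, ih (l' := m) (fun c hc => h c (by simp [hc])) (fun c hc => h' c (by simp [hc]))
        (by omega)]

/-! ### Invariants of the main loop. -/

/-- The registers whose content does not matter between two draws. -/
def scratch : Set ℕ := {a | 17 ≤ a ∧ a < 64}

/-- The part of the memory that does not change during the main loop. -/
structure Base (x : Word) (P L r₀ : ℕ) (R : ℕ → ℕ) : Prop where
  one : R 6 = 1
  len : R 7 = x.length
  bonus : R 11 = L
  dict : R 12 = r₀
  bound : R 13 = P
  letters : ∀ i < x.length, R (R 10 + i) = x.codes.getD i 0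
  low : 64 ≤ R 10
  high : R 10 + x.length ≤ r₀

/-- The memory between two draws, when the words in `ys` have been found, the budget is `b`, and
the regions from `r` on are unused. -/
structure Inv (x : Word) (P L r₀ σ : ℕ) (ys : List Word) (b r : ℕ) (R : ℕ → ℕ) : Prop where
  base : Base x P L r₀ R
  budget : R 14 = b
  region : R 15 = r
  lt : r₀ < r
  found : ∀ k, R (ad r₀ k) = if k ∈ ys.map (fun y => wordCode y.codes) then 1 else 0
  zero : ∀ r' ≥ r, ∀ i, R (ad r' i) = 0
  below : Below σ R

/-- The stored input lies between address 64 and `r₀`, whereas all cells of a region `r ≥ r₀` have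
addresses at least `r * r ≥ r₀`. -/
theorem Base.of_keep {x : Word} {P L r₀ : ℕ} {R R' : ℕ → ℕ} (h : Base x P L r₀ R) {T Z : Set ℕ}
    (hk : Keep T Z R R') (hT : ∀ a ∈ T, 14 ≤ a ∧ a < 64) (hZ : ∀ r ∈ Z, r₀ ≤ r) :
    Base x P L r₀ R' := by
  have hr₀ := h.low.trans ((Nat.le_add_right _ _).trans h.high)
  have hreg : ∀ {a}, a < 14 → R' a = R a := fun {a} ha =>
    hk.reg (fun r hr => by have := hZ r hr; omega) (by omega) fun hh => by
      have := hT a hh; omega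
  refine ⟨?_, ?_, ?_, ?_, ?_, fun i hi => ?_, ?_, ?_⟩
  · rw [hreg (by norm_num), h.one]
  · rw [hreg (by norm_num), h.len]
  · rw [hreg (by norm_num), h.bonus]
  · rw [hreg (by norm_num), h.dict]
  · rw [hreg (by norm_num), h.bound]
  · rw [hreg (by norm_num : 10 < 14), ← h.letters i hi]
    refine hk _ (fun hh => ?_) fun r hr j hj => ?_
    · have := hT _ hh; have := h.low; omega
    · have h1 := le_ad r j
      have h2 := hZ r hr
      have h3 := h.high
      have h4 : r ≤ r * r := Nat.le_mul_self r
      omega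
  · rw [hreg (by norm_num)]; exact h.low
  · rw [hreg (by norm_num)]; exact h.high

/-! ### Feeding the input to the two simulated machines. -/

variable {G D : Machine} {cB dB : ℕ} {E : Mem → Prop} {x : Word} {P L r₀ μ κ : ℕ}

theorem ad_eq_iff {r i r' i' : ℕ} : ad r i = ad r' i' ↔ r = r' ∧ i = i' :=
  ⟨ad_inj, by rintro ⟨rfl, rfl⟩; rfl⟩

/-- The state of the memory while the input is being copied to the regions `r` and `r + 2`. -/
structure Feed (x : Word) (σ r i : ℕ) (R₀ R : ℕ → ℕ) : Prop where
  good : Good scratch {r, r + 2} σ R₀ R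
  r17 : R 17 = r
  r18 : R 18 = r + 1
  r26 : R 26 = r + 2
  r24 : R 24 = i + 1
  r27 : R 27 = i + 2
  r28 : R 28 = R₀ 10 + i
  r25 : R 25 = x.length - i
  gen : Holds r (x.length :: x.codes.take i) R
  dec : Holds (r + 2) (x.length :: 0 :: x.codes.take i) R

theorem Base.eight_le {R : ℕ → ℕ} (h : Base x P L r₀ R) : 64 ≤ r₀ :=
  h.low.trans ((Nat.le_add_right _ _).trans h.high)

theorem two_pow_le (μ : ℕ) : 2 ^ μ ≤ 2 ^ (2 * μ + 3) := Nat.pow_le_pow_right two_pos (by omega)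

theorem add_one_add_one (r : ℕ) : r + 1 + 1 = r + 2 := rfl

/-- Unused regions contain zeros, so only `|x|` has to be written. Cell 1 of region `r + 2` stays 0
until the length of the drawn word is known. -/
theorem seed_spec (hκ : (enumerator G D cB dB).CostBound (2 * μ + 3) κ) {ys : List Word} {b r : ℕ}
    {s : Mem} (h : Inv x P L r₀ (2 * μ + 3) ys b r s.R) (hr : r + 4 < 2 ^ μ)
    (hx : x.length + P + 8 < 2 ^ μ) :
    ∃ s', enumVal G D cB dB E (.inl .seed) s =
        (if x.length = 0 then enumVal G D cB dB E (.inr (.inl G.start)) s'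
          else enumVal G D cB dB E (.inl .feed) s') ∧
      Feed x (2 * μ + 3) r 0 s.R s'.R ∧ s'.O = s.O ∧ s'.outputs = s.outputs ∧
      s'.time ≤ s.time + κ := by
  obtain ⟨s', hv, hR, hO, ho, ht⟩ := Flow.val_branch (E := E) (n := .inl .seed) hκ rfl
    (by simp [enumerator, Ctl.ops, place, Op.Det]) h.below
  change _ = runL 0 (Ctl.ops cB dB .seed) s.R at hR
  have hr8 : 8 ≤ r := by have := h.base.eight_le; have := h.lt; omega
  have hr82 : 8 ≤ r + 2 := by omega
  have hp := two_pow_le μ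
  have had : ∀ i k, k < 64 → k ≠ ad r i := fun i k hk => (ad_ne hr8 i hk).symm
  have had2 : ∀ i k, k < 64 → k ≠ ad (r + 2) i := fun i k hk => (ad_ne hr82 i hk).symm
  have hb1 : ad r 0 < 2 ^ (2 * μ + 3) := ad_lt (by omega) (by positivity)
  have hb2 : ad (r + 2) 0 < 2 ^ (2 * μ + 3) := ad_lt (by omega) (by positivity)
  have hb3 := h.below 10
  simp [had, had2, Ctl.ops, runL_append, runL, Op.runR, runL_place_eq, h.region, h.base.one,
    h.base.len, add_one_add_one] at hR
  have e25 : s'.R 25 = x.length := by rw [hR]; simp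
  rw [e25] at hv
  refine ⟨s', hv, ?_, ?_, ?_, ht⟩
  · constructor
    · rw [hR]
      repeat' first | exact Good.refl h.below | apply Good.setCell | apply Good.set
      all_goals first | simp [scratch] | omega
    · rw [hR]; simp [had, had2]
    · rw [hR]; simp [had, had2]
    · rw [hR]; simp [had, had2]
    · rw [hR]; simp
    · rw [hR]; simp
    · rw [hR]; simp
    · rw [hR]; simp
    · intro i
      rw [hR]
      have := h.zero r le_rfl i
      cases i <;> simp [ad_ne hr8, ad_eq_iff, this]
    · intro i
      rw [hR]
      have := h.zero (r + 2) (by omega) i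
      rcases i with _ | _ | i <;> simp [ad_ne hr82, ad_eq_iff, this]
  · rw [hO]; exact (execL_silent 0 (by simp [enumerator, Ctl.ops, place, Op.Silent]) s).1
  · rw [ho]; exact (execL_silent 0 (by simp [enumerator, Ctl.ops, place, Op.Silent]) s).2

theorem Word.length_codes (y : Word) : y.codes.length = y.length := List.length_map _

theorem Word.codes_getD_lt (y : Word) (i : ℕ) : y.codes.getD i 0 < 3 := by
  by_cases hi : i < y.codes.length
  · rw [List.getD_eq_getElem _ _ hi]
    exact y.codes_lt _ (List.getElem_mem hi)
  · rw [List.getD_eq_default _ _ (by omega)]; norm_num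

theorem take_succ_codes {y : Word} {i : ℕ} (hi : i < y.length) :
    y.codes.take (i + 1) = y.codes.take i ++ [y.codes.getD i 0] := by
  rw [List.getD_eq_getElem _ _ (by rwa [y.length_codes]), List.take_concat_get']

theorem feed_spec (hκ : (enumerator G D cB dB).CostBound (2 * μ + 3) κ) {r i : ℕ} {R₀ : ℕ → ℕ}
    (hbase : Base x P L r₀ R₀) (hlt : r₀ < r)
    {s : Mem} (h : Feed x (2 * μ + 3) r i R₀ s.R) (hr : r + 4 < 2 ^ μ)
    (hx : x.length + P + 8 < 2 ^ μ) (hi : i < x.length) :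
    ∃ s', enumVal G D cB dB E (.inl .feed) s =
        (if x.length - (i + 1) = 0 then enumVal G D cB dB E (.inr (.inl G.start)) s'
          else enumVal G D cB dB E (.inl .feed) s') ∧
      Feed x (2 * μ + 3) r (i + 1) R₀ s'.R ∧ s'.O = s.O ∧ s'.outputs = s.outputs ∧
      s'.time ≤ s.time + κ := by
  obtain ⟨s', hv, hR, hO, ho, ht⟩ := Flow.val_branch (E := E) (n := .inl .feed) hκ rfl
    (by simp [enumerator, Ctl.ops, place, Op.Det]) h.good.below
  change _ = runL 0 (Ctl.ops cB dB .feed) s.R at hR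
  have hr8 : 8 ≤ r := by have := hbase.eight_le; omega
  have hr82 : 8 ≤ r + 2 := by omega
  have hbase' := hbase.of_keep h.good.keep (fun a ha => ⟨by have := ha.1; omega, ha.2⟩) (by
    rintro a (rfl | rfl) <;> omega)
  have hp := two_pow_le μ
  have had : ∀ i k, k < 64 → k ≠ ad r i := fun i k hk => (ad_ne hr8 i hk).symm
  have had2 : ∀ i k, k < 64 → k ≠ ad (r + 2) i := fun i k hk => (ad_ne hr82 i hk).symm
  have hb1 : ad r (i + 1) < 2 ^ (2 * μ + 3) := ad_lt (by omega) (by omega)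
  have hb2 : ad (r + 2) (i + 2) < 2 ^ (2 * μ + 3) := ad_lt (by omega) (by omega)
  have e10 : s.R 10 = R₀ 10 := h.good.keep.reg (by rintro a (rfl | rfl) <;> omega) (by norm_num)
    (by simp [scratch])
  have hw : s.R (R₀ 10 + i) = x.codes.getD i 0 := by
    rw [← e10]; exact hbase'.letters i hi
  have hw3 := x.codes_getD_lt i
  have h10 := h.good.below 28
  have h28 : R₀ 10 + i < r₀ := by have := hbase.high; omega
  simp [had, had2, Ctl.ops, runL_append, runL, Op.runR, runL_place_eq, h.r17, h.r24, h.r25, h.r26,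
    h.r27, h.r28, hbase'.one, hw, add_one_add_one, -List.getD_eq_getElem?_getD] at hR
  have e25 : s'.R 25 = x.length - (i + 1) := by rw [hR]; simp; omega
  rw [e25] at hv
  have hlen : (x.codes.take i).length = i := by
    rw [List.length_take, x.length_codes]; omega
  refine ⟨s', hv, ?_, ?_, ?_, ht⟩
  · constructor
    · rw [hR]
      repeat' first | exact h.good | apply Good.setCell | apply Good.set
      all_goals first | simp [scratch]; done | omega
    · rw [hR]; simp [had, had2, h.r17]
    · rw [hR]; simp [had, had2, h.r18]
    · rw [hR]; simp [had, had2, h.r26]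
    · rw [hR]; simp
    · rw [hR]; simp
    · rw [hR]; simp [add_assoc]
    · exact e25
    · rw [take_succ_codes hi, ← List.cons_append]
      refine h.gen.concat ?_ fun j hj => ?_ <;> rw [hR]
      · simp [ad_ne hr8, ad_eq_iff, hlen]
      · rw [List.length_cons, hlen] at hj
        simp [ad_ne hr8, ad_eq_iff, hj]
    · rw [take_succ_codes hi, ← List.cons_append, ← List.cons_append]
      refine h.dec.concat ?_ fun j hj => ?_ <;> rw [hR]
      · simp [ad_ne hr82, hlen]
      · rw [List.length_cons, List.length_cons, hlen] at hj
        simp [ad_ne hr82, ad_eq_iff, hj]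
  · rw [hO]; exact (execL_silent 0 (by simp [enumerator, Ctl.ops, place, Op.Silent]) s).1
  · rw [ho]; exact (execL_silent 0 (by simp [enumerator, Ctl.ops, place, Op.Silent]) s).2

/-- The exit test is part of the statement, so the empty input, for which the loop body is never
entered, is included. -/
theorem feed_loop (hκ : (enumerator G D cB dB).CostBound (2 * μ + 3) κ) {r : ℕ} {R₀ : ℕ → ℕ}
    (hbase : Base x P L r₀ R₀) (hlt : r₀ < r) (hr : r + 4 < 2 ^ μ)
    (hx : x.length + P + 8 < 2 ^ μ) (k : ℕ) : ∀ i, i + k = x.length → ∀ s : Mem,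
    Feed x (2 * μ + 3) r i R₀ s.R →
    ∃ s', (if x.length - i = 0 then enumVal G D cB dB E (.inr (.inl G.start)) s
          else enumVal G D cB dB E (.inl .feed) s) =
        enumVal G D cB dB E (.inr (.inl G.start)) s' ∧
      Feed x (2 * μ + 3) r x.length R₀ s'.R ∧ s'.O = s.O ∧ s'.outputs = s.outputs ∧
      s'.time ≤ s.time + k * κ := by
  induction k with
  | zero =>
    intro i hi s h
    rw [add_zero] at hi
    subst hi
    exact ⟨s, by simp, h, rfl, rfl, by omega⟩
  | succ k ih =>
    intro i hi s h
    obtain ⟨s₁, hv, h₁, hO, ho, ht⟩ := feed_spec (E := E) hκ hbase hlt h hr hx (by omega)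
    obtain ⟨s₂, hv', h₂, hO', ho', ht'⟩ := ih (i + 1) (by omega) s₁ h₁
    refine ⟨s₂, ?_, h₂, hO'.trans hO, ho'.trans ho, by rw [add_mul]; omega⟩
    rw [if_neg (by omega), hv, hv']

/-! ### Inspecting and copying the generator's output. -/

variable {G D : Machine} {cB dB : ℕ} {E : Mem → Prop} {x : Word} {P L r₀ μ κ : ℕ}

/-- The memory after the generator has produced the content `o` of its output registers. -/
structure Drawn (x : Word) (σ r : ℕ) (o : ℕ → ℕ) (R₀ R : ℕ → ℕ) : Prop where
  good : Good scratch {r, r + 1, r + 2} σ R₀ R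
  r18 : R 18 = r + 1
  out : ∀ i, R (ad (r + 1) i) = o i
  dec : Holds (r + 2) (x.length :: 0 :: x.codes) R

/-- The word in the output registers, truncated to length `i`. -/
def outWord (o : ℕ → ℕ) (i : ℕ) : List ℕ := (List.range i).map fun j => o (j + 1)

theorem outWord_succ (o : ℕ → ℕ) (i : ℕ) : outWord o (i + 1) = outWord o i ++ [o (i + 1)] := by
  simp [outWord, List.range_succ]

theorem length_outWord (o : ℕ → ℕ) (i : ℕ) : (outWord o i).length = i := by simp [outWord]

theorem mem_outWord {o : ℕ → ℕ} {i a : ℕ} : a ∈ outWord o i ↔ ∃ j < i, o (j + 1) = a := by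
  simp [outWord]

/-- The state of the memory when `i` letters of the word produced by the generator have been
copied. -/
structure Lett (x : Word) (σ r i : ℕ) (o : ℕ → ℕ) (R₀ R O : ℕ → ℕ) : Prop where
  good : Good scratch {r, r + 1, r + 2} σ R₀ R
  r18 : R 18 = r + 1
  out : ∀ i, R (ad (r + 1) i) = o i
  r26 : R 26 = r + 2
  r19 : R 19 = wordCode (outWord o i)
  r24 : R 24 = i + 1
  r27 : R 27 = 2 + x.length + i
  r25 : R 25 = o 0 - i
  dec : Holds (r + 2) (x.length :: o 0 :: (x.codes ++ outWord o i)) R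
  O_zero : O 0 = o 0
  O_succ : ∀ j < i, O (j + 1) = o (j + 1)
  small : ∀ j < i, o (j + 1) < 3

theorem scratch_lt : ∀ a ∈ scratch, 14 ≤ a ∧ a < 64 := fun _ ha => ⟨by have := ha.1; omega, ha.2⟩

theorem check_spec (hκ : (enumerator G D cB dB).CostBound (2 * μ + 3) κ) {r : ℕ} {o R₀ : ℕ → ℕ}
    (hbase : Base x P L r₀ R₀) (hlt : r₀ < r) {s : Mem}
    (h : Drawn x (2 * μ + 3) r o R₀ s.R) (hr : r + 4 < 2 ^ μ) :
    ∃ s', enumVal G D cB dB E (.inl .check) s =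
        (if o 0 - P = 0 then enumVal G D cB dB E (.inl .accept) s'
          else enumVal G D cB dB E (.inl .finish) s') ∧
      Drawn x (2 * μ + 3) r o R₀ s'.R ∧ s'.R 29 = o 0 ∧ s'.O = s.O ∧ s'.outputs = s.outputs ∧
      s'.time ≤ s.time + κ := by
  obtain ⟨s', hv, hR, hO, ho, ht⟩ := Flow.val_branch (E := E) (n := .inl .check) hκ rfl
    (by simp [enumerator, Ctl.ops, fetch, Op.Det]) h.good.below
  change _ = runL 0 (Ctl.ops cB dB .check) s.R at hR
  have hr81 : 8 ≤ r + 1 := by have := hbase.eight_le; omega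
  have hr82 : 8 ≤ r + 2 := by omega
  have hbase' := hbase.of_keep h.good.keep scratch_lt (by rintro a (rfl | rfl | rfl) <;> omega)
  have hp := two_pow_le μ
  have had1 : ∀ i k, k < 64 → k ≠ ad (r + 1) i := fun i k hk => (ad_ne hr81 i hk).symm
  have hb1 : ad (r + 1) 0 < 2 ^ (2 * μ + 3) := ad_lt (by omega) (by positivity)
  have hb2 := h.good.below (ad (r + 1) 0)
  rw [h.out] at hb2
  simp [ad_ne hr81, Ctl.ops, runL_append, runL, Op.runR, runL_fetch_eq, h.r18, h.out,
    hbase'.bound] at hR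
  have e23 : s'.R 23 = o 0 - P := by rw [hR]; simp
  rw [e23] at hv
  refine ⟨s', hv, ?_, ?_, ?_, ?_, ht⟩
  · constructor
    · rw [hR]
      repeat' first | exact h.good | apply Good.setCell | apply Good.set
      all_goals first | simp [scratch] | omega
    · rw [hR]; simp [h.r18]
    · intro i; rw [hR]; simp [ad_ne hr81, h.out]
    · intro i; rw [hR]; simp [ad_ne hr82, h.dec i]
  · rw [hR]; simp
  · rw [hO]; exact (execL_silent 0 (by simp [enumerator, Ctl.ops, fetch, Op.Silent]) s).1
  · rw [ho]; exact (execL_silent 0 (by simp [enumerator, Ctl.ops, fetch, Op.Silent]) s).2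

theorem accept_spec (hκ : (enumerator G D cB dB).CostBound (2 * μ + 3) κ) {r : ℕ} {o R₀ : ℕ → ℕ}
    (hbase : Base x P L r₀ R₀) (hlt : r₀ < r) {s : Mem}
    (h : Drawn x (2 * μ + 3) r o R₀ s.R) (h29 : s.R 29 = o 0) (hr : r + 4 < 2 ^ μ)
    (hx : x.length + P + 8 < 2 ^ μ) :
    ∃ s', enumVal G D cB dB E (.inl .accept) s =
        (if o 0 = 0 then enumVal G D cB dB E (.inl .pass) s'
          else enumVal G D cB dB E (.inl .letter) s') ∧
      Lett x (2 * μ + 3) r 0 o R₀ s'.R s'.O ∧ s'.outputs = s.outputs ∧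
      s'.time ≤ s.time + κ := by
  obtain ⟨s', hv, hR, hO, ho, ht⟩ := Flow.val_branch (E := E) (n := .inl .accept) hκ rfl
    (by simp [enumerator, Ctl.ops, place, Op.Det]) h.good.below
  change _ = runL 0 (Ctl.ops cB dB .accept) s.R at hR
  change _ = (execL 0 (Ctl.ops cB dB .accept) s).O at hO
  change _ = (execL 0 (Ctl.ops cB dB .accept) s).outputs at ho
  have hr81 : 8 ≤ r + 1 := by have := hbase.eight_le; omega
  have hr82 : 8 ≤ r + 2 := by omega
  have hbase' := hbase.of_keep h.good.keep scratch_lt (by rintro a (rfl | rfl | rfl) <;> omega)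
  have hp := two_pow_le μ
  have had2 : ∀ i k, k < 64 → k ≠ ad (r + 2) i := fun i k hk => (ad_ne hr82 i hk).symm
  have hb1 : ad (r + 2) 1 < 2 ^ (2 * μ + 3) := ad_lt (by omega) (by omega)
  have hb2 := h.good.below 29
  rw [h29] at hb2
  have hsil := execL_silent 0 (l := ([.add 26 18 6, .const 20 1] ++ (place 26 20 29 ++
        [.const 19 1, .const 24 1, .const 27 2, .add 27 27 7, .copy 25 29])))
        (by simp [place, Op.Silent])
        (execL 0 [.const 20 0, .writeOut 20 29] s)
  rw [Ctl.ops, execL_append, hsil.1] at hO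
  rw [Ctl.ops, execL_append, hsil.2] at ho
  simp [execL, Op.exec, Op.runO, Op.runR, h29] at hO ho
  simp [had2, Ctl.ops, runL_append, runL, Op.runR, runL_place_eq, h.r18, hbase'.one, hbase'.len,
    h29, add_one_add_one] at hR
  have e25 : s'.R 25 = o 0 := by rw [hR]; simp
  rw [e25] at hv
  refine ⟨s', hv, ?_, ho, ht⟩
  constructor
  · rw [hR]
    repeat' first | exact h.good | apply Good.setCell | apply Good.set
    all_goals first | simp [scratch] | omega
  · rw [hR]; simp [had2, h.r18]
  · intro i; rw [hR]; simp [ad_ne hr81, ad_eq_iff, h.out]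
  · rw [hR]; simp [had2]
  · rw [hR]; simp [wordCode, outWord]
  · rw [hR]; simp
  · rw [hR]; simp
  · rw [e25]; rfl
  · intro i
    have := h.dec i
    rw [hR]
    rcases i with _ | _ | i <;> simp [ad_ne hr82, ad_eq_iff, this, outWord]
  · rw [hO]; simp
  · intro j hj; omega
  · intro j hj; omega

theorem letter_spec (hκ : (enumerator G D cB dB).CostBound (2 * μ + 3) κ) {r i : ℕ}
    {o R₀ : ℕ → ℕ} (hbase : Base x P L r₀ R₀) (hlt : r₀ < r) {s : Mem}
    (h : Lett x (2 * μ + 3) r i o R₀ s.R s.O) (hi : i < o 0) (hr : r + 4 < 2 ^ μ)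
    (hx : x.length + P + 8 < 2 ^ μ) (hP : o 0 ≤ P) :
    ∃ s', enumVal G D cB dB E (.inl .letter) s =
        (if o (i + 1) - 2 = 0 then enumVal G D cB dB E (.inl .put) s'
          else enumVal G D cB dB E (.inl .finish) s') ∧
      Lett x (2 * μ + 3) r i o R₀ s'.R s'.O ∧ s'.R 23 = o (i + 1) ∧ s'.outputs = s.outputs ∧
      s'.time ≤ s.time + κ := by
  obtain ⟨s', hv, hR, hO, ho, ht⟩ := Flow.val_branch (E := E) (n := .inl .letter) hκ rfl
    (by simp [enumerator, Ctl.ops, fetch, Op.Det]) h.good.below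
  change _ = runL 0 (Ctl.ops cB dB .letter) s.R at hR
  have hr81 : 8 ≤ r + 1 := by have := hbase.eight_le; omega
  have hr82 : 8 ≤ r + 2 := by omega
  have hp := two_pow_le μ
  have hb1 : ad (r + 1) (i + 1) < 2 ^ (2 * μ + 3) := ad_lt (by omega) (by omega)
  have hb2 := h.good.below (ad (r + 1) (i + 1))
  rw [h.out] at hb2
  simp [ad_ne hr81, Ctl.ops, runL_append, runL, Op.runR, runL_fetch_eq, h.r18, h.r24, h.out] at hR
  have e22 : s'.R 22 = o (i + 1) - 2 := by rw [hR]; simp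
  rw [e22] at hv
  have hsO : s'.O = s.O := by
    rw [hO]; exact (execL_silent 0 (by simp [enumerator, Ctl.ops, fetch, Op.Silent]) s).1
  refine ⟨s', hv, ?_, ?_, ?_, ht⟩
  · constructor
    · rw [hR]
      repeat' first | exact h.good | apply Good.setCell | apply Good.set
      all_goals first | simp [scratch] | omega
    · rw [hR]; simp [h.r18]
    · intro i; rw [hR]; simp [ad_ne hr81, h.out]
    · rw [hR]; simp [h.r26]
    · rw [hR]; simp [h.r19]
    · rw [hR]; simp [h.r24]
    · rw [hR]; simp [h.r27]
    · rw [hR]; simp [h.r25]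
    · intro i; rw [hR]; rw [← h.dec i]; simp [ad_ne hr82]
    · rw [hsO]; exact h.O_zero
    · rw [hsO]; exact h.O_succ
    · exact h.small
  · rw [hR]; simp
  · rw [ho]; exact (execL_silent 0 (by simp [enumerator, Ctl.ops, fetch, Op.Silent]) s).2

/-- The code of the word is computed along with the copying. The preceding checks of length and
letters keep it below `2 * 4 ^ P`, so it is a legitimate cell of the dictionary. -/
theorem put_spec (hκ : (enumerator G D cB dB).CostBound (2 * μ + 3) κ) {r i : ℕ}
    {o R₀ : ℕ → ℕ} (hbase : Base x P L r₀ R₀) (hlt : r₀ < r) {s : Mem}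
    (h : Lett x (2 * μ + 3) r i o R₀ s.R s.O) (hi : i < o 0) (hr : r + 4 < 2 ^ μ)
    (hx : x.length + P + 8 < 2 ^ μ) (hP : o 0 ≤ P) (hcode : 2 * 4 ^ P < 2 ^ μ)
    (h23 : s.R 23 = o (i + 1)) (h3 : o (i + 1) < 3) :
    ∃ s', enumVal G D cB dB E (.inl .put) s =
        (if o 0 - (i + 1) = 0 then enumVal G D cB dB E (.inl .pass) s'
          else enumVal G D cB dB E (.inl .letter) s') ∧
      Lett x (2 * μ + 3) r (i + 1) o R₀ s'.R s'.O ∧ s'.outputs = s.outputs ∧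
      s'.time ≤ s.time + κ := by
  obtain ⟨s', hv, hR, hO, ho, ht⟩ := Flow.val_branch (E := E) (n := .inl .put) hκ rfl
    (by simp [enumerator, Ctl.ops, place, Op.Det]) h.good.below
  change _ = runL 0 (Ctl.ops cB dB .put) s.R at hR
  change _ = (execL 0 (Ctl.ops cB dB .put) s).O at hO
  change _ = (execL 0 (Ctl.ops cB dB .put) s).outputs at ho
  have hr81 : 8 ≤ r + 1 := by have := hbase.eight_le; omega
  have hr82 : 8 ≤ r + 2 := by omega
  have hbase' := hbase.of_keep h.good.keep scratch_lt (by rintro a (rfl | rfl | rfl) <;> omega)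
  have hp := two_pow_le μ
  have had2 : ∀ i k, k < 64 → k ≠ ad (r + 2) i := fun i k hk => (ad_ne hr82 i hk).symm
  have hb1 : ad (r + 2) (2 + x.length + i) < 2 ^ (2 * μ + 3) := ad_lt (by omega) (by omega)
  have hsmall : ∀ j < i + 1, o (j + 1) < 3 := by
    intro j hj
    rcases Nat.lt_succ_iff_lt_or_eq.1 hj with hj | rfl
    exacts [h.small j hj, h3]
  have hcd : wordCode (outWord o (i + 1)) = 4 * wordCode (outWord o i) + o (i + 1) := by
    rw [outWord_succ, wordCode_concat]
  have hclt : wordCode (outWord o (i + 1)) < 2 ^ μ := by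
    refine (wordCode_lt ?_).trans_le (le_trans ?_ hcode.le)
    · intro a ha
      obtain ⟨j, hj, rfl⟩ := mem_outWord.1 ha
      exact hsmall j hj
    · rw [length_outWord]
      exact Nat.mul_le_mul_left _ (Nat.pow_le_pow_right (by norm_num) (by omega))
  have hsil := execL_silent 0 (l := place 26 27 23 ++
        [.add 19 19 19, .add 19 19 19, .add 19 19 23, .add 24 24 6, .add 27 27 6, .sub 25 25 6])
        (by simp [place, Op.Silent]) ((Op.writeOut 24 23).exec 0 s)
  rw [Ctl.ops, execL, hsil.1] at hO
  rw [Ctl.ops, execL, hsil.2] at ho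
  simp [Op.exec, Op.runO, h23, h.r24] at hO ho
  simp [had2, Ctl.ops, runL_append, runL, Op.runR, runL_place_eq, h.r26, h.r27, h.r19, h.r24,
    h.r25, hbase'.one, h23] at hR
  have e25 : s'.R 25 = o 0 - (i + 1) := by rw [hR]; simp; omega
  rw [e25] at hv
  have hlen : (x.length :: o 0 :: (x.codes ++ outWord o i)).length = 2 + x.length + i := by
    simp [length_outWord, x.length_codes]; omega
  refine ⟨s', hv, ?_, ho, ht⟩
  constructor
  · rw [hR]
    repeat' first | exact h.good | apply Good.setCell | apply Good.set
    all_goals first | simp [scratch] | omega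
  · rw [hR]; simp [had2, h.r18]
  · intro i; rw [hR]; simp [ad_ne hr81, ad_eq_iff, h.out]
  · rw [hR]; simp [had2, h.r26]
  · rw [hR, hcd]; simp; omega
  · rw [hR]; simp
  · rw [hR]; simp [add_assoc]
  · exact e25
  · rw [outWord_succ, ← List.append_assoc, ← List.cons_append, ← List.cons_append]
    refine h.dec.concat ?_ fun j hj => ?_ <;> rw [hR]
    · rw [hlen]; simp [ad_ne hr82]
    · rw [hlen] at hj
      simp [ad_ne hr82, ad_eq_iff, hj]
  · rw [hO]; simp [h.O_zero]
  · intro j hj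
    rw [hO]
    by_cases hji : j = i
    · subst hji; simp
    · rw [Function.update_of_ne (by omega)]; exact h.O_succ j (by omega)
  · exact hsmall

/-- Either some content is not a letter and the run ends there, or the whole word is copied; each
letter takes two blocks. -/
theorem letter_loop (hκ : (enumerator G D cB dB).CostBound (2 * μ + 3) κ) {r : ℕ}
    {o R₀ : ℕ → ℕ} (hbase : Base x P L r₀ R₀) (hlt : r₀ < r) (hr : r + 4 < 2 ^ μ)
    (hx : x.length + P + 8 < 2 ^ μ) (hP : o 0 ≤ P) (hcode : 2 * 4 ^ P < 2 ^ μ) (k : ℕ) :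
    ∀ i, i + k = o 0 → ∀ s : Mem, Lett x (2 * μ + 3) r i o R₀ s.R s.O →
    ∃ s', s'.outputs = s.outputs ∧ s'.time ≤ s.time + 2 * k * κ ∧
      ((∃ j < o 0, 3 ≤ o (j + 1)) ∧
        (if o 0 - i = 0 then enumVal G D cB dB E (.inl .pass) s
          else enumVal G D cB dB E (.inl .letter) s) = enumVal G D cB dB E (.inl .finish) s' ∨
      Lett x (2 * μ + 3) r (o 0) o R₀ s'.R s'.O ∧
        (if o 0 - i = 0 then enumVal G D cB dB E (.inl .pass) s
          else enumVal G D cB dB E (.inl .letter) s) = enumVal G D cB dB E (.inl .pass) s') := by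
  induction k with
  | zero =>
    intro i hi s h
    rw [add_zero] at hi
    subst hi
    exact ⟨s, rfl, by omega, .inr ⟨h, by simp⟩⟩
  | succ k ih =>
    intro i hi s h
    obtain ⟨s₁, hv, h₁, h23, ho, ht⟩ :=
      letter_spec (E := E) hκ hbase hlt h (by omega) hr hx hP
    have hne : ¬ o 0 - i = 0 := by omega
    simp only [if_neg hne]
    have hk : 2 * (k + 1) * κ = 2 * k * κ + κ + κ := by ring
    by_cases h3 : o (i + 1) < 3
    · rw [if_pos (by omega)] at hv
      obtain ⟨s₂, hv', h₂, ho', ht'⟩ :=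
        put_spec (E := E) hκ hbase hlt h₁ (by omega) hr hx hP hcode h23 h3
      obtain ⟨s₃, ho'', ht'', h₃⟩ := ih (i + 1) (by omega) s₂ h₂
      rw [← hv', ← hv] at h₃
      exact ⟨s₃, ho''.trans (ho'.trans ho), by omega, h₃⟩
    · rw [if_neg (by omega)] at hv
      exact ⟨s₁, ho, by omega, .inl ⟨⟨i, by omega, by omega⟩, hv⟩⟩

/-- The inspection of the output of the generator. -/
theorem inspect_spec (hκ : (enumerator G D cB dB).CostBound (2 * μ + 3) κ) {r : ℕ}
    {o R₀ : ℕ → ℕ} (hbase : Base x P L r₀ R₀) (hlt : r₀ < r) (hr : r + 4 < 2 ^ μ)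
    (hx : x.length + P + 8 < 2 ^ μ) (hcode : 2 * 4 ^ P < 2 ^ μ) {s : Mem}
    (h : Drawn x (2 * μ + 3) r o R₀ s.R) :
    ∃ s', s'.outputs = s.outputs ∧ s'.time ≤ s.time + (2 * P + 2) * κ ∧
      ((¬ ∃ y : Word, y.codes = outWord o (o 0) ∧ y.length ≤ P) ∧
        enumVal G D cB dB E (.inl .check) s = enumVal G D cB dB E (.inl .finish) s' ∨
      ∃ y : Word, y.codes = outWord o (o 0) ∧ y.length ≤ P ∧
        Lett x (2 * μ + 3) r (o 0) o R₀ s'.R s'.O ∧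
        enumVal G D cB dB E (.inl .check) s = enumVal G D cB dB E (.inl .pass) s') := by
  obtain ⟨s₁, hv₁, h₁, h29, hO₁, ho₁, ht₁⟩ := check_spec (E := E) hκ hbase hlt h hr
  have hlen : ∀ y : Word, y.codes = outWord o (o 0) → y.length = o 0 := fun y hy => by
    rw [← y.length_codes, hy, length_outWord]
  have hk : (2 * P + 2) * κ = 2 * P * κ + κ + κ := by ring
  by_cases hP : o 0 ≤ P
  · rw [if_pos (by omega)] at hv₁
    obtain ⟨s₂, hv₂, h₂, ho₂, ht₂⟩ := accept_spec (E := E) hκ hbase hlt h₁ h29 hr hx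
    obtain ⟨s₃, ho₃, ht₃, h₃⟩ :=
      letter_loop (E := E) hκ hbase hlt hr hx hP hcode (o 0) 0 (by omega) s₂ h₂
    rw [Nat.sub_zero, ← hv₂, ← hv₁] at h₃
    have hle : 2 * o 0 * κ ≤ 2 * P * κ := by gcongr
    refine ⟨s₃, ho₃.trans (ho₂.trans ho₁), by omega, ?_⟩
    rcases h₃ with ⟨⟨j, hj, hj3⟩, hv₃⟩ | ⟨h₃, hv₃⟩
    · refine .inl ⟨?_, hv₃⟩
      rintro ⟨y, hy, -⟩
      have := y.codes_lt (o (j + 1)) (by rw [hy]; exact mem_outWord.2 ⟨j, hj, rfl⟩)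
      omega
    · obtain ⟨y, hy⟩ := exists_codes (l := outWord o (o 0)) (by
        intro a ha
        obtain ⟨j, hj, rfl⟩ := mem_outWord.1 ha
        exact h₃.small j hj)
      exact .inr ⟨y, hy, (hlen y hy).trans_le hP, h₃, hv₃⟩
  · rw [if_neg (by omega)] at hv₁
    refine ⟨s₁, ho₁, by rw [hk]; omega, .inl ⟨?_, hv₁⟩⟩
    rintro ⟨y, hy, hle⟩
    have := hlen y hy
    omega

/-! ### Deciding membership and updating the dictionary. -/

variable {G D : Machine} {cB dB : ℕ} {E : Mem → Prop} {x : Word} {P L r₀ μ κ : ℕ}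

/-- The facts about the generator, the decision procedure and the bounds that the analysis of a
draw depends on. -/
structure Setting (G D : Machine) (cB dB : ℕ) (A : Word → Word → Prop) (x : Word)
    (P μ κ TG TD : ℕ) : Prop where
  cost : (enumerator G D cB dB).CostBound (2 * μ + 3) κ
  len_lt : x.length + P + 8 < 2 ^ μ
  code_lt : 2 * 4 ^ P < 2 ^ μ
  balanced : ∀ y, A x y → y.length ≤ P
  constG : ∀ l, (G.code l).maxConst < 2 ^ μ
  constD : ∀ l, (D.code l).maxConst < 2 ^ μ
  reachG : ∀ c, Machine.Reach (G.init (inputWord x)) c → c.time ≤ TG ∧ ∀ i, c.R i < 2 ^ μ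
  reachD : ∀ y, y.length ≤ P → ∀ c, Machine.Reach (D.init (inputPair x y)) c →
    c.time ≤ TD ∧ ∀ i, c.R i < 2 ^ μ
  valueD : ∀ y, D.value (Machine.ind fun c => c.R 0 ≠ 0 ↔ A x y) (D.init (inputPair x y)) = 1

/-- The state of the memory when the decision procedure has inspected the word `y`. -/
structure Decided (σ r : ℕ) (y : Word) (R₀ R O : ℕ → ℕ) : Prop where
  good : Good scratch {r, r + 1, r + 2, r + 3} σ R₀ R
  r19 : R 19 = wordCode y.codes
  word : outWord O (O 0) = y.codes

/-- The simulated decision is correct with probability one, so any lower bound `ψ` valid after the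
correct verdict is valid before the call. -/
theorem decide_spec {A : Word → Word → Prop} {TG TD : ℕ} (hS : Setting G D cB dB A x P μ κ TG TD)
    {r b : ℕ} {ys : List Word} {o R₀ : ℕ → ℕ} (hinv : Inv x P L r₀ (2 * μ + 3) ys b r R₀)
    (hr : r + 8 < 2 ^ μ) {y : Word} (hy : y.codes = outWord o (o 0)) (hyP : y.length ≤ P)
    {s : Mem} (h : Lett x (2 * μ + 3) r (o 0) o R₀ s.R s.O) {ψ : ℝ≥0∞}
    (hψ : ∀ s' : Mem, Decided (2 * μ + 3) r y R₀ s'.R s'.O → s'.outputs = s.outputs →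
      s'.time ≤ s.time + (TD + 3) * κ →
      (A x y → ψ ≤ enumVal G D cB dB E (.inl .lookup) s') ∧
        (¬ A x y → ψ ≤ enumVal G D cB dB E (.inl .finish) s')) :
    ψ ≤ enumVal G D cB dB E (.inl .pass) s := by
  have hr8 : 8 ≤ r := by have := hinv.base.eight_le; have := hinv.lt; omega
  have hr82 : 8 ≤ r + 2 := by omega
  have hbase' := hinv.base.of_keep h.good.keep scratch_lt (by
    have := hinv.lt; rintro a (rfl | rfl | rfl) <;> omega)
  have hp := two_pow_le μ
  obtain ⟨s₁, hv₁, hR₁, hO₁, ho₁, ht₁⟩ := Flow.val_goto (E := E) (n := .inl .pass) hS.cost rfl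
    (by simp [enumerator, Ctl.ops, Op.Det]) h.good.below
  change _ = runL 0 (Ctl.ops cB dB .pass) s.R at hR₁
  rw [(execL_silent 0 (by simp [enumerator, Ctl.ops, Op.Silent]) s).1] at hO₁
  rw [(execL_silent 0 (by simp [enumerator, Ctl.ops, Op.Silent]) s).2] at ho₁
  simp [Ctl.ops, runL, Op.runR, h.r26, hbase'.one] at hR₁
  have hgood₁ : Good scratch {r, r + 1, r + 2} (2 * μ + 3) R₀ s₁.R := by
    rw [hR₁]
    repeat' first | exact h.good | apply Good.setCell | apply Good.set
    all_goals first | simp [scratch] | omega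
  have hzero₁ : ∀ i, s₁.R (ad (r + 3) i) = 0 := by
    intro i
    rw [hgood₁.keep.cell (by omega) (fun a ha => ha.2) (by simp) i]
    exact hinv.zero _ (by omega) i
  have hlen : o 0 = y.length := by rw [← y.length_codes, hy, length_outWord]
  have hsim : Sim (r + 2) (2 * μ + 3) s₁.R (D.init (inputPair x y)) s₁.R :=
    { region := by rw [hR₁]; simp
      outRegion := by rw [hR₁]; simp
      work := by
        intro i
        have := h.dec i
        rw [hlen, ← hlen, ← hy, hlen] at this
        rw [hR₁, Function.update_of_ne (ad_ne hr82 i (by norm_num)),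
          Function.update_of_ne (ad_ne hr82 i (by norm_num)), this]
        rfl
      out := hzero₁
      keep := Keep.refl _ _ _
      below := hgood₁.below }
  have hemb : ∀ l, D.code l ≠ .halt →
      (enumerator G D cB dB).ops (.inr (.inr l)) = simOps (D.code l) ∧
      (enumerator G D cB dB).exit (.inr (.inr l)) =
        simExit (fun l => (.inr (.inr l) : Ctl ⊕ G.Λ ⊕ D.Λ)) (D.code l) := by
    intro l hl
    refine ⟨rfl, ?_⟩
    change (match D.code l with
      | .halt => Exit.goto (Sum.inl Ctl.verdict)
      | i => simExit (fun l => (.inr (.inr l) : Ctl ⊕ G.Λ ⊕ D.Λ)) i) = _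
    split
    · contradiction
    · rfl
  have key := Flow.value_le_val_of_sim (F := enumerator G D cB dB) (E := E) (s₀ := s₁)
    (emb := fun l => (.inr (.inr l) : Ctl ⊕ G.Λ ⊕ D.Λ)) hemb
    (by omega) (by omega) hS.cost hS.constD (fun c hc => (hS.reachD y hyP c hc).2)
    -- The sum over one point only serves to obtain the factor `ψ` from `Machine.value_sum`.
    (Φ := fun c => ∑ _i ∈ ({()} : Finset Unit),
      Machine.ind (fun c : Cfg D.Λ => c.R 0 ≠ 0 ↔ A x y) c * ψ) hsim ?_
  · rw [Machine.value_sum] at key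
    simp only [Finset.sum_const, Finset.card_singleton, one_smul, hS.valueD, one_mul] at key
    exact key.trans hv₁.ge
  · intro c s₂ hc hh hs₂ hO₂ ho₂ ht₂
    simp only [Finset.sum_const, Finset.card_singleton, one_smul]
    by_cases hdec : c.R 0 ≠ 0 ↔ A x y
    swap
    · simp [Machine.ind, hdec]
    simp only [Machine.ind, hdec, if_true, one_mul]
    have hTD : κ * c.time ≤ TD * κ := by
      rw [mul_comm]; exact Nat.mul_le_mul_right _ (hS.reachD y hyP c hc).1
    have hgood₂ : Good scratch {r, r + 1, r + 2, r + 3} (2 * μ + 3) R₀ s₂.R :=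
      (hgood₁.mono subset_rfl (by intro a; simp; tauto)).trans
        ⟨hs₂.keep.mono (fun a ha => ⟨by have := ha.1; omega, by have := ha.2; omega⟩)
          (by intro a; simp; omega), hs₂.below⟩
    have hhc : D.code c.label = .halt := hh
    have hxit : (enumerator G D cB dB).exit (.inr (.inr c.label)) = .goto (.inl .verdict) := by
      change (match D.code c.label with
        | .halt => Exit.goto (Sum.inl Ctl.verdict)
        | i => simExit (fun l => (.inr (.inr l) : Ctl ⊕ G.Λ ⊕ D.Λ)) i) = _
      rw [hhc]; rfl
    have hops : (enumerator G D cB dB).ops (.inr (.inr c.label)) = [] := by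
      change simOps (D.code c.label) = []
      rw [hhc]; rfl
    obtain ⟨s₃, hv₃, hR₃, hO₃, ho₃, ht₃⟩ := Flow.val_goto (E := E) hS.cost hxit
      (by simp [hops]) hs₂.below
    rw [hops] at hR₃ hO₃ ho₃
    have hb₃ : Below (2 * μ + 3) s₃.R := by rw [hR₃]; exact hs₂.below
    obtain ⟨s₄, hv₄, hR₄, hO₄, ho₄, ht₄⟩ := Flow.val_branch (E := E) (n := .inl .verdict) hS.cost
      rfl (by simp [enumerator, Ctl.ops, fetch, Op.Det]) hb₃
    change _ = runL 0 (Ctl.ops cB dB .verdict) s₃.R at hR₄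
    rw [(execL_silent 0 (by simp [enumerator, Ctl.ops, fetch, Op.Silent]) s₃).1] at hO₄
    rw [(execL_silent 0 (by simp [enumerator, Ctl.ops, fetch, Op.Silent]) s₃).2] at ho₄
    have hR₃' : s₃.R = s₂.R := hR₃
    simp [ad_ne hr82, Ctl.ops, runL, Op.runR, runL_fetch_eq, hR₃', hs₂.region, hs₂.work] at hR₄
    have e23 : s₄.R 23 = c.R 0 := by rw [hR₄]; simp
    rw [e23] at hv₄
    have h19 : s₂.R 19 = wordCode y.codes := by
      rw [hs₂.keep.reg (by rintro a (rfl | rfl) <;> omega) (by norm_num) (by simp), hR₁]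
      simp [h.r19, hy]
    have hb : ad (r + 2) 0 < 2 ^ (2 * μ + 3) := ad_lt (by omega) (by positivity)
    have hb' : c.R 0 < 2 ^ (2 * μ + 3) := ((hS.reachD y hyP c hc).2 0).trans_le hp
    -- The simulation writes its outputs into a memory region, so the word prepared in the real
    -- output registers survives until it may be output.
    have hOeq : s₄.O = s.O := hO₄.trans (hO₃.trans (hO₂.trans hO₁))
    have hD : Decided (2 * μ + 3) r y R₀ s₄.R s₄.O := by
      refine ⟨?_, by rw [hR₄]; simp [h19], ?_⟩
      · rw [hR₄]
        repeat' first | exact hgood₂ | apply Good.setCell | apply Good.set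
        all_goals first | simp [scratch] | omega
      · rw [hOeq, hy, h.O_zero]
        refine List.map_congr_left fun j hj => h.O_succ j (List.mem_range.1 hj)
    have hT : (TD + 3) * κ = TD * κ + κ + κ + κ := by ring
    have := hψ s₄ hD (ho₄.trans (ho₃.trans (ho₂.trans ho₁))) (by omega)
    refine le_trans ?_ (hv₃.trans hv₄).ge
    by_cases h0 : c.R 0 = 0
    · rw [if_pos h0]
      exact this.2 fun hA => hdec.2 hA h0
    · rw [if_neg h0]
      exact this.1 (hdec.1 h0)

theorem Inv.of_good {σ b b' r : ℕ} {ys ys' : List Word} {R₀ R : ℕ → ℕ}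
    (h : Inv x P L r₀ σ ys b r R₀)
    (hg : Good {a | 14 ≤ a ∧ a < 64 ∧ a ≠ 16} {r₀, r, r + 1, r + 2, r + 3} σ R₀ R)
    (h14 : R 14 = b') (h15 : R 15 = r + 4)
    (hf : ∀ k, R (ad r₀ k) = if k ∈ ys'.map (fun y => wordCode y.codes) then 1 else 0) :
    Inv x P L r₀ σ ys' b' (r + 4) R := by
  have hlt := h.lt
  have hlow := h.base.eight_le
  refine ⟨h.base.of_keep hg.keep (fun a ha => ⟨ha.1, ha.2.1⟩) ?_, h14, h15, by omega, hf, ?_,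
    hg.below⟩
  · rintro a (rfl | rfl | rfl | rfl | rfl) <;> omega
  · intro r' hr' i
    rw [hg.keep.cell (by omega) (fun a ha => ha.2.1) (by simp; omega), h.zero r' (by omega)]

theorem mem_map_wordCode {ys : List Word} {y : Word} :
    wordCode y.codes ∈ ys.map (fun y => wordCode y.codes) ↔ y ∈ ys := by
  constructor
  · intro h
    obtain ⟨z, hz, he⟩ := List.mem_map.1 h
    rwa [← Word.codes_injective (wordCode_inj z.codes_lt y.codes_lt he)]
  · exact fun h => List.mem_map.2 ⟨y, h, rfl⟩

/-- The treatment of an accepted word. -/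
theorem store_spec {A : Word → Word → Prop} {TG TD : ℕ} (hS : Setting G D cB dB A x P μ κ TG TD)
    {r b : ℕ} {ys : List Word} {R₀ : ℕ → ℕ} (hinv : Inv x P L r₀ (2 * μ + 3) ys b r R₀)
    (hr : r + 8 < 2 ^ μ) (hb : b + L < 2 ^ μ) {y : Word} (hyP : y.length ≤ P) {s : Mem}
    (h : Decided (2 * μ + 3) r y R₀ s.R s.O) :
    ∃ s', enumVal G D cB dB E (.inl .lookup) s = enumVal G D cB dB E (.inl .main) s' ∧
      s'.time ≤ s.time + 3 * κ ∧
      (y ∈ ys → s'.outputs = s.outputs ∧ Inv x P L r₀ (2 * μ + 3) ys b (r + 4) s'.R) ∧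
      (y ∉ ys → (∃ t ≤ s.time + κ, s'.outputs = s.outputs ++ [(y.codes, t)]) ∧
        Inv x P L r₀ (2 * μ + 3) (ys ++ [y]) (b + L) (r + 4) s'.R) := by
  have hr₀ : 8 ≤ r₀ := by have := hinv.base.eight_le; omega
  have hlt := hinv.lt
  have hp := two_pow_le μ
  have hκ := hS.cost
  have hcode : wordCode y.codes < 2 ^ μ := by
    refine (wordCode_lt y.codes_lt).trans_le (le_trans ?_ hS.code_lt.le)
    rw [y.length_codes]
    exact Nat.mul_le_mul_left _ (Nat.pow_le_pow_right (by norm_num) hyP)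
  have hbad : ad r₀ (wordCode y.codes) < 2 ^ (2 * μ + 3) := ad_lt (by omega) hcode
  have had : ∀ i k, k < 64 → k ≠ ad r₀ i := fun i k hk => (ad_ne hr₀ i hk).symm
  have hZ : ∀ a ∈ ({r, r + 1, r + 2, r + 3} : Set ℕ), r₀ < a := by
    rintro a (rfl | rfl | rfl | rfl) <;> omega
  have hbase := hinv.base.of_keep h.good.keep scratch_lt fun a ha => (hZ a ha).le
  have hreg : ∀ {R' : ℕ → ℕ}, Keep scratch {r, r + 1, r + 2, r + 3} R₀ R' → ∀ a < 17,
      R' a = R₀ a := fun hk a ha =>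
    hk.reg (fun r hr => by have := hZ r hr; omega) (by omega) (by simp [scratch]; omega)
  have hfound : ∀ k, s.R (ad r₀ k) =
      if k ∈ ys.map (fun y => wordCode y.codes) then 1 else 0 := by
    intro k
    rw [h.good.keep.cell hr₀ (fun a ha => ha.2) (fun hh => (hZ _ hh).false), hinv.found]
  obtain ⟨s₁, hv₁, hR₁, hO₁, ho₁, ht₁⟩ := Flow.val_branch (E := E) (n := .inl .lookup) hκ rfl
    (by simp [enumerator, Ctl.ops, fetch, Op.Det]) h.good.below
  change _ = runL 0 (Ctl.ops cB dB .lookup) s.R at hR₁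
  rw [(execL_silent 0 (by simp [enumerator, Ctl.ops, fetch, Op.Silent]) s).1] at hO₁
  rw [(execL_silent 0 (by simp [enumerator, Ctl.ops, fetch, Op.Silent]) s).2] at ho₁
  simp only [Ctl.ops] at hR₁
  rw [runL_fetch 0 hbase.dict h.r19 (by norm_num) hr₀, hfound] at hR₁
  have e23 : s₁.R 23 = if y ∈ ys then 1 else 0 := by
    rw [hR₁, Function.update_self]
    exact if_congr mem_map_wordCode rfl rfl
  have hone : (if wordCode y.codes ∈ ys.map (fun y => wordCode y.codes) then 1 else 0) <
      2 ^ (2 * μ + 3) := by split_ifs <;> omega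
  have hgood₁ : Good scratch {r, r + 1, r + 2, r + 3} (2 * μ + 3) R₀ s₁.R := by
    rw [hR₁]
    exact (h.good.set (by simp [scratch]) hbad).set (by simp [scratch]) hone
  have hfound₁ : ∀ k, s₁.R (ad r₀ k) =
      if k ∈ ys.map (fun y => wordCode y.codes) then 1 else 0 := by
    intro k
    rw [hgood₁.keep.cell hr₀ (fun a ha => ha.2) (fun hh => (hZ _ hh).false), hinv.found]
  have hsub : scratch ⊆ {a | 14 ≤ a ∧ a < 64 ∧ a ≠ 16} := fun a ha =>
    ⟨by have := ha.1; omega, ha.2, by have := ha.1; omega⟩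
  -- the last block
  have next : ∀ s₂ : Mem, Good {a | 14 ≤ a ∧ a < 64 ∧ a ≠ 16} {r₀, r, r + 1, r + 2, r + 3}
      (2 * μ + 3) R₀ s₂.R → s₂.R 15 = r → ∀ b' ys', s₂.R 14 = b' →
      (∀ k, s₂.R (ad r₀ k) = if k ∈ ys'.map (fun y => wordCode y.codes) then 1 else 0) →
      ∃ s', enumVal G D cB dB E (.inl .next) s₂ = enumVal G D cB dB E (.inl .main) s' ∧
        s'.time ≤ s₂.time + κ ∧ s'.outputs = s₂.outputs ∧
        Inv x P L r₀ (2 * μ + 3) ys' b' (r + 4) s'.R := by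
    intro s₂ hg h15 b' ys' h14 hf
    obtain ⟨s', hv, hR, hO, ho, ht⟩ := Flow.val_goto (E := E) (n := .inl .next) hκ rfl
      (by simp [enumerator, Ctl.ops, Op.Det]) hg.below
    change _ = runL 0 (Ctl.ops cB dB .next) s₂.R at hR
    rw [(execL_silent 0 (by simp [enumerator, Ctl.ops, Op.Silent]) s₂).2] at ho
    simp [Ctl.ops, runL, Op.runR, h15] at hR
    refine ⟨s', hv, ht, ho, hinv.of_good ?_ ?_ ?_ ?_⟩
    · rw [hR]
      exact (hg.set (by simp) (by omega)).set (by simp) (by omega)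
    · rw [hR]; simp [h14]
    · rw [hR]; simp
    · intro k; rw [hR]; simp [ad_ne hr₀, hf]
  by_cases hy : y ∈ ys
  · rw [e23, if_pos hy, if_neg one_ne_zero] at hv₁
    obtain ⟨s₂, hv₂, ht₂, ho₂, hI⟩ := next s₁ (hgood₁.mono hsub (Set.subset_insert _ _))
      ((hreg hgood₁.keep 15 (by norm_num)).trans hinv.region) b ys
      ((hreg hgood₁.keep 14 (by norm_num)).trans hinv.budget) hfound₁
    exact ⟨s₂, hv₁.trans hv₂, by omega, fun _ => ⟨ho₂.trans ho₁, hI⟩, fun hn => absurd hy hn⟩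
  · rw [e23, if_neg hy, if_pos rfl] at hv₁
    have hbase₁ := hinv.base.of_keep hgood₁.keep scratch_lt fun a ha => (hZ a ha).le
    obtain ⟨s₂, hv₂, hR₂, hO₂, ho₂, ht₂⟩ := Flow.val_goto (E := E) (n := .inl .fresh) hκ rfl
      (by simp [enumerator, Ctl.ops, place, Op.Det]) hgood₁.below
    change _ = runL 0 (Ctl.ops cB dB .fresh) s₁.R at hR₂
    change _ = (execL 0 (Ctl.ops cB dB .fresh) s₁).outputs at ho₂
    rw [Ctl.ops, execL, (execL_silent 0 (by simp [place, Op.Silent]) _).2] at ho₂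
    have ho₂' : s₂.outputs = s₁.outputs ++ [(outWord s₁.O (s₁.O 0), s₁.time)] := ho₂
    rw [ho₁, hO₁, h.word] at ho₂'
    have e19 : s₁.R 19 = wordCode y.codes := by rw [hR₁]; simp [h.r19]
    have e14 : s₁.R 14 = b := (hreg hgood₁.keep 14 (by norm_num)).trans hinv.budget
    have e15 : s₁.R 15 = r := (hreg hgood₁.keep 15 (by norm_num)).trans hinv.region
    simp [had, Ctl.ops, runL_append, runL, Op.runR, runL_place_eq, hbase₁.dict, e19, hbase₁.one,
      hbase₁.bonus, e14] at hR₂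
    obtain ⟨s₃, hv₃, ht₃, ho₃, hI⟩ := next s₂ (by
        rw [hR₂]
        refine (((hgood₁.mono hsub (Set.subset_insert _ _)).set ?_ hbad).setCell ?_ ?_).set ?_ ?_
        all_goals first | simp | omega)
      (by rw [hR₂]; simp [had, e15]) (b + L) (ys ++ [y]) (by rw [hR₂]; simp) (by
        intro k
        rw [hR₂, Function.update_of_ne (ad_ne hr₀ _ (by norm_num))]
        by_cases hk : k = wordCode y.codes
        · subst hk; simp
        · rw [Function.update_of_ne fun he => hk (ad_inj he).2,
            Function.update_of_ne (ad_ne hr₀ _ (by norm_num)), hfound₁]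
          refine if_congr ?_ rfl rfl
          simp [hk])
    refine ⟨s₃, hv₁.trans (hv₂.trans hv₃), by omega, fun hh => absurd hh hy, fun _ => ⟨⟨s₁.time, ht₁, ?_⟩, hI⟩⟩
    rw [ho₃, ho₂']

/-! ### A complete draw. -/

variable {G D : Machine} {cB dB : ℕ} {E : Mem → Prop} {x : Word} {P L r₀ μ κ : ℕ}
  {A : Word → Word → Prop} {TG TD : ℕ}

/-- From the end of the simulation of the generator to the call of the decision procedure. -/
theorem generated_spec (hS : Setting G D cB dB A x P μ κ TG TD) {r b : ℕ} {ys : List Word}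
    {R₀ R₁ : ℕ → ℕ} (hinv : Inv x P L r₀ (2 * μ + 3) ys b r R₀) (hr : r + 8 < 2 ^ μ)
    (hfeed : Feed x (2 * μ + 3) r x.length R₀ R₁) {c : Cfg G.untilOutput.Λ}
    (hh : G.untilOutput.Halted c) {s : Mem} (hs : Sim r (2 * μ + 3) R₁ c s.R) :
    ∃ s', s'.outputs = s.outputs ∧ s'.time ≤ s.time + (2 * P + 3) * κ ∧
      ((¬ ∃ y : Word, G.AtOutput c.label ∧ c.word = y.codes ∧ y.length ≤ P) ∧
        enumVal G D cB dB E (.inr (.inl c.label)) s = enumVal G D cB dB E (.inl .finish) s' ∨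
      ∃ y : Word, G.AtOutput c.label ∧ c.word = y.codes ∧ y.length ≤ P ∧
        Lett x (2 * μ + 3) r (c.O 0) c.O R₀ s'.R s'.O ∧
        enumVal G D cB dB E (.inr (.inl c.label)) s = enumVal G D cB dB E (.inl .pass) s') := by
  have hr8 : 8 ≤ r := by have := hinv.base.eight_le; have := hinv.lt; omega
  have hhc : G.untilOutput.code c.label = .halt := hh
  have hops : (enumerator G D cB dB).ops (.inr (.inl c.label)) = [] := by
    change simOps (G.untilOutput.code c.label) = []
    rw [hhc]; rfl
  have hxit : (enumerator G D cB dB).exit (.inr (.inl c.label)) = (match G.code c.label with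
      | .output _ => Exit.goto (Sum.inl Ctl.check)
      | .halt => .goto (.inl .finish)
      | i => simExit (fun l => (.inr (.inl l) : Ctl ⊕ G.Λ ⊕ D.Λ)) i) := rfl
  have hk : (2 * P + 3) * κ = (2 * P + 2) * κ + κ := by ring
  by_cases ho : G.AtOutput c.label
  · have hxit' : (enumerator G D cB dB).exit (.inr (.inl c.label)) = .goto (.inl .check) := by
      obtain ⟨n, hn⟩ := ho
      rw [hxit, hn]
    obtain ⟨s₁, hv₁, hR₁, hO₁, ho₁, ht₁⟩ := Flow.val_goto (E := E) hS.cost hxit'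
      (by simp [hops]) hs.below
    rw [hops] at hR₁ ho₁
    have hR₁' : s₁.R = s.R := hR₁
    have hD : Drawn x (2 * μ + 3) r c.O R₀ s₁.R := by
      rw [hR₁']
      refine ⟨(hfeed.good.mono subset_rfl (by intro a; simp; tauto)).trans
        ⟨hs.keep.mono (fun a ha => ⟨by have := ha.1; omega, by have := ha.2; omega⟩)
          (by intro a; simp; tauto), hs.below⟩, hs.outRegion, hs.out, fun i => ?_⟩
      rw [hs.keep.cell (by omega) (fun a ha => by have := ha.2; omega) (by simp),
        hfeed.dec i, ← x.length_codes, List.take_length]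
    obtain ⟨s₂, ho₂, ht₂, h₂⟩ := inspect_spec (E := E) hS.cost hinv.base hinv.lt (by omega)
      hS.len_lt hS.code_lt hD
    refine ⟨s₂, ho₂.trans ho₁, by omega, h₂.imp ?_ ?_⟩
    · rintro ⟨hno, hv₂⟩
      exact ⟨fun ⟨y, _, hy, hyP⟩ => hno ⟨y, hy.symm, hyP⟩, hv₁.trans hv₂⟩
    · rintro ⟨y, hy, hyP, hl, hv₂⟩
      exact ⟨y, ho, hy.symm, hyP, hl, hv₁.trans hv₂⟩
  · have hxit' : (enumerator G D cB dB).exit (.inr (.inl c.label)) = .goto (.inl .finish) := by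
      rw [Machine.untilOutput_code_of_not ho] at hhc
      rw [hxit, hhc]
    obtain ⟨s₁, hv₁, hR₁, hO₁, ho₁, ht₁⟩ := Flow.val_goto (E := E) hS.cost hxit'
      (by simp [hops]) hs.below
    rw [hops] at ho₁
    exact ⟨s₁, ho₁, by omega, .inl ⟨fun ⟨y, h, _⟩ => ho h, hv₁⟩⟩

/-- A bound on the time of a draw. -/
def drawTime (x : Word) (P κ TG TD : ℕ) : ℕ := (x.length + TG + 2 * P + TD + 12) * κ

/-- One draw. -/
theorem draw_spec (hS : Setting G D cB dB A x P μ κ TG TD) {r b : ℕ} {ys : List Word} {s : Mem}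
    (hinv : Inv x P L r₀ (2 * μ + 3) ys (b + 1) r s.R) (hr : r + 8 < 2 ^ μ) (hb : b + L < 2 ^ μ)
    {ψ : Word → ℝ≥0∞} {ψ₀ : ℝ≥0∞} {Φ : Cfg G.untilOutput.Λ → ℝ≥0∞}
    (hΦ : ∀ c y, G.AtOutput c.label → c.word = y.codes → A x y → Φ c ≤ ψ y)
    (hΦ₀ : ∀ c, (¬ ∃ y, G.AtOutput c.label ∧ c.word = y.codes ∧ A x y) → Φ c ≤ ψ₀)
    (hψ : ∀ (y : Word) (s' : Mem), A x y → s'.time ≤ s.time + drawTime x P κ TG TD →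
      (y ∈ ys → s'.outputs = s.outputs ∧ Inv x P L r₀ (2 * μ + 3) ys b (r + 4) s'.R) →
      (y ∉ ys → (∃ t ≤ s.time + drawTime x P κ TG TD, s'.outputs = s.outputs ++ [(y.codes, t)]) ∧
        Inv x P L r₀ (2 * μ + 3) (ys ++ [y]) (b + L) (r + 4) s'.R) →
      ψ y ≤ enumVal G D cB dB E (.inl .main) s')
    (hψ₀ : ∀ s' : Mem, s'.time ≤ s.time + drawTime x P κ TG TD → s'.outputs = s.outputs →
      ψ₀ ≤ enumVal G D cB dB E (.inl .finish) s') :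
    G.untilOutput.value Φ (G.untilOutput.init (inputWord x)) ≤
      enumVal G D cB dB E (.inl .main) s := by
  have hr8 : 8 ≤ r := by have := hinv.base.eight_le; have := hinv.lt; omega
  have hp := two_pow_le μ
  have hκ := hS.cost
  -- the budget is decreased
  obtain ⟨s₁, hv₁, hR₁, hO₁, ho₁, ht₁⟩ := Flow.val_branch (E := E) (n := .inl .main) hκ rfl
    (by simp [enumerator, Ctl.ops]) hinv.below
  have hR₁' : s₁.R = s.R := hR₁
  have ho₁' : s₁.outputs = s.outputs := ho₁
  rw [hR₁', hinv.budget, if_neg (Nat.succ_ne_zero b)] at hv₁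
  obtain ⟨s₂, hv₂, hR₂, hO₂, ho₂, ht₂⟩ := Flow.val_goto (E := E) (n := .inl .draw) hκ rfl
    (by simp [enumerator, Ctl.ops, Op.Det]) (s := s₁) (by rw [hR₁']; exact hinv.below)
  change _ = runL 0 (Ctl.ops cB dB .draw) s₁.R at hR₂
  rw [(execL_silent 0 (by simp [enumerator, Ctl.ops, Op.Silent]) s₁).2] at ho₂
  simp only [Ctl.ops, runL, Op.runR, hR₁', hinv.budget, hinv.base.one, Nat.add_sub_cancel] at hR₂
  have hlt := hinv.lt
  have hr₀ := hinv.base.eight_le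
  have hinv₂ : Inv x P L r₀ (2 * μ + 3) ys b r s₂.R := by
    have hg : Good {14} ∅ (2 * μ + 3) s.R s₂.R := by
      rw [hR₂]; exact (Good.refl hinv.below).set (by simp) (by omega)
    refine ⟨hinv.base.of_keep hg.keep (by rintro a rfl; omega) (by simp), by rw [hR₂]; simp,
      by rw [hR₂]; simp [hinv.region], hlt, fun k => ?_, fun r' hr' i => ?_, hg.below⟩
    · rw [hg.keep.cell (by omega) (by rintro a rfl; omega) (by simp), hinv.found]
    · rw [hg.keep.cell (by omega) (by rintro a rfl; omega) (by simp), hinv.zero r' hr']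
  -- the input is copied
  obtain ⟨s₃, hv₃, hf₃, hO₃, ho₃, ht₃⟩ :=
    seed_spec (E := E) hκ hinv₂ (by omega) hS.len_lt
  obtain ⟨s₄, hv₄, hf₄, hO₄, ho₄, ht₄⟩ := feed_loop (E := E) hκ hinv₂.base hlt (by omega) hS.len_lt
    x.length 0 (by omega) s₃ hf₃
  rw [Nat.sub_zero] at hv₄
  -- the generator is simulated
  have hsim : Sim r (2 * μ + 3) s₄.R (G.untilOutput.init (inputWord x)) s₄.R :=
    { region := hf₄.r17
      outRegion := hf₄.r18
      work := by
        intro i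
        have := hf₄.gen i
        rwa [← x.length_codes, List.take_length, x.length_codes] at this
      out := by
        intro i
        rw [hf₄.good.keep.cell (by omega) (fun a ha => ha.2) (by simp)]
        exact hinv₂.zero _ (by omega) i
      keep := Keep.refl _ _ _
      below := hf₄.good.below }
  have hemb : ∀ l, G.untilOutput.code l ≠ .halt →
      (enumerator G D cB dB).ops (.inr (.inl l)) = simOps (G.untilOutput.code l) ∧
      (enumerator G D cB dB).exit (.inr (.inl l)) =
        simExit (fun l => (.inr (.inl l) : Ctl ⊕ G.Λ ⊕ D.Λ)) (G.untilOutput.code l) := by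
    intro l hl
    refine ⟨rfl, ?_⟩
    have ho : ¬ G.AtOutput l := fun h => hl (Machine.untilOutput_code_of h)
    rw [Machine.untilOutput_code_of_not ho] at hl ⊢
    change (match G.code l with
      | .output _ => Exit.goto (Sum.inl Ctl.check)
      | .halt => .goto (.inl .finish)
      | i => simExit (fun l => (.inr (.inl l) : Ctl ⊕ G.Λ ⊕ D.Λ)) i) = _
    split
    · rename_i n hn; exact absurd ⟨n, hn⟩ ho
    · contradiction
    · rfl
  have hconst : ∀ l, (G.untilOutput.code l).maxConst < 2 ^ μ := by
    intro l
    by_cases ho : G.AtOutput l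
    · rw [Machine.untilOutput_code_of ho]; exact Nat.two_pow_pos μ
    · rw [Machine.untilOutput_code_of_not ho]; exact hS.constG l
  have hreach : ∀ c : Cfg G.untilOutput.Λ,
      Machine.Reach (G.untilOutput.init (inputWord x)) c → c.time ≤ TG ∧ ∀ i, c.R i < 2 ^ μ :=
    fun c hc => hS.reachG c hc.of_untilOutput
  refine le_trans (Flow.value_le_val_of_sim (M := G.untilOutput) (F := enumerator G D cB dB) (E := E)
    (s₀ := s₄) (emb := fun l : G.untilOutput.Λ => (.inr (.inl l) : Ctl ⊕ G.Λ ⊕ D.Λ)) hemb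
    hr8 (by omega) hκ hconst (fun c hc => (hreach c hc).2) hsim ?_)
    (hv₁.trans (hv₂.trans (hv₃.trans hv₄))).ge
  intro c s₅ hc hh hs₅ hO₅ ho₅ ht₅
  have hTG : κ * c.time ≤ TG * κ := by
    rw [mul_comm]; exact Nat.mul_le_mul_right _ (hreach c hc).1
  -- The summands stand for copying the input, the generator, the inspection, the decision, the
  -- dictionary, and the blocks `main`, `draw` and `seed`.
  have hQ : drawTime x P κ TG TD = x.length * κ + TG * κ + (2 * P + 3) * κ + (TD + 3) * κ +
      3 * κ + κ + κ + κ := by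
    unfold drawTime; ring
  obtain ⟨s₆, ho₆, ht₆, h₆⟩ := generated_spec (E := E) hS hinv₂ hr hf₄ hh hs₅
  have hos : s₆.outputs = s.outputs :=
    ho₆.trans (ho₅.trans (ho₄.trans (ho₃.trans (ho₂.trans ho₁'))))
  rcases h₆ with ⟨hno, hv₆⟩ | ⟨y, hao, hy, hyP, hl, hv₆⟩
  · refine ((hΦ₀ c ?_).trans (hψ₀ s₆ (by omega) hos)).trans hv₆.ge
    rintro ⟨y, hao, hy, hA⟩
    exact hno ⟨y, hao, hy, hS.balanced y hA⟩
  · refine le_trans ?_ hv₆.ge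
    refine decide_spec hS hinv₂ hr hy.symm hyP hl fun s₇ hD₇ ho₇ ht₇ => ⟨fun hA => ?_, fun hA => ?_⟩
    · obtain ⟨s₈, hv₈, ht₈, hold, hnew⟩ := store_spec (E := E) hS hinv₂ hr hb hyP hD₇
      refine ((hΦ c y hao hy hA).trans (hψ y s₈ hA (by omega) ?_ ?_)).trans hv₈.ge
      · intro hmem
        obtain ⟨h1, h2⟩ := hold hmem
        exact ⟨h1.trans (ho₇.trans hos), h2⟩
      · intro hmem
        obtain ⟨⟨t, ht, h1⟩, h2⟩ := hnew hmem
        exact ⟨⟨t, by omega, by rw [h1, ho₇, hos]⟩, h2⟩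
    · refine (hΦ₀ c ?_).trans (hψ₀ s₇ (by omega) (ho₇.trans hos))
      rintro ⟨z, -, hz, hAz⟩
      rw [Word.codes_injective (hy.symm.trans hz)] at hA
      exact hA hAz

/-- Truncation only makes the machine halt earlier. This is all that is needed of the generator when
`A(x)` is empty. -/
theorem Machine.ev_one_le_untilOutput {M : Machine} (N : ℕ) (c : Cfg M.Λ) :
    M.ev (fun _ => 1) N c ≤ M.untilOutput.ev (fun _ => 1) N c := by
  by_cases ho : M.AtOutput c.label
  · have hh : M.untilOutput.Halted c := untilOutput_code_of ho
    rw [ev_halted hh]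
    exact ev_const_le _ _ _
  · have hcode := untilOutput_code_of_not ho
    cases N with
    | zero =>
      simp only [ev]
      by_cases hh : M.Halted c
      · have hh' : M.untilOutput.Halted c := hcode.trans hh
        simp [hh, hh']
      · simp [hh]
    | succ N =>
      simp only [ev, hcode]
      refine avg_mono fun v _ => ?_
      have hs : M.untilOutput.stepWith v c = M.stepWith v c := by
        simp only [stepWith, hcode]; rfl
      rw [hs]
      exact ev_one_le_untilOutput N _

/-! ### The main loop and its probability of success. -/

variable {G D : Machine} {cB dB : ℕ} {E : Mem → Prop} {x : Word} {P L r₀ μ κ : ℕ}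
  {A : Word → Word → Prop} {TG TD : ℕ}

theorem enumVal_finish {s : Mem} (hE : E s) : enumVal G D cB dB E (.inl .finish) s = 1 := by
  refine (Flow.val_eq_of_det (F := enumerator G D cB dB) (.inl .finish)
    (by simp [enumerator, Ctl.ops]) 0 s).trans ?_
  change Machine.ind E s = 1
  simp [Machine.ind, hE]

/-- The run that ends in `s` has enumerated `A(x)` without repetition, after a precomputation in
time `T` and with incremental time `V * m`. -/
structure Enumerated (A : Word → Word → Prop) (x : Word) (T V : ℕ) (s : Mem) : Prop where
  words : ∃ ys : List Word, ys.Nodup ∧ (∀ y, y ∈ ys ↔ A x y) ∧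
    s.outputs.map Prod.fst = ys.map Word.codes
  outputTime : ∀ (i : ℕ) (h : i < s.outputs.length), s.outputs[i].2 ≤ T + V * (i + 1)
  time : s.time ≤ T + V * s.outputs.length

/-- The outputs between two draws, when the words in `ys` have been found, the budget is `b`, and
`t` draws have been made, of duration `Q` each, after time `T`. -/
structure Progress (L T Q : ℕ) (ys : List Word) (b t : ℕ) (s : Mem) : Prop where
  nodup : ys.Nodup
  words : s.outputs.map Prod.fst = ys.map Word.codes
  draws : b + t = L * (ys.length + 1)
  time : s.time ≤ T + Q * t
  outputTime : ∀ (i : ℕ) (h : i < s.outputs.length), s.outputs[i].2 ≤ T + Q * L * (i + 1)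

theorem Progress.length {T Q b t : ℕ} {ys : List Word} {s : Mem} (h : Progress L T Q ys b t s) :
    s.outputs.length = ys.length := by
  simpa using congrArg List.length h.words

theorem Progress.old {T Q b t : ℕ} {ys : List Word} {s s' : Mem}
    (h : Progress L T Q ys (b + 1) t s) (ho : s'.outputs = s.outputs)
    (ht : s'.time ≤ s.time + Q) : Progress L T Q ys b (t + 1) s' where
  nodup := h.nodup
  words := by rw [ho, h.words]
  draws := by have := h.draws; omega
  time := by have := h.time; rw [mul_add, mul_one]; omega
  outputTime := by rw [ho]; exact h.outputTime

theorem Progress.new {T Q b t t' : ℕ} {ys : List Word} {s s' : Mem} {y : Word}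
    (h : Progress L T Q ys (b + 1) t s) (hy : y ∉ ys)
    (ho : s'.outputs = s.outputs ++ [(y.codes, t')]) (ht' : t' ≤ s.time + Q)
    (ht : s'.time ≤ s.time + Q) : Progress L T Q (ys ++ [y]) (b + L) (t + 1) s' where
  nodup := by
    rw [List.nodup_append]
    exact ⟨h.nodup, List.nodup_singleton y, by rintro a ha b hb rfl; simp at hb; exact hy (hb ▸ ha)⟩
  words := by rw [ho, List.map_append, List.map_append, h.words]; rfl
  draws := by
    have := h.draws
    rw [List.length_append, List.length_singleton, mul_add, mul_one]; omega
  time := by have := h.time; rw [mul_add, mul_one]; omega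
  outputTime := by
    rw [ho]
    intro i hi
    by_cases hlt : i < s.outputs.length
    · rw [List.getElem_append_left hlt]; exact h.outputTime i hlt
    · have hi' : i = s.outputs.length := by simp at hi; omega
      subst hi'
      simp only [List.getElem_concat_length]
      have h1 := h.time
      -- Spent and remaining budget add up to `L * (ys.length + 1)`, so the current draw is among
      -- the first `L * m` when it yields the `m`-th output.
      have h2 : Q * (t + 1) ≤ Q * (L * (ys.length + 1)) :=
        Nat.mul_le_mul_left _ (by have := h.draws; omega)
      rw [h.length, mul_assoc]
      rw [mul_add, mul_one] at h2
      omega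

/-- Success probability plus `failBound` is at least 1: at budget zero one of them already is, and a
draw preserves the inequality by `draw_spec` and `sum_failBound_le`. The induction parameter is the
largest number of draws still possible, which drops by exactly one per draw. -/
theorem main_spec (hS : Setting G D cB dB A x P μ κ TG TD) {S : Finset Word}
    (hA : ∀ y, y ∈ S ↔ A x y)
    (hgen : ∀ y ∈ S, (S.card : ℝ≥0∞)⁻¹ ≤ G.untilOutput.value
      (Machine.ind fun c => G.AtOutput c.label ∧ c.word = y.codes)
      (G.untilOutput.init (inputWord x)))
    {T : ℕ} (hr : r₀ + 9 + 4 * (L * (S.card + 1)) < 2 ^ μ)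
    (hb : L * (S.card + 2) < 2 ^ μ)
    (hE : ∀ s, Enumerated A x (T + drawTime x P κ TG TD * L + κ) (drawTime x P κ TG TD * L) s → E s)
    (hne : S.Nonempty) :
    ∀ (w : ℕ) (ys : List Word) (b t : ℕ) (s : Mem), w = b + L * (S.card - ys.length) →
      Progress L T (drawTime x P κ TG TD) ys b t s →
      Inv x P L r₀ (2 * μ + 3) ys b (r₀ + 1 + 4 * t) s.R → (∀ y ∈ ys, y ∈ S) →
      1 ≤ enumVal G D cB dB E (.inl .main) s + failBound S L b ys.toFinset := by
  set Q := drawTime x P κ TG TD with hQ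
  intro w
  induction w using Nat.strong_induction_on with
  | _ w ih =>
  intro ys b t s hw hp hinv hys
  have hF : ys.toFinset ⊆ S := fun y hy => hys y (List.mem_toFinset.1 hy)
  have hcard : ys.toFinset.card = ys.length := List.toFinset_card_of_nodup hp.nodup
  have hle : ys.length ≤ S.card := hcard ▸ Finset.card_le_card hF
  rcases b with _ | b
  · by_cases hall : ys.toFinset = S
    · obtain ⟨s₁, hv₁, hR₁, hO₁, ho₁, ht₁⟩ := Flow.val_branch (E := E) (n := .inl .main) hS.cost rfl
        (by simp [enumerator, Ctl.ops]) hinv.below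
      have hR₁' : s₁.R = s.R := hR₁
      have ho₁' : s₁.outputs = s.outputs := ho₁
      rw [hR₁', hinv.budget, if_pos rfl] at hv₁
      refine le_trans ?_ le_self_add
      refine le_trans ?_ hv₁.ge
      refine (enumVal_finish (hE _ ⟨⟨ys, hp.nodup, fun y => ?_, ?_⟩, ?_, ?_⟩)).ge
      · rw [← hA, ← hall, List.mem_toFinset]
      · rw [ho₁', hp.words]
      · rw [ho₁']
        intro i hi
        have := hp.outputTime i hi
        omega
      · rw [ho₁', hp.length]
        have h1 := hp.time
        have h2 := hp.draws
        rw [zero_add] at h2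
        -- All `L * (|A(x)| + 1)` draws have been made; the surplus `L` is covered by the
        -- precomputation term in `hE`.
        rw [h2, mul_add, mul_one, mul_add, ← mul_assoc] at h1
        omega
    · exact (one_le_failBound_zero L hF hall).trans le_add_self
  · have hL : L * (ys.length + 1) ≤ L * (S.card + 1) := Nat.mul_le_mul_left _ (by omega)
    have hL2 : L * (S.card + 2) = L * (S.card + 1) + L := by ring
    have hdr := hp.draws
    set f : Word → ℝ≥0∞ := fun y => if y ∈ ys.toFinset then failBound S L b ys.toFinset
      else failBound S L (b + L) (insert y ys.toFinset) with hf
    -- By induction `1 - f y` is a lower bound for success after drawing `y`. Draws outside `A(x)`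
    -- get the trivial bound 0, which loses nothing because the elements of `S` exhaust the
    -- probability.
    have key := draw_spec (E := E) (D := D) (cB := cB) (dB := dB) hS hinv (by omega) (by omega)
      (ψ := fun y => 1 - f y) (ψ₀ := 0)
      (Φ := fun c => ∑ y ∈ S, Machine.ind (fun c : Cfg G.untilOutput.Λ =>
        G.AtOutput c.label ∧ c.word = y.codes) c * (1 - f y)) ?_ ?_ ?_ ?_
    · rw [Machine.value_sum] at key
      have h1 : ∑ y ∈ S, (S.card : ℝ≥0∞)⁻¹ * (1 - f y) ≤ enumVal G D cB dB E (.inl .main) s :=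
        (Finset.sum_le_sum fun y hy => mul_le_mul_left (hgen y hy) _).trans key
      refine le_trans ?_ (add_le_add h1 (sum_failBound_le L b))
      rw [← Finset.sum_add_distrib]
      have h2 : ∑ _y ∈ S, (S.card : ℝ≥0∞)⁻¹ = 1 := by
        rw [Finset.sum_const, nsmul_eq_mul]
        exact ENNReal.mul_inv_cancel (by simp [hne.ne_empty]) (by simp)
      refine h2.ge.trans (Finset.sum_le_sum fun y _ => ?_)
      rw [← mul_add]
      exact le_mul_of_one_le_right' le_tsub_add
    · intro c y hao hy hAy
      refine (Finset.sum_le_sum (g := fun z => if z = y then 1 - f z else 0) fun z _ => ?_).trans ?_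
      · by_cases hz : z = y
        · rw [if_pos hz]
          unfold Machine.ind
          split_ifs <;> simp
        · rw [if_neg hz]
          unfold Machine.ind
          rw [if_neg, zero_mul]
          rintro ⟨-, h⟩
          exact hz (Word.codes_injective (h.symm.trans hy))
      · rw [Finset.sum_ite_eq' S y]
        split_ifs <;> simp
    · intro c hc
      refine (Finset.sum_eq_zero fun y hy => ?_).le
      unfold Machine.ind
      rw [if_neg, zero_mul]
      rintro ⟨h1, h2⟩
      exact hc ⟨y, h1, h2, (hA y).1 hy⟩
    · intro y s' hAy ht hold hnew
      rw [tsub_le_iff_right]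
      by_cases hy : y ∈ ys
      · obtain ⟨ho, hi⟩ := hold hy
        simp only [hf, List.mem_toFinset, hy, if_true]
        exact ih _ (by omega) ys b (t + 1) s' rfl (hp.old ho ht) (by
          rwa [show r₀ + 1 + 4 * (t + 1) = r₀ + 1 + 4 * t + 4 by ring]) hys
      · obtain ⟨⟨t', ht', ho⟩, hi⟩ := hnew hy
        simp only [hf, List.mem_toFinset, hy, if_false]
        have hlen : ys.length < S.card := by
          rw [← hcard]
          exact Finset.card_lt_card ⟨hF, fun h => hy (List.mem_toFinset.1 (h ((hA y).2 hAy)))⟩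
        have hins : (ys ++ [y]).toFinset = insert y ys.toFinset := by ext; simp
        rw [← hins]
        refine ih (b + L + L * (S.card - (ys ++ [y]).length)) ?_ (ys ++ [y]) (b + L) (t + 1) s' rfl
          (hp.new hy ho ht' ht) (by
          rwa [show r₀ + 1 + 4 * (t + 1) = r₀ + 1 + 4 * t + 4 by ring]) ?_
        · rw [List.length_append, List.length_singleton, hw,
            show S.card - ys.length = S.card - (ys.length + 1) + 1 by omega, mul_add, mul_one]
          omega
        · intro z hz
          rcases List.mem_append.1 hz with hz | hz
          · exact hys z hz
          · rw [List.mem_singleton.1 hz]; exact (hA y).2 hAy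
    · exact fun _ _ _ => zero_le

/-- Whatever the generator does, it halts almost surely, and its result is then rejected, so the run
ends after one draw without output. The budget is positive, so this draw does take place. -/
theorem main_spec_of_empty (hS : Setting G D cB dB A x P μ κ TG TD) (hA : ∀ y, ¬ A x y)
    (hgen : G.value (fun _ => 1) (G.init (inputWord x)) = 1)
    {T b : ℕ} (hr : r₀ + 9 < 2 ^ μ) (hb : b + L < 2 ^ μ)
    (hE : ∀ s, Enumerated A x (T + drawTime x P κ TG TD * L + κ) (drawTime x P κ TG TD * L) s → E s)
    {s : Mem} (hL : 1 ≤ L) (ht : s.time ≤ T) (ho : s.outputs = [])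
    (hinv : Inv x P L r₀ (2 * μ + 3) [] (b + 1) (r₀ + 1) s.R) :
    1 ≤ enumVal G D cB dB E (.inl .main) s := by
  refine le_trans ?_ (draw_spec (E := E) hS hinv (by omega) hb (ψ := fun _ => 1) (ψ₀ := 1)
    (Φ := fun _ => 1) (fun _ _ _ _ _ => le_rfl) (fun _ _ => le_rfl)
    (fun y _ hy => absurd hy (hA y)) fun s' ht' ho' => ?_)
  · exact hgen.ge.trans (iSup_mono fun N => Machine.ev_one_le_untilOutput N _)
  · refine (enumVal_finish (hE _ ⟨⟨[], List.nodup_nil, fun y => ?_, ?_⟩, ?_, ?_⟩)).ge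
    · simp [hA y]
    · simp [ho', ho]
    · simp [ho', ho]
    · have : drawTime x P κ TG TD * 1 ≤ drawTime x P κ TG TD * L := Nat.mul_le_mul_left _ hL
      simp [ho', ho]
      omega

/-! ### The precomputation. -/

variable {G D : Machine} {cB dB : ℕ} {E : Mem → Prop} {x : Word} {P L r₀ μ κ σ τ num den : ℕ}

theorem runL_double (v : ℕ) (R : ℕ → ℕ) :
    runL v [.add 0 0 0, .add 0 0 0, .add 0 0 0, .add 0 0 0, .add 0 0 0, .add 0 0 0] R =
      Function.update R 0 (64 * R 0) := by
  simp only [runL, Op.runR, Function.update_self, Function.update_idem]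
  congr 1
  ring

theorem runL_power (v : ℕ) (n : ℕ) (R : ℕ → ℕ) :
    runL v (List.replicate n (.mul 13 13 8)) R = Function.update R 13 (R 13 * R 8 ^ n) := by
  induction n generalizing R with
  | zero => simp [runL]
  | succ n ih =>
    rw [List.replicate_succ]
    simp only [runL, Op.runR]
    rw [ih]
    simp [pow_succ', mul_assoc]

/-- The memory after the `j`-th round of the loop that moves the input. -/
structure Moved (x : Word) (num den τ j : ℕ) (R : ℕ → ℕ) : Prop where
  r0 : R 0 = 64 * (x.length - j)
  r1 : R 1 = num
  r2 : R 2 = den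
  r3 : R 3 = 10 + j
  r4 : R 4 = 64 * x.length + 74 + j
  r5 : R 5 = 64
  r6 : R 6 = 1
  r7 : R 7 = j
  moved : ∀ i < x.length, i < 7 + j → R (64 * x.length + 67 + i) = x.codes.getD i 0
  rest : ∀ i < x.length, 7 + j ≤ i → R (3 + i) = x.codes.getD i 0
  zero : ∀ a, 65 * x.length + 74 ≤ a → R a = 0
  below : ∀ a, a ≠ 1 → a ≠ 2 → R a < 2 ^ τ

/-- The effect of the first block after the computation of `v`. -/
theorem runL_start {v : ℕ} {R : ℕ → ℕ} (h0 : R 0 = v) (hv : 64 ≤ v ∨ v = 0 ∧ R 3 = 0) :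
    runL 0 [.store 0 3,
        .const 3 68, .add 3 3 0, .store 3 4, .const 3 69, .add 3 3 0, .store 3 5,
        .const 3 70, .add 3 3 0, .store 3 6, .const 3 71, .add 3 3 0, .store 3 7,
        .const 3 72, .add 3 3 0, .store 3 8, .const 3 73, .add 3 3 0, .store 3 9,
        .load 4 0, .const 3 67, .add 3 3 0, .store 3 4,
        .const 5 64, .const 6 1, .const 7 0, .const 3 10, .const 4 74, .add 4 4 0] R = fun a =>
      if a = 0 then v else if a = 3 then 10 else if a = 4 then 74 + v else if a = 5 then 64 else
      if a = 6 then 1 else if a = 7 then 0 else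
      if 67 + v ≤ a ∧ a < 74 + v then R (a - v - 64) else if a = v then R 3 else R a := by
  have e1 : ∀ k l, l < 64 → 64 ≤ k → (l = k + v) = False := fun k l hl hk => by simp; omega
  have e2 : (0 = v) = (v = 0) := by simp [eq_comm]
  have e3 : ∀ k, 0 < k → k < 64 → (k = v) = False := fun k h h' => by simp; omega
  have e4 : (v = 3) = False := by simp; omega
  -- For `v = 0` the first store hits register 0 itself; it does no harm because register 3 is then
  -- 0.
  have h3 : (if v = 0 then R 3 else v) = v := by split_ifs <;> omega
  funext a
  simp [runL, Op.runR, Function.update_apply, h0, e1, e2, e3, e4, h3]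
  by_cases hw : 67 + v ≤ a ∧ a < 74 + v
  · obtain ⟨k, rfl⟩ : ∃ k, a = k + v := ⟨a - v, by omega⟩
    have hk : 67 ≤ k ∧ k < 74 := by omega
    have e5 : ∀ l, l < 64 → (k + v = l) = False := fun l hl => by simp; omega
    simp only [e5, hw, if_true, if_false, Nat.reduceLT, Nat.add_right_cancel_iff, and_self,
      Nat.add_sub_cancel]
    obtain ⟨hk1, hk2⟩ := hk
    clear hw e5
    interval_cases k <;> simp
  · have e5 : ∀ k, 67 ≤ k → k < 74 → (a = k + v) = False := fun k h h' => by simp; omega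
    simp only [hw, e5, if_false, Nat.reduceLT, Nat.reduceLeDiff]
    by_cases h : a < 64
    · clear hw e5
      interval_cases a <;> simp [h0, e2, e3] <;> omega
    · have e6 : ∀ k, k < 64 → (a = k) = False := fun k hk => by simp; omega
      simp only [e6, if_false, Nat.reduceLT]

theorem start_spec (hκ : (enumerator G D cB dB).CostBound σ κ) {s : Mem}
    (hs : ∀ i, s.R i = (x.length :: num :: den :: x.codes).getD i 0) (hτσ : τ ≤ σ)
    (hτ : 65 * x.length + 74 < 2 ^ τ) (hnum : num < 2 ^ σ) (hden : den < 2 ^ σ) :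
    ∃ s', enumVal G D cB dB E (.inl .start) s =
        (if x.length = 0 then enumVal G D cB dB E (.inl .scan) s'
          else enumVal G D cB dB E (.inl .copy) s') ∧
      Moved x num den τ 0 s'.R ∧ s'.outputs = s.outputs ∧ s'.time ≤ s.time + κ := by
  have hp : 2 ^ τ ≤ 2 ^ σ := Nat.pow_le_pow_right two_pos hτσ
  have hlet := x.codes_getD_lt
  have hs3 : ∀ i, s.R (3 + i) = x.codes.getD i 0 := fun i => by rw [hs, add_comm]; simp
  have h0 : s.R 0 = x.length := by rw [hs]; rfl
  have h1 : s.R 1 = num := by rw [hs]; rfl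
  have h2 : s.R 2 = den := by rw [hs]; rfl
  have hlet' : ∀ a, 3 ≤ a → s.R a < 3 := fun a ha => by
    have := hs3 (a - 3)
    rw [Nat.add_sub_cancel' ha] at this
    rw [this]; exact hlet _
  have hB : Below σ s.R := by
    intro a
    have h3 := hlet' a
    rcases a with _ | _ | _ | a
    · omega
    · rw [zero_add, h1]; omega
    · rw [zero_add, h2]; omega
    · have := h3 (by omega); omega
  obtain ⟨s', hv, hR, hO, ho, ht⟩ := Flow.val_branch (E := E) (n := .inl .start) hκ rfl
    (by simp [enumerator, Ctl.ops, Op.Det]) hB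
  rw [(execL_silent 0 (by simp [enumerator, Ctl.ops, Op.Silent]) s).2] at ho
  have hpos : x.length = 0 → s.R 3 = 0 := fun h => by
    have := hs3 0
    rwa [List.getD_eq_default _ _ (by rw [x.length_codes]; omega)] at this
  have hR' : s'.R = fun a =>
      if a = 0 then 64 * x.length else if a = 3 then 10 else if a = 4 then 74 + 64 * x.length else
      if a = 5 then 64 else if a = 6 then 1 else if a = 7 then 0 else
      if 67 + 64 * x.length ≤ a ∧ a < 74 + 64 * x.length then s.R (a - 64 * x.length - 64) else
      if a = 64 * x.length then s.R 3 else s.R a := by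
    rw [hR]
    refine (runL_append 0 [.add 0 0 0, .add 0 0 0, .add 0 0 0, .add 0 0 0, .add 0 0 0, .add 0 0 0]
      _ s.R).trans ?_
    rw [runL_double, h0, runL_start (v := 64 * x.length) (by simp) (by
      rw [Function.update_of_ne (by norm_num)]; omega)]
    funext a
    by_cases ha : a = 0
    · simp [ha]
    · rw [Function.update_of_ne ha, Function.update_of_ne (by norm_num : (3 : ℕ) ≠ 0)]
      split_ifs <;> first | rfl | (rw [Function.update_of_ne]; omega)
  rw [hR'] at hv
  refine ⟨s', by simpa using hv, ?_, ho, ht⟩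
  rw [hR']
  constructor
  · simp
  · simp [h1]; split_ifs <;> omega
  · simp [h2]; split_ifs <;> omega
  · simp
  · simp; omega
  · simp
  · simp
  · simp
  · intro i hi hi7
    rw [← hs3]
    simp only [show 67 + 64 * x.length ≤ 64 * x.length + 67 + i ∧
      64 * x.length + 67 + i < 74 + 64 * x.length by omega, and_self, if_true]
    rw [if_neg (by omega), if_neg (by omega), if_neg (by omega), if_neg (by omega),
      if_neg (by omega), if_neg (by omega)]
    congr 1
    omega
  · intro i hi hi7
    rw [← hs3]
    rw [if_neg (by omega), if_neg (by omega), if_neg (by omega), if_neg (by omega),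
      if_neg (by omega), if_neg (by omega), if_neg (by omega), if_neg (by omega)]
  · intro a ha
    have : s.R a = 0 := by
      have := hs3 (a - 3)
      rwa [Nat.add_sub_cancel' (by omega), List.getD_eq_default _ _ (by rw [x.length_codes]; omega)]
        at this
    rw [if_neg (by omega), if_neg (by omega), if_neg (by omega), if_neg (by omega),
      if_neg (by omega), if_neg (by omega), if_neg (by omega), if_neg (by omega), this]
  · intro a ha1 ha2
    have ha3 := hlet' a
    have h3 := hlet' 3 le_rfl
    have h4 := hlet' (a - 64 * x.length - 64)
    split_ifs <;> omega

theorem Moved.below' {j : ℕ} {R : ℕ → ℕ} (h : Moved x num den τ j R) (hτσ : τ ≤ σ)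
    (hnum : num < 2 ^ σ) (hden : den < 2 ^ σ) : Below σ R := by
  intro a
  by_cases h1 : a = 1
  · rw [h1, h.r1]; exact hnum
  by_cases h2 : a = 2
  · rw [h2, h.r2]; exact hden
  exact (h.below a h1 h2).trans_le (Nat.pow_le_pow_right two_pos hτσ)

/-- The counter in register 0 is kept multiplied by 64. Letters from the eighth on move from `10 +
j` to `64 * |x| + 74 + j`; source and target do not overlap, and the rounds past the last letter
copy zeros. -/
theorem copy_spec (hκ : (enumerator G D cB dB).CostBound σ κ) {s : Mem} {j : ℕ}
    (h : Moved x num den τ j s.R) (hj : j < x.length) (hτσ : τ ≤ σ)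
    (hτ : 65 * x.length + 84 < 2 ^ τ) (hnum : num < 2 ^ σ) (hden : den < 2 ^ σ) :
    ∃ s', enumVal G D cB dB E (.inl .copy) s =
        (if x.length - (j + 1) = 0 then enumVal G D cB dB E (.inl .scan) s'
          else enumVal G D cB dB E (.inl .copy) s') ∧
      Moved x num den τ (j + 1) s'.R ∧ s'.outputs = s.outputs ∧ s'.time ≤ s.time + κ := by
  obtain ⟨s', hv, hR, hO, ho, ht⟩ := Flow.val_branch (E := E) (n := .inl .copy) hκ rfl
    (by simp [enumerator, Ctl.ops, Op.Det]) (h.below' hτσ hnum hden)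
  rw [(execL_silent 0 (by simp [enumerator, Ctl.ops, Op.Silent]) s).2] at ho
  change _ = runL 0 (Ctl.ops cB dB .copy) s.R at hR
  have hne : ∀ k, k < 64 → (64 * x.length + 74 + j = k) = False := fun k hk => by simp; omega
  have hne' : ∀ k, k < 64 → (k = 64 * x.length + 74 + j) = False := fun k hk => by simp; omega
  have hR' : s'.R = fun a =>
      if a = 0 then 64 * (x.length - (j + 1)) else if a = 3 then 10 + j + 1 else
      if a = 4 then 64 * x.length + 74 + j + 1 else if a = 7 then j + 1 else
      if a = 64 * x.length + 74 + j then s.R (10 + j) else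
      if a = 8 then s.R (10 + j) else s.R a := by
    rw [hR]
    simp [Ctl.ops, runL, Op.runR, h.r0, h.r3, h.r4, h.r5, h.r6, h.r7, hne']
    funext a
    simp only [Function.update_apply]
    split_ifs <;> omega
  have hsmall := fun a h1 h2 => h.below a h1 h2
  rw [hR'] at hv
  refine ⟨s', ?_, ?_, ho, ht⟩
  · refine hv.trans ?_
    simp only [if_true, mul_eq_zero, OfNat.ofNat_ne_zero, false_or]
  rw [hR']
  constructor
  · simp
  · simp [hne', h.r1]
  · simp [hne', h.r2]
  · simp [add_assoc]
  · simp [add_assoc]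
  · simp [hne', h.r5]
  · simp [hne', h.r6]
  · simp
  · intro i hi hi7
    rw [if_neg (by omega), if_neg (by omega), if_neg (by omega), if_neg (by omega)]
    by_cases hij : i = 7 + j
    · rw [if_pos (by omega), hij, ← h.rest _ (by omega) le_rfl]
      congr 1; omega
    · rw [if_neg (by omega), if_neg (by omega), h.moved i hi (by omega)]
  · intro i hi hi7
    rw [if_neg (by omega), if_neg (by omega), if_neg (by omega), if_neg (by omega),
      if_neg (by omega), if_neg (by omega), h.rest i hi (by omega)]
  · intro a ha
    rw [if_neg (by omega), if_neg (by omega), if_neg (by omega), if_neg (by omega),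
      if_neg (by omega), if_neg (by omega), h.zero a ha]
  · intro a ha1 ha2
    have h1 := h.below a ha1 ha2
    have h2 := h.below (10 + j) (by omega) (by omega)
    split_ifs <;> omega

theorem copy_loop (hκ : (enumerator G D cB dB).CostBound σ κ) (hτσ : τ ≤ σ)
    (hτ : 65 * x.length + 84 < 2 ^ τ) (hnum : num < 2 ^ σ) (hden : den < 2 ^ σ) (k : ℕ) :
    ∀ j, j + k = x.length → ∀ s : Mem, Moved x num den τ j s.R →
    ∃ s', (if x.length - j = 0 then enumVal G D cB dB E (.inl .scan) s
          else enumVal G D cB dB E (.inl .copy) s) = enumVal G D cB dB E (.inl .scan) s' ∧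
      Moved x num den τ x.length s'.R ∧ s'.outputs = s.outputs ∧ s'.time ≤ s.time + k * κ := by
  induction k with
  | zero =>
    intro j hj s h
    rw [add_zero] at hj
    subst hj
    exact ⟨s, by simp, h, rfl, by omega⟩
  | succ k ih =>
    intro j hj s h
    obtain ⟨s₁, hv, h₁, ho, ht⟩ := copy_spec (E := E) hκ h (by omega) hτσ hτ hnum hden
    obtain ⟨s₂, hv', h₂, ho', ht'⟩ := ih (j + 1) (by omega) s₁ h₁
    refine ⟨s₂, ?_, h₂, ho'.trans ho, by rw [add_mul]; omega⟩
    rw [if_neg (by omega), hv, hv']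

/-- The memory after the `k`-th round of the loop that computes the logarithm. -/
structure Logged (x : Word) (num den τ k : ℕ) (R : ℕ → ℕ) : Prop where
  r1 : R 1 = num * 2 ^ k
  r2 : R 2 = den - num * (2 ^ k - 1)
  r6 : R 6 = 1
  r7 : R 7 = x.length
  r10 : R 10 = 64 * x.length + 67
  r12 : R 12 = 65 * x.length + 74
  r16 : R 16 = k
  letters : ∀ i < x.length, R (64 * x.length + 67 + i) = x.codes.getD i 0
  zero : ∀ a, 65 * x.length + 74 ≤ a → R a = 0
  below : ∀ a, a ≠ 1 → a ≠ 2 → R a < 2 ^ τ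

theorem scan_spec (hκ : (enumerator G D cB dB).CostBound σ κ) {s : Mem}
    (h : Moved x num den τ x.length s.R) (hτσ : τ ≤ σ)
    (hτ : 65 * x.length + 84 < 2 ^ τ) (hnum : num < 2 ^ σ) (hden : den < 2 ^ σ) :
    ∃ s', enumVal G D cB dB E (.inl .scan) s = enumVal G D cB dB E (.inl .log) s' ∧
      Logged x num den τ 0 s'.R ∧ s'.outputs = s.outputs ∧ s'.time ≤ s.time + κ := by
  obtain ⟨s', hv, hR, hO, ho, ht⟩ := Flow.val_goto (E := E) (n := .inl .scan) hκ rfl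
    (by simp [enumerator, Ctl.ops, Op.Det]) (h.below' hτσ hnum hden)
  rw [(execL_silent 0 (by simp [enumerator, Ctl.ops, Op.Silent]) s).2] at ho
  change _ = runL 0 (Ctl.ops cB dB .scan) s.R at hR
  simp [Ctl.ops, runL, Op.runR, h.r3, h.r4] at hR
  refine ⟨s', hv, ?_, ho, ht⟩
  rw [hR]
  have hbig : ∀ a, 64 ≤ a → ∀ k, k < 64 → a ≠ k := by omega
  constructor
  · simp [h.r1]
  · simp [h.r2]
  · simp [h.r6]
  · simp [h.r7]
  · simp; omega
  · simp; omega
  · simp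
  · intro i hi
    rw [← h.moved i hi (by omega)]
    simp only [Function.update_apply]
    split_ifs <;> omega
  · intro a ha
    rw [← h.zero a ha]
    simp only [Function.update_apply]
    split_ifs <;> omega
  · intro a h1 h2
    have := h.below a h1 h2
    simp only [Function.update_apply]
    split_ifs <;> omega

theorem Logged.below' {k : ℕ} {R : ℕ → ℕ} (h : Logged x num den τ k R) (hτσ : τ ≤ σ)
    (hnum : num * 2 ^ k < 2 ^ σ) (hden : den < 2 ^ σ) : Below σ R := by
  intro a
  by_cases h1 : a = 1
  · rw [h1, h.r1]; exact hnum
  by_cases h2 : a = 2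
  · rw [h2, h.r2]; omega
  exact (h.below a h1 h2).trans_le (Nat.pow_le_pow_right two_pos hτσ)

theorem log_spec (hκ : (enumerator G D cB dB).CostBound σ κ) {s : Mem} {k : ℕ}
    (h : Logged x num den τ k s.R) (hτσ : τ ≤ σ)
    (hτ : k + 1 < 2 ^ τ) (hnum : num * 2 ^ k < 2 ^ σ) (hden : den < 2 ^ σ) :
    ∃ s', enumVal G D cB dB E (.inl .log) s =
        (if den - num * (2 ^ (k + 1) - 1) = 0 then enumVal G D cB dB E (.inl .setup) s'
          else enumVal G D cB dB E (.inl .log) s') ∧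
      Logged x num den τ (k + 1) s'.R ∧ s'.outputs = s.outputs ∧ s'.time ≤ s.time + κ := by
  obtain ⟨s', hv, hR, hO, ho, ht⟩ := Flow.val_branch (E := E) (n := .inl .log) hκ rfl
    (by simp [enumerator, Ctl.ops, Op.Det]) (h.below' hτσ hnum hden)
  rw [(execL_silent 0 (by simp [enumerator, Ctl.ops, Op.Silent]) s).2] at ho
  change _ = runL 0 (Ctl.ops cB dB .log) s.R at hR
  simp [Ctl.ops, runL, Op.runR, h.r1, h.r2, h.r6, h.r16] at hR
  have e2 : s'.R 2 = den - num * (2 ^ (k + 1) - 1) := by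
    have h1 : 2 ^ (k + 1) - 1 = (2 ^ k - 1) + 2 ^ k := by
      have := Nat.one_le_two_pow (n := k); rw [pow_succ]; omega
    rw [hR, h1, mul_add]
    simp
    omega
  rw [e2] at hv
  refine ⟨s', hv, ?_, ho, ht⟩
  constructor
  · rw [hR]; simp [pow_succ]; ring
  · exact e2
  · rw [hR]; simp [h.r6]
  · rw [hR]; simp [h.r7]
  · rw [hR]; simp [h.r10]
  · rw [hR]; simp [h.r12]
  · rw [hR]; simp
  · intro i hi
    rw [← h.letters i hi, hR]
    simp only [Function.update_apply]
    split_ifs <;> omega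
  · intro a ha
    rw [← h.zero a ha, hR]
    simp only [Function.update_apply]
    split_ifs <;> omega
  · intro a h1 h2
    have := h.below a h1 h2
    rw [hR]
    simp only [Function.update_apply]
    split_ifs <;> omega

/-- The minimality of `K` says that the loop does not stop earlier. -/
theorem log_loop (hκ : (enumerator G D cB dB).CostBound σ κ) {K : ℕ} (hτσ : τ ≤ σ)
    (hτ : K < 2 ^ τ) (hnum : num * 2 ^ K < 2 ^ σ) (hden : den < 2 ^ σ)
    (hK : den ≤ num * (2 ^ K - 1)) (hlt : ∀ k < K, num * (2 ^ k - 1) < den) (m : ℕ) :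
    ∀ k, k + m = K → ∀ s : Mem, Logged x num den τ k s.R →
    ∃ s', (if den - num * (2 ^ k - 1) = 0 then enumVal G D cB dB E (.inl .setup) s
          else enumVal G D cB dB E (.inl .log) s) = enumVal G D cB dB E (.inl .setup) s' ∧
      Logged x num den τ K s'.R ∧ s'.outputs = s.outputs ∧ s'.time ≤ s.time + m * κ := by
  induction m with
  | zero =>
    intro k hk s h
    rw [add_zero] at hk
    subst hk
    exact ⟨s, by simp [Nat.sub_eq_zero_of_le hK], h, rfl, by omega⟩
  | succ m ih =>
    intro k hk s h
    have hnum' : num * 2 ^ k < 2 ^ σ :=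
      (Nat.mul_le_mul_left _ (Nat.pow_le_pow_right two_pos (by omega))).trans_lt hnum
    obtain ⟨s₁, hv, h₁, ho, ht⟩ := log_spec (E := E) hκ h hτσ (by omega) hnum' hden
    obtain ⟨s₂, hv', h₂, ho', ht'⟩ := ih (k + 1) (by omega) s₁ h₁
    refine ⟨s₂, ?_, h₂, ho'.trans ho, by rw [add_mul]; omega⟩
    rw [if_neg (by have := hlt k (by omega); omega), hv, hv']

/-- Only registers 1 and 2 could exceed `2 ^ τ`, as they depend on the numerator and denominator of
`ε`. Once they are cleared, the invariant holds with `τ` in place of `σ`. -/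
theorem setup_spec (hκ : (enumerator G D cB dB).CostBound σ κ) {s : Mem} {K : ℕ}
    (h : Logged x num den τ K s.R) (hτσ : τ ≤ σ) (hnum : num * 2 ^ K < 2 ^ σ) (hden : den < 2 ^ σ)
    (hτ : 65 * x.length + 84 < 2 ^ τ) (hP : cB * (x.length + 1) ^ dB = P)
    (hL : 2 * (2 * (2 * P + 2) + K) = L) (hLτ : L < 2 ^ τ) (hcB : 2 < 2 ^ τ) :
    ∃ s', enumVal G D cB dB E (.inl .setup) s = enumVal G D cB dB E (.inl .main) s' ∧
      Inv x P L (65 * x.length + 74) τ [] L (65 * x.length + 74 + 1) s'.R ∧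
      s'.outputs = s.outputs ∧ s'.time ≤ s.time + κ := by
  obtain ⟨s', hv, hR, hO, ho, ht⟩ := Flow.val_goto (E := E) (n := .inl .setup) hκ rfl
    (by
      intro o ho
      simp only [enumerator, Ctl.ops, List.mem_append, List.mem_cons, List.mem_replicate,
        List.not_mem_nil, or_false] at ho
      rcases ho with (rfl | rfl | rfl | rfl) | ⟨-, rfl⟩ |
        (rfl | rfl | rfl | rfl | rfl | rfl | rfl | rfl) <;> trivial)
    (h.below' hτσ hnum hden)
  rw [(execL_silent 0 (by
      intro o ho
      simp only [enumerator, Ctl.ops, List.mem_append, List.mem_cons, List.mem_replicate,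
        List.not_mem_nil, or_false] at ho
      rcases ho with (rfl | rfl | rfl | rfl) | ⟨-, rfl⟩ |
        (rfl | rfl | rfl | rfl | rfl | rfl | rfl | rfl) <;> trivial) s).2] at ho
  change _ = runL 0 (Ctl.ops cB dB .setup) s.R at hR
  simp only [Ctl.ops, runL_append, runL_power] at hR
  simp [runL, Op.runR, h.r6, h.r7, h.r12, h.r16, hP] at hR
  have e11 : P + P + 2 + (P + P + 2) + K + (P + P + 2 + (P + P + 2) + K) = L := by omega
  rw [e11] at hR
  have hbig : ∀ a, 64 ≤ a → s'.R a = s.R a := by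
    intro a ha
    rw [hR]
    simp only [Function.update_apply]
    split_ifs <;> omega
  refine ⟨s', hv, ⟨⟨?_, ?_, ?_, ?_, ?_, ?_, ?_, ?_⟩, ?_, ?_, ?_, ?_, ?_, ?_⟩, ho, ht⟩
  · rw [hR]; simp [h.r6]
  · rw [hR]; simp [h.r7]
  · rw [hR]; simp
  · rw [hR]; simp [h.r12]
  · rw [hR]; simp
  · intro i hi
    have : s'.R 10 = 64 * x.length + 67 := by rw [hR]; simp [h.r10]
    rw [this, hbig _ (by omega), h.letters i hi]
  · rw [hR]; simp [h.r10]
  · rw [hR]; simp [h.r10]; omega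
  · rw [hR]; simp
  · rw [hR]; simp
  · omega
  · intro k
    have h1 := le_ad (65 * x.length + 74) k
    have h2 := Nat.le_mul_self (65 * x.length + 74)
    rw [hbig _ (by omega), h.zero _ (by omega)]; simp
  · intro r' hr' i
    have h1 := le_ad r' i
    have h2 := Nat.le_mul_self r'
    rw [hbig _ (by omega), h.zero _ (by omega)]
  · intro a
    rw [hR]
    have := h.below a
    simp only [Function.update_apply]
    split_ifs <;> omega

theorem prelude_spec (hκ : (enumerator G D cB dB).CostBound σ κ) {K : ℕ} (hτσ : τ ≤ σ)
    (hτ : 65 * x.length + 84 < 2 ^ τ) (hLτ : L < 2 ^ τ)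
    (hnum : num * 2 ^ K < 2 ^ σ) (hden : den < 2 ^ σ) (hden0 : 0 < den)
    (hK : den ≤ num * (2 ^ K - 1)) (hlt : ∀ k < K, num * (2 ^ k - 1) < den)
    (hP : cB * (x.length + 1) ^ dB = P) (hL : 2 * (2 * (2 * P + 2) + K) = L) {s : Mem}
    (hs : ∀ i, s.R i = (x.length :: num :: den :: x.codes).getD i 0) :
    ∃ s', enumVal G D cB dB E (.inl .start) s = enumVal G D cB dB E (.inl .main) s' ∧
      Inv x P L (65 * x.length + 74) τ [] L (65 * x.length + 74 + 1) s'.R ∧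
      s'.outputs = s.outputs ∧ s'.time ≤ s.time + (x.length + K + 3) * κ := by
  have hnum' : num < 2 ^ σ :=
    (Nat.le_mul_of_pos_right num (Nat.two_pow_pos K)).trans_lt hnum
  obtain ⟨s₁, hv₁, h₁, ho₁, ht₁⟩ := start_spec (E := E) hκ hs hτσ (by omega) hnum' hden
  obtain ⟨s₂, hv₂, h₂, ho₂, ht₂⟩ := copy_loop (E := E) hκ hτσ hτ hnum' hden x.length 0
    (by omega) s₁ h₁
  rw [Nat.sub_zero] at hv₂
  obtain ⟨s₃, hv₃, h₃, ho₃, ht₃⟩ := scan_spec (E := E) hκ h₂ hτσ hτ hnum' hden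
  obtain ⟨s₄, hv₄, h₄, ho₄, ht₄⟩ := log_loop (E := E) hκ hτσ (by omega) hnum hden hK hlt K 0
    (by omega) s₃ h₃
  -- The loop tests after its body, and before the first round the remainder is `den > 0`.
  rw [if_neg (by simp; omega)] at hv₄
  obtain ⟨s₅, hv₅, h₅, ho₅, ht₅⟩ := setup_spec (E := E) hκ h₄ hτσ hnum hden hτ hP hL hLτ (by omega)
  refine ⟨s₅, hv₁.trans (hv₂.trans (hv₃.trans (hv₄.trans hv₅))), h₅,
    ho₅.trans (ho₄.trans (ho₃.trans (ho₂.trans ho₁))), ?_⟩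
  have : (x.length + K + 3) * κ = x.length * κ + K * κ + κ + κ + κ := by ring
  omega

/-! ### Bounds on reachable registers, on the number of elements and on `K`. -/

theorem Machine.Sized.of_reach {M : Machine} {s : ℕ} {c₀ c : Cfg M.Λ} (h₀ : Machine.Sized s c₀)
    (hs : ∀ l, (M.code l).maxConst ≤ s) (h : Machine.Reach c₀ c) : Machine.Sized s c := by
  induction h with
  | refl => exact h₀
  | step v _ hv ih => exact ih.stepWith hs hv

theorem Machine.sized_init (M : Machine) {input : List ℕ} {s : ℕ} (h : ∀ a ∈ input, a ≤ s) :
    Machine.Sized s (M.init input) := by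
  refine ⟨fun i => ?_, fun i => by simp [init]⟩
  have hle : input.getD i 0 ≤ s := by
    by_cases hi : i < input.length
    · rw [List.getD_eq_getElem _ _ hi]; exact h _ (List.getElem_mem hi)
    · rw [List.getD_eq_default _ _ (by omega)]; omega
  exact (Nat.size_le.2 ((Nat.lt_two_pow_self).trans_le
    (Nat.pow_le_pow_right two_pos hle))).trans (Nat.le_add_right s _)

/-- A machine that stops in time `T` reaches only configurations with small registers. -/
theorem Machine.Reach.bounds {M : Machine} {E : Cfg M.Λ → Prop} {T s μ : ℕ} {input : List ℕ}
    (hE : ∀ c, E c → c.time ≤ T) (h₀ : M.prob input E = 1) (hin : ∀ a ∈ input, a ≤ s)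
    (hs : ∀ l, (M.code l).maxConst ≤ s) (hμ : s + T ≤ μ) {c : Cfg M.Λ}
    (h : Machine.Reach (M.init input) c) : c.time ≤ T ∧ ∀ i, c.R i < 2 ^ μ := by
  rw [prob_eq_value] at h₀
  have ht := h.time_le hE h₀
  refine ⟨ht, fun i => ?_⟩
  have := ((M.sized_init hin).of_reach hs h).1 i
  exact Nat.size_le.1 (by omega)

/-- The codes of the words are distinct numbers below `2 * 4 ^ P`. -/
theorem exists_finset_words {B : Word → Prop} {P : ℕ} (h : ∀ y, B y → y.length ≤ P) :
    ∃ S : Finset Word, (∀ y, y ∈ S ↔ B y) ∧ S.card ≤ 2 ^ (2 * P + 1) := by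
  have hfin : {y | B y}.Finite := (List.finite_length_le (Fin 3) P).subset h
  refine ⟨hfin.toFinset, by simp, ?_⟩
  rw [← Finset.card_range (2 ^ (2 * P + 1))]
  refine Finset.card_le_card_of_injOn (fun y => wordCode y.codes) (fun y hy => ?_) ?_
  · have hy' : B y := by simpa using hy
    have h1 := wordCode_lt y.codes_lt
    rw [y.length_codes] at h1
    have h2 : 4 ^ y.length ≤ 4 ^ P := Nat.pow_le_pow_right (by norm_num) (h y hy')
    have h3 : 2 ^ (2 * P + 1) = 2 * 4 ^ P := by rw [pow_succ, pow_mul]; ring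
    simp only [Finset.coe_range, Set.mem_Iio]
    omega
  · intro y _ z _ hyz
    exact Word.codes_injective (wordCode_inj y.codes_lt z.codes_lt hyz)

/-- The first property gives `2^-K < num / den`; minimality keeps `K` logarithmic. -/
theorem exists_log {num : ℕ} (den : ℕ) (hnum : 0 < num) :
    ∃ K, den ≤ num * (2 ^ K - 1) ∧ ∀ k < K, num * (2 ^ k - 1) < den := by
  have hex : ∃ K, den ≤ num * (2 ^ K - 1) :=
    ⟨den, (Nat.le_sub_one_of_lt Nat.lt_two_pow_self).trans (Nat.le_mul_of_pos_left _ hnum)⟩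
  classical
  exact ⟨Nat.find hex, Nat.find_spec hex, fun k hk => not_le.1 (Nat.find_min hex hk)⟩

/-! ### The source of randomness. -/

theorem Op.allowedBy_instr {Λ : Type} {S : RandomSource} {o : Op} {n : Λ}
    (h : o.Det) : (o.instr n).AllowedBy S := by
  cases o <;> cases S <;> trivial

theorem simOps_allowedBy {Λ N : Type} {S : RandomSource} {i : Instr Λ} (h : i.AllowedBy S)
    {o : Op} (ho : o ∈ simOps i) (n : N) : (o.instr n).AllowedBy S := by
  cases S
  · cases o with
    | random d s =>
      cases i <;> simp [simOps, read, write, fetch, place] at ho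
      exact h
    | _ => trivial
  · cases o <;> trivial

theorem Ctl.allowedBy_ops {Λ : Type} {S : RandomSource} {cB dB : ℕ} (c : Ctl) {o : Op}
    (ho : o ∈ c.ops cB dB) (n : Λ) : (o.instr n).AllowedBy S := by
  refine Op.allowedBy_instr ?_
  cases o with
  | coin d => cases c <;> simp [Ctl.ops, fetch, place] at ho
  | random d s => cases c <;> simp [Ctl.ops, fetch, place] at ho
  | _ => trivial

theorem Flow.isRandomized_machine {F : Flow} {S : RandomSource}
    (h : ∀ n, ∀ o ∈ F.ops n, (o.instr F.machine.start).AllowedBy S) :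
    F.machine.IsRandomized S := by
  rintro ⟨⟨n, l⟩, hl⟩
  cases l with
  | nil =>
    simp only [machine]
    cases F.exit n <;> cases S <;> trivial
  | cons o l =>
    have := h n o (hl.subset (List.mem_cons_self))
    revert this
    simp only [machine]
    cases o <;> cases S <;> exact id

/-- Control blocks and the simulated decision procedure are deterministic, and a random instruction
of the generator is simulated by one of the same kind. -/
theorem enumerator_isRandomized {G D : Machine} {S : RandomSource} (hG : G.IsRandomized S)
    (hD : D.IsDeterministic) (cB dB : ℕ) : (enumerator G D cB dB).machine.IsRandomized S := by
  refine Flow.isRandomized_machine ?_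
  rintro (c | l | l) o ho
  · exact c.allowedBy_ops ho _
  · refine simOps_allowedBy (S := S) (i := G.untilOutput.code l) ?_ ho _
    by_cases hl : G.AtOutput l
    · rw [Machine.untilOutput_code_of hl]; cases S <;> trivial
    · rw [Machine.untilOutput_code_of_not hl]; exact hG l
  · refine simOps_allowedBy (S := S) (i := D.code l) ?_ ho _
    have := hD l
    revert this
    cases D.code l <;> cases S <;> simp [Instr.IsDeterministic, Instr.AllowedBy]

/-! ### Explicit time and size bounds. -/

/-- The constants that govern the running time of the enumerating machine: the bounds for the
length of the elements, the time of the generator and the time of the decision procedure, a bound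
for the constants in their programs, and the cost of the blocks of the enumerating machine. -/
structure Constants : Type where
  cB : ℕ
  dB : ℕ
  cG : ℕ
  dG : ℕ
  cD : ℕ
  dD : ℕ
  maxConst : ℕ
  block : ℕ

namespace Constants

variable (p : Constants)

/-- A bound for the length of the elements. -/
def len (n : ℕ) : ℕ := p.cB * (n + 1) ^ p.dB

/-- A bound for the time of the generator. -/
def genTime (n : ℕ) : ℕ := p.cG * (n + 1) ^ p.dG

/-- A bound for the time of the decision procedure. -/
def decTime (n : ℕ) : ℕ := p.cD * (n + p.len n + 1) ^ p.dD

/-- The number of draws granted for every element. -/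
def bonus (n K : ℕ) : ℕ := 2 * (2 * (2 * p.len n + 2) + K)

/-- A bound for the size of all numbers in the simulated machines. -/
def bits (n K : ℕ) : ℕ :=
  p.maxConst + 67 * (n + p.len n) + p.genTime n + p.decTime n + p.bonus n K + 90

/-- A bound for the time of a draw. -/
def draw (n K : ℕ) : ℕ :=
  (n + p.genTime n + 2 * p.len n + p.decTime n + 12) * (p.block * (2 * p.bits n K + 3 + 1))

/-- A bound for the time between two outputs. -/
def delay (n K : ℕ) : ℕ := p.draw n K * p.bonus n K

/-- A bound for the time of the precomputation. -/
def pre (n K Z : ℕ) : ℕ :=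
  -- The summands are the actual precomputation, with the bits of `ε` entering through `Z`, the `L`
  -- surplus draws, and the final budget test.
  (n + K + 3) * (p.block * (2 * p.bits n K + 3 + Z + K + 1)) + p.draw n K * p.bonus n K +
    p.block * (2 * p.bits n K + 3 + 1)

end Constants

theorem mem_inputWord_le {x : Word} {a : ℕ} (ha : a ∈ inputWord x) : a ≤ x.length + 3 := by
  rcases List.mem_cons.1 ha with rfl | ha
  · omega
  · have := x.codes_lt a ha; omega

theorem mem_inputPair_le {x y : Word} {a : ℕ} (ha : a ∈ inputPair x y) :
    a ≤ x.length + y.length + 3 := by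
  simp only [inputPair, List.mem_cons, List.mem_append] at ha
  rcases ha with rfl | rfl | ha | ha
  · omega
  · omega
  · have := x.codes_lt a ha; omega
  · have := y.codes_lt a ha; omega

/-! ### The success probability of the enumerating machine. -/

section

variable {A : Word → Word → Prop} {G D : Machine} {p : Constants}

/-- `bits` dominates every relevant exponent linearly, so most conditions reduce to `m < 2 ^ m`; the
register bounds come from `Machine.Reach.bounds`. -/
theorem setting_of_constants {x : Word} (K : ℕ)
    (hG : G.prob (inputWord x) (fun z => z.time ≤ p.cG * (x.length + 1) ^ p.dG) = 1)
    (hD : ∀ y : Word, D.prob (inputPair x y)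
      (fun z => z.time ≤ p.cD * (x.length + y.length + 1) ^ p.dD ∧ (z.R 0 ≠ 0 ↔ A x y)) = 1)
    (hA : ∀ y : Word, A x y → y.length ≤ p.cB * (x.length + 1) ^ p.dB)
    (hGc : ∀ l, (G.code l).maxConst < p.maxConst) (hDc : ∀ l, (D.code l).maxConst < p.maxConst)
    (hb : ∀ (n : (enumerator G D p.cB p.dB).Node) (v σ : ℕ) (s : Mem), v < 2 ^ σ → Below σ s.R →
      (execL v ((enumerator G D p.cB p.dB).ops n) s).time + 1 ≤ s.time + p.block * (σ + 1)) :
    Setting G D p.cB p.dB A x (p.len x.length) (p.bits x.length K)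
      (p.block * (2 * p.bits x.length K + 3 + 1)) (p.genTime x.length) (p.decTime x.length) where
  cost n v s := hb n v _ s
  len_lt := by
    refine lt_of_le_of_lt ?_ Nat.lt_two_pow_self
    unfold Constants.bits; omega
  code_lt := by
    rw [show 2 * 4 ^ p.len x.length = 2 ^ (2 * p.len x.length + 1) by
      rw [pow_succ, pow_mul]; ring]
    refine Nat.pow_lt_pow_right (by norm_num) ?_
    unfold Constants.bits; omega
  balanced := hA
  constG l := (hGc l).trans (lt_of_le_of_lt (by unfold Constants.bits; omega) Nat.lt_two_pow_self)
  constD l := (hDc l).trans (lt_of_le_of_lt (by unfold Constants.bits; omega) Nat.lt_two_pow_self)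
  reachG c hc := by
    refine hc.bounds (T := p.genTime x.length) (s := p.maxConst + x.length + 3) (fun c h => h) hG
      (fun a ha => ?_) (fun l => ?_) ?_
    · have := mem_inputWord_le ha; omega
    · have := hGc l; omega
    · unfold Constants.bits; omega
  reachD y hy c hc := by
    refine hc.bounds (T := p.decTime x.length) (s := p.maxConst + x.length + p.len x.length + 3)
      (fun c h => h.1.trans ?_) (hD y) (fun a ha => ?_) (fun l => ?_) ?_
    · have := mem_inputPair_le ha; omega
    · have := hDc l; omega
    · unfold Constants.bits; omega
    · unfold Constants.decTime
      gcongr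
  valueD y := by
    have h := hD y
    rw [Machine.prob_eq_value] at h
    refine le_antisymm (Machine.value_ind_le_one _ _) (h.ge.trans ?_)
    refine Machine.value_mono_of_reach fun c _ _ => ?_
    unfold Machine.ind
    by_cases h1 : c.R 0 ≠ 0 ↔ A x y
    · simp only [h1, if_true]; split_ifs <;> simp
    · simp [h1]

theorem generator_value {x : Word} {S : Finset Word} (hS : ∀ y, y ∈ S ↔ A x y)
    (hG : ∀ y : Word, A x y →
      G.prob (inputWord x) (fun z => z.outputs.map Prod.fst = [y.codes]) =
        ((Set.ncard {y' : Word | A x y'} : ℕ) : ℝ≥0∞)⁻¹) (y : Word) (hy : y ∈ S) :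
    (S.card : ℝ≥0∞)⁻¹ ≤ G.untilOutput.value
      (Machine.ind fun c => G.AtOutput c.label ∧ c.word = y.codes)
      (G.untilOutput.init (inputWord x)) := by
  have h1 : {y' : Word | A x y'} = S := by ext y'; simp [hS]
  have h := hG y ((hS y).1 hy)
  rw [h1, Set.ncard_coe_finset, Machine.prob_eq_value] at h
  rw [← h]
  exact iSup_mono fun N => Machine.ev_le_ev_untilOutput _ N _ rfl

theorem enumerator_prob {x : Word} {num den K : ℕ}
    (hG : G.prob (inputWord x) (fun z => z.time ≤ p.cG * (x.length + 1) ^ p.dG) = 1)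
    (hGy : ∀ y : Word, A x y →
      G.prob (inputWord x) (fun z => z.outputs.map Prod.fst = [y.codes]) =
        ((Set.ncard {y' : Word | A x y'} : ℕ) : ℝ≥0∞)⁻¹)
    (hD : ∀ y : Word, D.prob (inputPair x y)
      (fun z => z.time ≤ p.cD * (x.length + y.length + 1) ^ p.dD ∧ (z.R 0 ≠ 0 ↔ A x y)) = 1)
    (hA : ∀ y : Word, A x y → y.length ≤ p.cB * (x.length + 1) ^ p.dB)
    (hGc : ∀ l, (G.code l).maxConst < p.maxConst) (hDc : ∀ l, (D.code l).maxConst < p.maxConst)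
    (hb : ∀ (n : (enumerator G D p.cB p.dB).Node) (v σ : ℕ) (s : Mem), v < 2 ^ σ → Below σ s.R →
      (execL v ((enumerator G D p.cB p.dB).ops n) s).time + 1 ≤ s.time + p.block * (σ + 1))
    (hden : 0 < den) (hK : den ≤ num * (2 ^ K - 1)) (hlt : ∀ k < K, num * (2 ^ k - 1) < den) :
    1 ≤ (enumerator G D p.cB p.dB).machine.prob (x.length :: num :: den :: x.codes)
      (fun c => Enumerated A x (p.pre x.length K (num.size + den.size)) (p.delay x.length K) c.mem) +
        ENNReal.ofReal ((1 / 2) ^ K) := by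
  set P := p.len x.length with hP
  set L := p.bonus x.length K with hL
  set μ := p.bits x.length K with hμ
  set Z := num.size + den.size with hZ
  have hμ' : μ = p.maxConst + 67 * (x.length + P) + p.genTime x.length + p.decTime x.length + L +
    90 := rfl
  have hL' : 2 * (2 * (2 * P + 2) + K) = L := rfl
  have hset : Setting G D p.cB p.dB A x P μ (p.block * (2 * μ + 3 + 1)) (p.genTime x.length)
      (p.decTime x.length) := setting_of_constants (p := p) K hG hD hA hGc hDc hb
  obtain ⟨S, hS, hcard⟩ := exists_finset_words (P := P) hA
  have hpow : ∀ m n : ℕ, m ≤ n → m < 2 ^ n := fun m n h => h.trans_lt Nat.lt_two_pow_self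
  rw [Flow.prob_machine (F := enumerator G D p.cB p.dB)
    (E := Enumerated A x (p.pre x.length K Z) (p.delay x.length K))]
  obtain ⟨s, hv, hinv, ho, ht⟩ := prelude_spec
    (E := Enumerated A x (p.pre x.length K Z) (p.delay x.length K)) (G := G) (D := D)
    (x := x) (L := L) (P := P) (num := num) (den := den)
    (s := ⟨fun i => (x.length :: num :: den :: x.codes).getD i 0, fun _ => 0, 0, []⟩)
    -- During the precomputation numbers as large as `num * 2 ^ K` and `den` occur; `Z + K` bits
    -- suffice for them.
    (σ := 2 * μ + 3 + Z + K) (τ := 2 * μ + 3) (κ := p.block * (2 * μ + 3 + Z + K + 1))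
    (fun n v s => hb n v _ s) (by omega) (hpow _ _ (by omega)) (hpow _ _ (by omega)) (by
      refine (Nat.mul_lt_mul_of_pos_right (Nat.lt_size_self num) (by positivity)).trans_le ?_
      rw [← pow_add]
      exact Nat.pow_le_pow_right two_pos (by omega)) ((Nat.lt_size_self den).trans_le
        (Nat.pow_le_pow_right two_pos (by omega))) hden hK hlt rfl hL' fun i => rfl
  have ht' : s.time ≤ (x.length + K + 3) * (p.block * (2 * μ + 3 + Z + K + 1)) := by
    simpa using ht
  have ho' : s.outputs = [] := ho
  have hE : ∀ s, Enumerated A x ((x.length + K + 3) * (p.block * (2 * μ + 3 + Z + K + 1)) +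
      drawTime x P (p.block * (2 * μ + 3 + 1)) (p.genTime x.length) (p.decTime x.length) * L +
      p.block * (2 * μ + 3 + 1))
      (drawTime x P (p.block * (2 * μ + 3 + 1)) (p.genTime x.length) (p.decTime x.length) * L) s →
      Enumerated A x (p.pre x.length K Z) (p.delay x.length K) s := fun s h => h
  -- Four new regions are used per draw. Their number may be exponential in `P`, but `μ` exceeds `2P
  -- + 4 + L`, so their numbers still have few bits.
  have hbound : 65 * x.length + 74 + 9 + 4 * (L * (S.card + 2)) < 2 ^ μ := by
    have h1 : S.card + 2 ≤ 2 ^ (2 * P + 1) + 2 ^ (2 * P + 1) :=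
      add_le_add hcard ((pow_one 2).ge.trans (Nat.pow_le_pow_right two_pos (by omega)))
    have h2 : L ≤ 2 ^ L := Nat.lt_two_pow_self.le
    have h3 : 4 * (L * (S.card + 2)) ≤ 2 ^ (2 * P + 4 + L) := by
      calc 4 * (L * (S.card + 2)) ≤ 4 * (2 ^ L * (2 ^ (2 * P + 1) + 2 ^ (2 * P + 1))) := by gcongr
        _ = 2 ^ (2 * P + 4 + L) := by ring
    have h4 : 65 * x.length + 83 < 2 ^ (65 * x.length + 83) := Nat.lt_two_pow_self
    have h5 : 2 ^ (2 * P + 4 + L) ≤ 2 ^ (μ - 1) := Nat.pow_le_pow_right two_pos (by omega)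
    have h6 : 2 ^ (65 * x.length + 83) ≤ 2 ^ (μ - 1) := Nat.pow_le_pow_right two_pos (by omega)
    have h7 : 2 ^ μ = 2 ^ (μ - 1) + 2 ^ (μ - 1) := by
      rw [← two_mul, ← pow_succ', Nat.sub_add_cancel (by omega)]
    omega
  refine le_trans ?_ (add_le_add_left hv.ge _)
  rcases S.eq_empty_or_nonempty with rfl | hne
  · refine le_trans ?_ le_self_add
    obtain ⟨b, hb'⟩ : ∃ b, L = b + 1 := ⟨L - 1, by omega⟩
    have hinv' : Inv x P L (65 * x.length + 74) (2 * μ + 3) [] (b + 1) (65 * x.length + 74 + 1)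
        s.R := hb' ▸ hinv
    refine main_spec_of_empty hset (fun y hy => by simpa using (hS y).2 hy) ?_ (by omega) ?_ hE
      (by omega) ht' ho' hinv'
    · rw [Machine.prob_eq_value] at hG
      refine le_antisymm ((iSup_le fun N => Machine.ev_const_le _ _ _)) (hG.ge.trans ?_)
      exact Machine.value_mono_of_reach fun c _ _ => Machine.ind_le_one _ c
    · simp at hbound; omega
  · have h4 : L * (S.card + 1) ≤ L * (S.card + 2) := Nat.mul_le_mul_left _ (by omega)
    have hmain := main_spec hset hS (generator_value hS hGy) (r₀ := 65 * x.length + 74)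
      (L := L) (by omega) (by omega) hE hne (L + L * (S.card - 0)) [] L 0 s rfl
      ⟨List.nodup_nil, by simp [ho'], by simp, by simpa using ht', by simp [ho']⟩ hinv (by simp)
    refine hmain.trans (add_le_add_right ?_ _)
    -- This `N` is the one built into the bonus; `2P + 1` would already bound the cardinality.
    have hfb := failBound_le (A := S) (N := 2 * P + 2) (K := K)
      (hcard.trans (Nat.pow_le_pow_right two_pos (by omega))) hne.card_pos
    exact hfb

end

/-! ### Polynomial growth of the bounds. -/

/-- The function is bounded by a polynomial. -/
def PolyBounded (f : ℕ → ℕ) : Prop := ∃ c d : ℕ, ∀ n, f n ≤ c * (n + 1) ^ d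

namespace PolyBounded

theorem const (a : ℕ) : PolyBounded fun _ => a := ⟨a, 0, fun n => by simp⟩

theorem id : PolyBounded fun n => n := ⟨1, 1, fun n => by simp⟩

theorem add {f g : ℕ → ℕ} (hf : PolyBounded f) (hg : PolyBounded g) :
    PolyBounded fun n => f n + g n := by
  obtain ⟨c, d, h⟩ := hf
  obtain ⟨c', d', h'⟩ := hg
  refine ⟨c + c', d + d', fun n => ?_⟩
  rw [add_mul]
  refine add_le_add ((h n).trans ?_) ((h' n).trans ?_)
  · gcongr <;> omega
  · gcongr <;> omega

theorem mul {f g : ℕ → ℕ} (hf : PolyBounded f) (hg : PolyBounded g) :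
    PolyBounded fun n => f n * g n := by
  obtain ⟨c, d, h⟩ := hf
  obtain ⟨c', d', h'⟩ := hg
  refine ⟨c * c', d + d', fun n => ?_⟩
  rw [pow_add, mul_mul_mul_comm]
  exact Nat.mul_le_mul (h n) (h' n)

theorem pow {f : ℕ → ℕ} (hf : PolyBounded f) (k : ℕ) : PolyBounded fun n => f n ^ k := by
  induction k with
  | zero => exact const 1
  | succ k ih => exact ih.mul hf

end PolyBounded

namespace Constants

variable (p : Constants)

theorem polyBounded_len : PolyBounded p.len :=
  (PolyBounded.const _).mul ((PolyBounded.id.add (.const 1)).pow _)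

theorem polyBounded_genTime : PolyBounded p.genTime :=
  (PolyBounded.const _).mul ((PolyBounded.id.add (.const 1)).pow _)

theorem polyBounded_decTime : PolyBounded p.decTime :=
  (PolyBounded.const _).mul (((PolyBounded.id.add p.polyBounded_len).add (.const 1)).pow _)

/-- The bounds are monotone in all arguments, so polynomials in one variable suffice: the arguments
are later replaced by a common majorant. -/
theorem polyBounded_bonus : PolyBounded fun n => p.bonus n n :=
  (PolyBounded.const _).mul (((PolyBounded.const _).mul
    (((PolyBounded.const _).mul p.polyBounded_len).add (.const _))).add .id)

theorem polyBounded_bits : PolyBounded fun n => p.bits n n :=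
  (((((PolyBounded.const _).add ((PolyBounded.const _).mul
    (PolyBounded.id.add p.polyBounded_len))).add p.polyBounded_genTime).add
      p.polyBounded_decTime).add p.polyBounded_bonus).add (.const _)

theorem polyBounded_draw : PolyBounded fun n => p.draw n n :=
  ((((PolyBounded.id.add p.polyBounded_genTime).add
    ((PolyBounded.const _).mul p.polyBounded_len)).add p.polyBounded_decTime).add (.const _)).mul
      ((PolyBounded.const _).mul
        ((((PolyBounded.const _).mul p.polyBounded_bits).add (.const _)).add (.const _)))

theorem polyBounded_delay : PolyBounded fun n => p.delay n n :=
  p.polyBounded_draw.mul p.polyBounded_bonus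

theorem polyBounded_pre : PolyBounded fun n => p.pre n n n :=
  ((((PolyBounded.id.add .id).add (.const _)).mul ((PolyBounded.const _).mul
    (((((((PolyBounded.const _).mul p.polyBounded_bits).add (.const _)).add .id).add .id).add
      (.const _))))).add p.polyBounded_delay).add ((PolyBounded.const _).mul
        ((((PolyBounded.const _).mul p.polyBounded_bits).add (.const _)).add (.const _)))

variable {p} {n n' K K' Z Z' : ℕ}

theorem bits_mono (hn : n ≤ n') (hK : K ≤ K') : p.bits n K ≤ p.bits n' K' := by
  unfold bits bonus decTime genTime len
  gcongr

theorem delay_mono (hn : n ≤ n') (hK : K ≤ K') : p.delay n K ≤ p.delay n' K' := by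
  have := bits_mono (p := p) hn hK
  unfold delay draw bonus decTime genTime len
  gcongr

theorem pre_mono (hn : n ≤ n') (hK : K ≤ K') (hZ : Z ≤ Z') : p.pre n K Z ≤ p.pre n' K' Z' := by
  have h1 := bits_mono (p := p) hn hK
  have h2 := delay_mono (p := p) hn hK
  unfold delay at h2
  unfold pre
  gcongr

end Constants

/-! ### The dependence on `ε` and the conclusion. -/

theorem log_le_size {num den K : ℕ} (hnum : 0 < num) (hlt : ∀ k < K, num * (2 ^ k - 1) < den) :
    K ≤ den.size := by
  rcases K with _ | k
  · exact Nat.zero_le _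
  · have h1 := (Nat.le_mul_of_pos_left (2 ^ k - 1) hnum).trans_lt (hlt k (by omega))
    exact Nat.lt_size.2 (by omega)

/-- Minimality at `k = K - 1` and `num ≤ den` give `2^k ≤ 2 den / num`. Taking logarithms, with `log
2 > 1/2`, yields `K ≤ 2 + 2 log (den / num)`. -/
theorem log_le_log {num den K : ℕ} (hnum : 0 < num) (hle : num ≤ den)
    (hlt : ∀ k < K, num * (2 ^ k - 1) < den) :
    (K : ℝ) + 1 ≤ 3 * (1 + Real.log ((num : ℝ) / den)⁻¹) := by
  have hn : (0 : ℝ) < num := by exact_mod_cast hnum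
  have hd : (0 : ℝ) < den := by exact_mod_cast hnum.trans_le hle
  have hle' : (1 : ℝ) ≤ den / num := by rw [one_le_div hn]; exact_mod_cast hle
  rw [inv_div]
  have hlog := Real.log_nonneg hle'
  rcases K with _ | k
  · push_cast; linarith
  · have h1 : (num : ℝ) * (2 ^ k - 1) < den := by
      have := hlt k (by omega)
      have h2 : ((2 ^ k - 1 : ℕ) : ℝ) = 2 ^ k - 1 := by
        rw [Nat.cast_sub Nat.one_le_two_pow]; norm_num
      rw [← h2]; exact_mod_cast this
    have h2 : (2 : ℝ) ^ k ≤ 2 * (den / num) := by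
      have : (2 : ℝ) ^ k - 1 < den / num := by rw [lt_div_iff₀ hn, mul_comm]; exact h1
      linarith
    have h3 := Real.log_le_log (by positivity) h2
    rw [Real.log_pow, Real.log_mul (by norm_num) (by positivity)] at h3
    have h4 := Real.log_two_gt_d9
    have h5 : (k : ℝ) * Real.log 2 ≤ Real.log 2 + Real.log (den / num) := h3
    have h6 : ((k : ℝ) - 1) * (1 / 2) ≤ Real.log (den / num) := by
      rcases le_total (k : ℝ) 1 with h | h
      · nlinarith
      · nlinarith
    push_cast
    linarith

theorem Enumerated.enumeratesInTime {A : Word → Word → Prop} {x : Word} {T V : ℕ} {Λ : Type}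
    {c : Cfg Λ} (h : Enumerated A x T V c.mem) {pre : ℝ} {f : ℕ → ℝ} (hT : (T : ℝ) ≤ pre)
    (hV : ∀ m : ℕ, (V : ℝ) * m ≤ f m) : EnumeratesInTime A x pre f c := by
  refine ⟨h.words, fun i hi => ?_, ?_⟩
  · have h1 := h.outputTime i hi
    have h2 : ((c.outputs[i].2 : ℕ) : ℝ) ≤ T + V * ((i + 1 : ℕ) : ℝ) := by exact_mod_cast h1
    exact h2.trans (add_le_add hT (hV _))
  · have h2 : ((c.time : ℕ) : ℝ) ≤ T + V * (c.outputs.length : ℝ) := by exact_mod_cast h.time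
    exact h2.trans (add_le_add hT (hV _))

/-- The probability that the machine succeeds is more than `1 - ε`. -/
theorem lt_toReal_of_half_pow {q : ℝ≥0∞} (hq : q ≤ 1) {K num den : ℕ} (hnum : 0 < num)
    (hden : 0 < den) (hK : den ≤ num * (2 ^ K - 1))
    (h : 1 ≤ q + ENNReal.ofReal ((1 / 2) ^ K)) : 1 - (num : ℝ) / den < q.toReal := by
  have hfin : q ≠ ⊤ := ne_top_of_le_ne_top ENNReal.one_ne_top hq
  have h1 := ENNReal.toReal_mono (by simp [hfin]) h
  rw [ENNReal.toReal_add hfin (by simp), ENNReal.toReal_ofReal (by positivity),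
    ENNReal.toReal_one] at h1
  have h2 : ((1 : ℝ) / 2) ^ K < num / den := by
    have h3 : den < num * 2 ^ K := by
      refine hK.trans_lt (Nat.mul_lt_mul_of_pos_left ?_ hnum)
      have := Nat.two_pow_pos K
      omega
    rw [div_pow, one_pow, div_lt_div_iff₀ (by positivity) (by exact_mod_cast hden), one_mul]
    exact_mod_cast h3
  linarith

/-- Only the lower bound on `g` matters, so both forms of the dependence on `ε` are instances. -/
theorem hasRandomizedEnumeration {S : RandomSource} {A : Word → Word → Prop} (hA : EnumP A)
    (hgen : HasUniformGenerator S A) {g : ℝ → ℝ}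
    (hg : ∀ ε : ℝ, 0 < ε → ε ≤ 1 → 1 + Real.log ε⁻¹ ≤ g ε) :
    HasRandomizedEnumeration S 1 g A := by
  obtain ⟨⟨D, cD, dD, hDdet, hD⟩, cB, dB, hB⟩ := hA
  obtain ⟨G, cG, dG, hGS, hG⟩ := hgen
  obtain ⟨C, hC⟩ := (enumerator G D cB dB).exists_blockCost
  obtain ⟨mG, hmG⟩ := G.exists_maxConst
  obtain ⟨mD, hmD⟩ := D.exists_maxConst
  set p : Constants := ⟨cB, dB, cG, dG, cD, dD, mG + mD, C⟩ with hp
  obtain ⟨c₁, d₁, h₁⟩ := p.polyBounded_delay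
  obtain ⟨c₂, d₂, h₂⟩ := p.polyBounded_pre
  refine ⟨(enumerator G D cB dB).machine, d₁, d₁, c₁ * 6 ^ d₁, c₂, d₂,
    enumerator_isRandomized hGS hDdet cB dB, fun x ε hε => ?_⟩
  -- For `ε > 1` the required probability is negative, so nothing has to be shown.
  rcases lt_or_ge 1 ε with h1 | h1
  · have : (1 : ℝ) < ε := by exact_mod_cast h1
    exact lt_of_lt_of_le (by linarith) ENNReal.toReal_nonneg
  have hnum : 0 < ε.num.toNat := by
    have := Rat.num_pos.2 hε; omega
  have hden := ε.den_pos
  have hεeq : (ε : ℝ) = (ε.num.toNat : ℝ) / ε.den := by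
    have h2 : ((ε.num.toNat : ℤ) : ℝ) = (ε.num : ℝ) := by
      rw [Int.toNat_of_nonneg (Rat.num_pos.2 hε).le]
    rw [Int.cast_natCast] at h2
    rw [h2, ← Rat.cast_def]
  obtain ⟨K, hK, hlt⟩ := exists_log ε.den hnum
  have hprob := enumerator_prob (p := p) (hG x).1 (hG x).2 (hD x) (hB x)
    (fun l => (hmG l).trans_le (Nat.le_add_right _ _))
    (fun l => (hmD l).trans_le (Nat.le_add_left _ _)) hC hden hK hlt
  have hε0 : (0 : ℝ) < ε := by exact_mod_cast hε
  have hε1 : (ε : ℝ) ≤ 1 := by exact_mod_cast h1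
  have hKg : (K : ℝ) + 1 ≤ 3 * g ε := by
    have hle : ε.num.toNat ≤ ε.den := by
      rw [hεeq, div_le_one (by exact_mod_cast hden)] at hε1
      exact_mod_cast hε1
    refine (log_le_log hnum hle hlt).trans ?_
    rw [← hεeq]
    exact mul_le_mul_of_nonneg_left (hg ε hε0 hε1) (by norm_num)
  rw [show 1 - (ε : ℝ) = 1 - (ε.num.toNat : ℝ) / ε.den by rw [hεeq]]
  refine lt_toReal_of_half_pow ?_ hnum hden hK (hprob.trans (add_le_add_left ?_ _))
  · rw [Machine.prob_eq_value]; exact Machine.value_ind_le_one _ _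
  rw [Machine.prob_eq_value, Machine.prob_eq_value]
  refine Machine.value_mono_of_reach fun c _ _ => ?_
  have himp : Enumerated A x (p.pre x.length K (ε.num.toNat.size + ε.den.size))
      (p.delay x.length K) c.mem → EnumeratesInTime A x
        ((c₂ : ℝ) * ((sizeWordRat x ε : ℝ) + 1) ^ d₂)
        (fun m => ((c₁ * 6 ^ d₁ : ℕ) : ℝ) * (m : ℝ) ^ 1 * ((x.length : ℝ) + 1) ^ d₁ *
          g ε ^ d₁) c := by
    intro h
    refine h.enumeratesInTime ?_ fun m => ?_
    · have hKs := log_le_size hnum hlt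
      have := (Constants.pre_mono (p := p) (n := x.length) (n' := sizeWordRat x ε) (K := K)
        (K' := sizeWordRat x ε) (Z := ε.num.toNat.size + ε.den.size) (Z' := sizeWordRat x ε)
        (by unfold sizeWordRat; omega) (by unfold sizeWordRat; omega)
        (by unfold sizeWordRat; omega)).trans (h₂ _)
      exact_mod_cast this
    -- The majorant `|x| + K + |x| K` is chosen because adding 1 gives `(|x| + 1)(K + 1)`, which
    -- separates the two dependences.
    · have hw := (Constants.delay_mono (p := p) (n := x.length) (K := K)
        (n' := x.length + K + x.length * K) (K' := x.length + K + x.length * K)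
        (by rw [add_assoc]; omega) (by rw [add_right_comm]; omega)).trans (h₁ _)
      have hw' : p.delay x.length K ≤ c₁ * ((x.length + 1) * (K + 1)) ^ d₁ := by
        refine hw.trans (le_of_eq ?_)
        congr 2
        ring
      have hw'' : (p.delay x.length K : ℝ) ≤ c₁ * (((x.length : ℝ) + 1) * (K + 1)) ^ d₁ := by
        exact_mod_cast hw'
      have h3 : c₁ * (((x.length : ℝ) + 1) * (K + 1)) ^ d₁ ≤
          c₁ * (((x.length : ℝ) + 1) * (6 * g ε)) ^ d₁ := by
        gcongr
        linarith [show (0 : ℝ) ≤ K from K.cast_nonneg]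
      calc (p.delay x.length K : ℝ) * m
          ≤ c₁ * (((x.length : ℝ) + 1) * (6 * g ε)) ^ d₁ * m := by
            gcongr; exact hw''.trans h3
        _ = _ := by push_cast; rw [mul_pow, mul_pow]; ring
  unfold Machine.ind
  split_ifs with h2 h3
  · exact le_rfl
  · exact absurd (himp h2) h3
  · exact zero_le
  · exact le_rfl

end EnumRAM

theorem mainTheorem3 (S : EnumRAM.RandomSource) (A : EnumRAM.Word → EnumRAM.Word → Prop)
    (hA : EnumRAM.EnumP A) (hgen : EnumRAM.HasUniformGenerator S A) :
    EnumRAM.RandomizedIncP S 1 A ∧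
      EnumRAM.HasRandomizedEnumeration S 1 (fun ε => 1 + Real.log ε⁻¹) A := by
  refine ⟨⟨hA, EnumRAM.hasRandomizedEnumeration hA hgen fun ε hε _ => ?_⟩,
    EnumRAM.hasRandomizedEnumeration hA hgen fun ε _ _ => le_rfl⟩
  -- For `g ε = ε⁻¹` the lower bound is the inequality `log t ≤ t - 1`.
  have := Real.log_le_sub_one_of_pos (inv_pos.2 hε)
  linarith
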